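/- Let $X$ be a compact smooth 4-manifold and $E\to X$ a smooth real vector bundle of rank 3 with a smooth fibrewise inner product (for instance an $SO(3)$-bundle). Equip the bundle $\mathfrak{so}(E)$ of skew endomorphisms with the inner product $\langle\xi,\eta\rangle=-c\,\mathrm{tr}(\xi\eta)$ for a constant $c>0$ ($c=1$ is minus the Killing form; for $c=\tfrac12$ a fibrewise orientation of $E$ gives an isometry $E\cong\mathfrak{so}(E)$). A smooth metric connection $A$ in $E$ is called definite if its curvature satisfies $F_A(u,v)\neq 0$ for all linearly independent tangent vectors $u,v$. Write locally $F_A=\sum_i F_i\otimes e_i$ with $e_1,e_2,e_3$ an orthonormal frame of $\mathfrak{so}(E)$. For a definite connection $A$ the 4-form $\mu(A)=\frac13\sum_i F_i\wedge F_i$ is nowhere zero. Orient $X$ by $\mu(A)$ and let $g_A$ be the (unique) Riemannian metric with volume form $\mu(A)$ for which $F_1,F_2,F_3$ span the bundle of self-dual 2-forms. Let $Q(A)$ be the self-adjoint endomorphism of $\mathfrak{so}(E)$ with matrix $Q(A)_{ij}=(F_i\wedge F_j)/\mu(A)$, put $|Q(A)|^2=\mathrm{tr}(Q(A)^2)$,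 and define the energy $$\mathcal E(A)=\int_X |Q(A)|^2\,\mu(A).$$ On the space $\mathcal D$ of definite connections, whose tangent space at $A$ is $\Omega^1(X,\mathfrak{so}(E))$, use the $L^2(g_A)$ inner product $\langle a,b\rangle=\int_X (a,b)_{g_A}\,\mu(A)$. Let $d_A^*\colon\Omega^2(X,\mathfrak{so}(E))\to\Omega^1(X,\mathfrak{so}(E))$ be the $L^2(g_A)$-adjoint of $d_A$, and let $$B_A=4Q(A)-\tfrac23|Q(A)|^2\,\mathrm{Id},$$ with $B_A(F_A)\in\Omega^2(X,\mathfrak{so}(E))$ the result of applying $B_A$ to the $\mathfrak{so}(E)$-factor of $F_A$ and leaving the 2-form part unchanged. Then, for every definite connection $A$, these objects are well defined, and $d_A^*(B_A(F_A))$ is the gradient of $\mathcal E$ at $A$: it is the unique $\xi\in\Omega^1(X,\mathfrak{so}(E))$ such that $\frac{d}{dt}\big|_{t=0}\mathcal E(A+ta)=\langle\xi,a\rangle$ for all $a\in\Omega^1(X,\mathfrak{so}(E))$. Consequently, a path $A(t)$ of definite connections, defined for $t$ in a nondegenerate interval, is a downward gradient flow line of $\mathcal E$ (that is, $\partial A/\partial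 t=-\operatorname{grad}\mathcal E(A)$) if and only if $$\frac{\partial A}{\partial t}=-d_A^*\big(B_A(F_A)\big).$$ -/

import Mathlib

open Bundle FiberBundle
open scoped Manifold ContDiff

noncomputable section

namespace DefiniteConnection

/-- The model `ℝ⁴` of the base manifold. -/
abbrev R4 : Type := EuclideanSpace ℝ (Fin 4)

/-- The model `ℝ³` of the fibres of the bundle. -/
abbrev R3 : Type := EuclideanSpace ℝ (Fin 3)

/-- The wedge product of two 2-forms `α`, `β` with values in `W`, `W'`, evaluated on four vectors;
the values are multiplied by the pairing `m`. -/
def wedge {T W W' U : Type*} [AddCommGroup U] (m : W → W' → U)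
    (α : T → T → W) (β : T → T → W') (v : Fin 4 → T) : U :=
  m (α (v 0) (v 1)) (β (v 2) (v 3)) - m (α (v 0) (v 2)) (β (v 1) (v 3))
    + m (α (v 0) (v 3)) (β (v 1) (v 2)) + m (α (v 1) (v 2)) (β (v 0) (v 3))
    - m (α (v 1) (v 3)) (β (v 0) (v 2)) + m (α (v 2) (v 3)) (β (v 0) (v 1))

/-- The multiple `-c tr(ξη)` of the trace form.  On the skew endomorphisms of a three-dimensional
Euclidean space it is, for `c > 0`, an invariant inner product (any invariant inner product has this
form).  For `c = 1` it is minus the Killing form of `𝔰𝔬(3)`; for `c = 1/2` it is the one for which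
the cross product identifies `𝔰𝔬(3)` isometrically with `ℝ³`. -/
def soInner {W : Type*} [AddCommGroup W] [Module ℝ W] (c : ℝ) (ξ η : Module.End ℝ W) : ℝ :=
  -c * LinearMap.trace ℝ W (ξ * η)

section Density

variable {X : Type*} [TopologicalSpace X] [ChartedSpace R4 X]

/-- The coordinate vector field `∂ᵢ`, at the point with coordinates `y` in the chart at `p`. -/
def coordField (p : X) (y : R4) (i : Fin 4) :
    TangentSpace (𝓡 4) ((extChartAt (𝓡 4) p).symm y) :=
  mfderiv 𝓘(ℝ, R4) (𝓡 4) (extChartAt (𝓡 4) p).symm y (EuclideanSpace.single i (1 : ℝ) : R4)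

variable [IsManifold (𝓡 4) ∞ X] [T2Space X] [CompactSpace X]

/-- A smooth partition of unity, subordinate to the cover by chart domains. -/
def chartPartition (X : Type*) [TopologicalSpace X] [ChartedSpace R4 X]
    [IsManifold (𝓡 4) ∞ X] [T2Space X] [CompactSpace X] :
    SmoothPartitionOfUnity X (𝓡 4) X Set.univ :=
  Classical.choose (SmoothPartitionOfUnity.exists_isSubordinate_chartAt_source (𝓡 4) X)

/-- The integral over the compact manifold `X` of a density `δ` (a function of a point and four
tangent vectors there which scales by the absolute value of the determinant): with a partition of
unity `ρ_p` it is `∑_p ∫ ρ_p δ(∂₀, ∂₁, ∂₂, ∂₃) dy` in the chart at `p`. -/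
def integrateDensity (δ : Π x : X, (Fin 4 → TangentSpace (𝓡 4) x) → ℝ) : ℝ :=
  ∑ᶠ p : X, ∫ y in (extChartAt (𝓡 4) p).target,
    chartPartition X p ((extChartAt (𝓡 4) p).symm y) *
      δ ((extChartAt (𝓡 4) p).symm y) (coordField p y)

end Density

section Bundle

variable {X : Type*} [TopologicalSpace X] [ChartedSpace R4 X]
  {V : X → Type*} [TopologicalSpace (TotalSpace R3 V)]
  [∀ x, NormedAddCommGroup (V x)] [∀ x, InnerProductSpace ℝ (V x)]
  [FiberBundle R3 V]

/-- The standard basis of `T_x X`, i.e. the coordinate vectors at `x` of the preferred chart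
at `x`. -/
def stdVec (x : X) (i : Fin 4) : TangentSpace (𝓡 4) x := (EuclideanSpace.single i (1 : ℝ) : R4)

variable [IsManifold (𝓡 4) ∞ X] [VectorBundle ℝ R3 V]

/-- The basis of the fibre `V x` given by the local trivialization at `x`. -/
def fibreBasis (x : X) : Module.Basis (Fin 3) ℝ (V x) :=
  (EuclideanSpace.basisFun (Fin 3) ℝ).toBasis.map
    (VectorBundle.continuousLinearEquivAt ℝ R3 V x).symm.toLinearEquiv

/-- `F_A(u,v)s = ∇_U ∇_W S - ∇_W ∇_U S - ∇_{[U,W]} S` at `x`, where `U`, `W`, `S` are extensions of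
`u`, `v`, `s` to a neighbourhood of `x`. -/
def curvatureAux (A : CovariantDerivative (𝓡 4) R3 V) (x : X) (u v : TangentSpace (𝓡 4) x)
    (s : V x) : V x :=
  A (fun y ↦ A (extend R3 s) y (extend R4 v y)) x u
    - A (fun y ↦ A (extend R3 s) y (extend R4 u y)) x v
    - A (extend R3 s) x (VectorField.mlieBracket (𝓡 4) (extend R4 u) (extend R4 v) x)

/-- The curvature `F_A(u,v)`, an endomorphism of the fibre.  (For a smooth connection the expression
`curvatureAux` is already linear in `s`, so this is nothing but its bundling as a linear map.) -/
def curvature (A : CovariantDerivative (𝓡 4) R3 V) (x : X) (u v : TangentSpace (𝓡 4) x) :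
    Module.End ℝ (V x) :=
  (fibreBasis x).constr ℝ fun i ↦ curvatureAux A x u v (fibreBasis x i)

variable (V) in
/-- `Ω¹(X, 𝔰𝔬(E))`: smooth 1-forms with values in the skew endomorphisms.  As for differences of
connections in Mathlib, `a x s u` is the endomorphism `a(u)` applied to `s ∈ V x`, for
`u ∈ T_x X`. -/
structure OneForm where
  /-- the underlying section -/
  toFun : Π x : X, V x →L[ℝ] TangentSpace (𝓡 4) x →L[ℝ] V x
  skew : ∀ (x : X) (u : TangentSpace (𝓡 4) x) (s t : V x),
    inner ℝ (toFun x s u) t = -inner ℝ s (toFun x t u)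
  smooth : ContMDiff (𝓡 4) ((𝓡 4).prod 𝓘(ℝ, R3 →L[ℝ] R4 →L[ℝ] R3)) ∞
    fun x ↦ TotalSpace.mk' (R3 →L[ℝ] R4 →L[ℝ] R3)
      (E := fun x ↦ V x →L[ℝ] TangentSpace (𝓡 4) x →L[ℝ] V x) x (toFun x)

instance [ContMDiffVectorBundle ∞ R3 V (𝓡 4)] : Nonempty (OneForm V) :=
  ⟨{ toFun := fun _ ↦ 0
     skew := by simp
     smooth := Bundle.contMDiff_zeroSection ℝ
      (fun x : X ↦ V x →L[ℝ] TangentSpace (𝓡 4) x →L[ℝ] V x) }⟩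

/-- The endomorphism `a(u)`. -/
def OneForm.endo (a : OneForm V) (x : X) (u : TangentSpace (𝓡 4) x) : Module.End ℝ (V x) where
  toFun s := a.toFun x s u
  map_add' s t := by rw [ContinuousLinearMap.map_add, add_apply]
  map_smul' r s := by
    rw [ContinuousLinearMap.map_smul, smul_apply, RingHom.id_apply]

/-- `β ∈ Ω²(X, 𝔰𝔬(E))`: an alternating bilinear form on each tangent space with values in the skew
endomorphisms, which is smooth, i.e. sends smooth vector fields and sections to smooth sections. -/
structure IsTwoForm (β : Π x : X, TangentSpace (𝓡 4) x → TangentSpace (𝓡 4) x →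
    Module.End ℝ (V x)) : Prop where
  add : ∀ x u u' v, β x (u + u') v = β x u v + β x u' v
  smul : ∀ x (r : ℝ) u v, β x (r • u) v = r • β x u v
  alt : ∀ x u v, β x u v = -β x v u
  skew : ∀ x u v s t, inner ℝ (β x u v s) t = -inner ℝ s (β x u v t)
  smooth : ∀ (U W : Π x : X, TangentSpace (𝓡 4) x) (S : Π x : X, V x),
    ContMDiff (𝓡 4) ((𝓡 4).prod 𝓘(ℝ, R4)) ∞
      (fun x ↦ TotalSpace.mk' R4 (E := fun x : X ↦ TangentSpace (𝓡 4) x) x (U x)) →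
    ContMDiff (𝓡 4) ((𝓡 4).prod 𝓘(ℝ, R4)) ∞
      (fun x ↦ TotalSpace.mk' R4 (E := fun x : X ↦ TangentSpace (𝓡 4) x) x (W x)) →
    ContMDiff (𝓡 4) ((𝓡 4).prod 𝓘(ℝ, R3)) ∞ (fun x ↦ TotalSpace.mk' R3 x (S x)) →
    ContMDiff (𝓡 4) ((𝓡 4).prod 𝓘(ℝ, R3)) ∞
      (fun x ↦ TotalSpace.mk' R3 x (β x (U x) (W x) (S x)))

/-- `(d_A a)(u,v) = ∇_U (a(W)) - ∇_W (a(U)) - a([U,W])` applied to `s`, with `U`, `W`, `S`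
extensions of `u`, `v`, `s`, and with the connection on endomorphisms
`(∇_U ξ) S = ∇_U (ξ S) - ξ (∇_U S)`. -/
def covExtDerivAux (A : CovariantDerivative (𝓡 4) R3 V) (a : OneForm V) (x : X)
    (u v : TangentSpace (𝓡 4) x) (s : V x) : V x :=
  (A (fun y ↦ a.toFun y (extend R3 s y) (extend R4 v y)) x u
      - a.toFun x (A (extend R3 s) x u) v)
    - (A (fun y ↦ a.toFun y (extend R3 s y) (extend R4 u y)) x v
      - a.toFun x (A (extend R3 s) x v) u)
    - a.toFun x s (VectorField.mlieBracket (𝓡 4) (extend R4 u) (extend R4 v) x)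

/-- The covariant exterior derivative `d_A a` of a 1-form with values in `𝔰𝔬(E)` (again
`covExtDerivAux`, which is linear in `s`, bundled as an endomorphism). -/
def covExtDeriv (A : CovariantDerivative (𝓡 4) R3 V) (a : OneForm V) (x : X)
    (u v : TangentSpace (𝓡 4) x) : Module.End ℝ (V x) :=
  (fibreBasis x).constr ℝ fun i ↦ covExtDerivAux A a x u v (fibreBasis x i)

variable (c : ℝ)

/-- The 4-form `μ(A) = ⅓ ∑ Fᵢ ∧ Fᵢ`, where `F_A = ∑ Fᵢ ⊗ eᵢ` in an orthonormal frame of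
`𝔰𝔬(E)`. -/
def volForm (A : CovariantDerivative (𝓡 4) R3 V) (x : X)
    (v : Fin 4 → TangentSpace (𝓡 4) x) : ℝ :=
  (1 / 3) * wedge (soInner c) (curvature A x) (curvature A x) v

/-- The endomorphism `Q(A)`, which sends `ξ ∈ 𝔰𝔬(E)` to `(⟨F_A, ξ⟩ ∧ F_A) / μ(A)`, so that
`⟨Q(A)ξ, η⟩ = (⟨F_A, ξ⟩ ∧ ⟨F_A, η⟩) / μ(A)`.  The formula makes sense for all endomorphisms `ξ`; as
`F_A` is skew, the resulting map vanishes on symmetric endomorphisms and has its values in `𝔰𝔬(E)`,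
so extending it in this way changes neither the trace of it nor that of its powers. -/
def Q (A : CovariantDerivative (𝓡 4) R3 V) (x : X) :
    Module.End ℝ (V x) →ₗ[ℝ] Module.End ℝ (V x) where
  toFun ξ := (volForm c A x (stdVec x))⁻¹ •
    wedge (fun (r : ℝ) (η : Module.End ℝ (V x)) ↦ r • η)
      (fun u v ↦ soInner c (curvature A x u v) ξ) (curvature A x) (stdVec x)
  map_add' ξ η := by
    simp only [wedge, soInner, mul_add, map_add]
    module
  map_smul' r ξ := by
    simp only [wedge, soInner, mul_smul_comm, map_smul, RingHom.id_apply, smul_eq_mul]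
    module

/-- `|Q(A)|² = tr (Q(A)²)`. -/
def normSqQ (A : CovariantDerivative (𝓡 4) R3 V) (x : X) : ℝ :=
  LinearMap.trace ℝ _ (Q c A x ∘ₗ Q c A x)

/-- `B_A = 4 Q(A) - ⅔ |Q(A)|² Id`. -/
def B (A : CovariantDerivative (𝓡 4) R3 V) (x : X) :
    Module.End ℝ (V x) →ₗ[ℝ] Module.End ℝ (V x) :=
  (4 : ℝ) • Q c A x - ((2 / 3) * normSqQ c A x) • LinearMap.id

/-- The 2-form `B_A(F_A)` with values in `𝔰𝔬(E)`. -/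
def twistedCurvature (A : CovariantDerivative (𝓡 4) R3 V) (x : X)
    (u v : TangentSpace (𝓡 4) x) : Module.End ℝ (V x) :=
  B c A x (curvature A x u v)

/-- `g` is an inner product on `T_x X` whose volume form is `μ(A)`, and for which (with the
orientation given by `μ(A)`) the 2-forms `Fᵢ` are self-dual: every `g`-orthonormal basis `e` has
`μ(A)(e) = ±1`, and if the sign is `+` then `F₀₁ = F₂₃`, `F₀₂ = F₃₁`, `F₀₃ = F₁₂`. -/
def IsMetricOf (A : CovariantDerivative (𝓡 4) R3 V) (x : X)
    (g : LinearMap.BilinForm ℝ (TangentSpace (𝓡 4) x)) : Prop :=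
  (∀ u v, g u v = g v u) ∧ (∀ u, u ≠ 0 → 0 < g u u) ∧
  ∀ e : Fin 4 → TangentSpace (𝓡 4) x, (∀ i j, g (e i) (e j) = if i = j then 1 else 0) →
    |volForm c A x e| = 1 ∧
    (0 < volForm c A x e →
      curvature A x (e 0) (e 1) = curvature A x (e 2) (e 3) ∧
      curvature A x (e 0) (e 2) = curvature A x (e 3) (e 1) ∧
      curvature A x (e 0) (e 3) = curvature A x (e 1) (e 2))

/-- The Riemannian metric `g_A` at `x`. -/
def gA (A : CovariantDerivative (𝓡 4) R3 V) (x : X) :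
    LinearMap.BilinForm ℝ (TangentSpace (𝓡 4) x) :=
  Classical.epsilon (IsMetricOf c A x)

/-- The inverse matrix `gⁱʲ` of `g_A` in the standard basis of `T_x X`. -/
def gInv (A : CovariantDerivative (𝓡 4) R3 V) (x : X) : Matrix (Fin 4) (Fin 4) ℝ :=
  (Matrix.of fun i j ↦ gA c A x (stdVec x i) (stdVec x j))⁻¹

/-- The pointwise inner product `∑ gⁱʲ ⟨aᵢ, bⱼ⟩` on `Λ¹ ⊗ 𝔰𝔬(E)`. -/
def inner₁ (A : CovariantDerivative (𝓡 4) R3 V) (a b : OneForm V) (x : X) : ℝ :=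
  ∑ i, ∑ j, gInv c A x i j * soInner c (a.endo x (stdVec x i)) (b.endo x (stdVec x j))

/-- The pointwise inner product `½ ∑ gⁱᵏ gʲˡ ⟨Sᵢⱼ, Tₖₗ⟩` on `Λ² ⊗ 𝔰𝔬(E)`. -/
def inner₂ (A : CovariantDerivative (𝓡 4) R3 V)
    (S T : Π x : X, TangentSpace (𝓡 4) x → TangentSpace (𝓡 4) x → Module.End ℝ (V x))
    (x : X) : ℝ :=
  (1 / 2) * ∑ i, ∑ j, ∑ k, ∑ l, gInv c A x i k * gInv c A x j l *
    soInner c (S x (stdVec x i) (stdVec x j)) (T x (stdVec x k) (stdVec x l))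

/-- The connection `A + t a`. -/
def addForm (A : CovariantDerivative (𝓡 4) R3 V) (t : ℝ) (a : OneForm V) :
    CovariantDerivative (𝓡 4) R3 V :=
  A.addOneForm fun x ↦ t • a.toFun x

section Compact

variable [T2Space X] [CompactSpace X]

/-- `∫_X f μ(A)`, where `X` carries the orientation for which `μ(A)` is positive. -/
def integral (A : CovariantDerivative (𝓡 4) R3 V) (f : X → ℝ) : ℝ :=
  integrateDensity fun x v ↦ f x * |volForm c A x v|

/-- The energy `ℰ(A) = ∫_X |Q(A)|² μ(A)`. -/
def energy (A : CovariantDerivative (𝓡 4) R3 V) : ℝ :=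
  integral c A (normSqQ c A)

/-- The `L²(g_A)` inner product on `Ω¹(X, 𝔰𝔬(E))`. -/
def innerL2 (A : CovariantDerivative (𝓡 4) R3 V) (a b : OneForm V) : ℝ :=
  integral c A (inner₁ c A a b)

/-- `α` is a formal `L²(g_A)`-adjoint of `d_A` evaluated at `β`:
`⟨α, a⟩ = ⟨β, d_A a⟩` for all `a ∈ Ω¹(X, 𝔰𝔬(E))`. -/
def IsAdjointValue (A : CovariantDerivative (𝓡 4) R3 V)
    (β : Π x : X, TangentSpace (𝓡 4) x → TangentSpace (𝓡 4) x → Module.End ℝ (V x))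
    (α : OneForm V) : Prop :=
  ∀ a : OneForm V, innerL2 c A α a = integral c A (inner₂ c A β (covExtDeriv A a))

/-- `d_A^* β`, for the `L²(g_A)`-adjoint `d_A^*` of `d_A`. -/
def dAdjoint [ContMDiffVectorBundle ∞ R3 V (𝓡 4)] (A : CovariantDerivative (𝓡 4) R3 V)
    (β : Π x : X, TangentSpace (𝓡 4) x → TangentSpace (𝓡 4) x → Module.End ℝ (V x)) :
    OneForm V :=
  Classical.epsilon (IsAdjointValue c A β)

/-- `ξ ∈ Ω¹(X, 𝔰𝔬(E))` is the gradient of the energy at `A` for the `L²(g_A)` metric. -/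
def IsGradient (A : CovariantDerivative (𝓡 4) R3 V) (ξ : OneForm V) : Prop :=
  ∀ a : OneForm V,
    HasDerivAt (fun t : ℝ ↦ energy c (addForm A t a)) (innerL2 c A ξ a) 0

end Compact

variable [ContMDiffVectorBundle ∞ R3 V (𝓡 4)]

/-- A path of connections has, at time `t`, the time derivative `w`. -/
def HasTimeDeriv (A : ℝ → CovariantDerivative (𝓡 4) R3 V) (J : Set ℝ) (t : ℝ)
    (w : Π x : X, V x →L[ℝ] TangentSpace (𝓡 4) x →L[ℝ] V x) : Prop :=
  ∀ (x : X) (s : V x) (u : TangentSpace (𝓡 4) x),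
    HasDerivWithinAt (fun τ ↦ (A τ).difference (A t) x s u) (w x s u) J t

variable [IsContMDiffRiemannianBundle (𝓡 4) ∞ R3 V]

/-- A definite connection: a smooth metric connection whose curvature is non-zero on every
tangent 2-plane. -/
structure IsDefinite (A : CovariantDerivative (𝓡 4) R3 V) : Prop where
  smooth : A.ContMDiffCovariantDerivative ∞
  metric : A.IsMetricCompatible
  definite : ∀ (x : X) (u v : TangentSpace (𝓡 4) x),
    LinearIndependent ℝ ![u, v] → curvature A x u v ≠ 0

/-- A path of definite connections, defined for times in `J`, which is a downward gradient flow line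
of the energy: `∂A/∂t = - grad ℰ(A)`. -/
def IsDownwardGradientFlow [T2Space X] [CompactSpace X]
    (A : ℝ → CovariantDerivative (𝓡 4) R3 V) (J : Set ℝ) : Prop :=
  ∀ t ∈ J, IsDefinite (A t) ∧
    ∃ ξ : OneForm V, IsGradient c (A t) ξ ∧ HasTimeDeriv A J t fun x ↦ -ξ.toFun x

end Bundle

end DefiniteConnection

end

/-!
The first variation of `∫ |Q|² μ` is an algebraic expression in the curvature paired with the
variation `d_A a` of the curvature; the point is that this expression is the `L²(g_A)` pairing of
`B_A(F_A)` with `d_A a`.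

*The metric.* In an orthonormal frame, `𝔰𝔬(E)` is `ℝ³` with the cross product (`ChartFrame.hat`,
`ChartFrame.vee`), a metric connection is `d + γ ×` (`ChartFrame.exists_isConnRep`), and its
curvature is a triple of 2-forms `F₁, F₂, F₃` on a four-dimensional space. The triple is definite
when `F(u, v) ≠ 0` for independent `u, v`. For a definite triple the Urbantke form
`∑ εᵢⱼₖ ι_u Fᵢ ∧ ι_w Fⱼ ∧ Fₖ` has no isotropic vectors (`urbantke_self_ne_zero`), hence is definite,
and in a basis in which it is a multiple of the identity each `Fᵢ` is self-dual, or each is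
anti-self-dual (`selfDual_or_antiSelfDual_of_urbantke`). So a rescaling of it is a metric as required
(`isTripleMetric_urbantke`). Conversely, evaluation of the Urbantke form in an oriented orthonormal
basis of any such metric shows that the metric is this one (`IsTripleMetric.eq_urbantke`). The
explicit formula also shows that `g_A` is smooth.

*The adjoint.* In a chart, integration by parts gives a smooth 1-form `α` such that
`⟨β, d_A a⟩ - ⟨α, a⟩`, as a density, is the divergence of a vector field with compact support
(`ChartFrame.IsConnRep.inner₂_sub_inner₁`, `setIntegral_fderiv_eq_zero`), for `β` with support in the
chart. A partition of unity gives the general case (`exists_isAdjointValue`).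
Integrals of densities do not depend on the chart (`IsContDensity.integral_eq_chart`).

*The gradient.* Let `M = (Fᵢ ∧ Fⱼ)`, evaluated on a coordinate basis. Then `μ = (2c/3) tr M` and
`Q = 3M / tr M`, so that the energy density is `6c tr(M²) / |tr M|`. Since the curvature of `A + ta`
is `F + t d_A a + O(t²)`, the derivative of the energy density is a sum of wedge products of the
`Fᵢ` with the components of `d_A a`, and the coefficients are those of `B_A`
(`hasDerivAt_trace_sq_div_abs_trace`). The 2-form `B_A(F_A)` is self-dual, because the `Fᵢ` are; so
its wedge product with `d_A a` is the inner product `⟨B_A(F_A), d_A a⟩ |μ|`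
(`IsTripleMetric.mul_inner_eq_wedge`, `ChartFrame.IsConnRep.hasDerivAt_densRep_energyDensity`).
Integration gives `hasDerivAt_energy`, and the definition of the adjoint turns the result into
`⟨d_A^* B_A(F_A), a⟩`. The gradient is unique because the `L²` inner product is positive definite
(`toFun_eq_zero_of_innerL2_self`, `isGradient_iff`). The statement on the gradient flow is a
pointwise application of this.
-/

set_option linter.unusedSimpArgs false
set_option linter.unusedSectionVars false

namespace DefiniteConnection

/-! ### Triples of 2-forms on a four-dimensional vector space -/

section LinearAlgebra

open scoped Matrix

/-- The matrix `Fᵢ ∧ Fⱼ` of a triple of 2-forms, evaluated on four vectors. -/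
def wedgeMatrix {T : Type*} (F : T → T → Fin 3 → ℝ) (v : Fin 4 → T) : Matrix (Fin 3) (Fin 3) ℝ :=
  Matrix.of fun i j ↦ wedge (fun x y : ℝ ↦ x * y) (fun a b ↦ F a b i) (fun a b ↦ F a b j) v

/-- The Urbantke form `∑ εᵢⱼₖ ι_u Fᵢ ∧ ι_w Fⱼ ∧ Fₖ` of a triple of 2-forms, evaluated on four
vectors `v`. For a definite triple it spans the conformal class of the associated metric. -/
def urbantke {T : Type*} (F : T → T → Fin 3 → ℝ) (v : Fin 4 → T) (u w : T) : ℝ :=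
  wedge (fun x y : Fin 3 → ℝ ↦ x ⬝ᵥ y) (fun a b ↦ F u a ⨯₃ F w b - F u b ⨯₃ F w a) F v

/-- The determinant of the three vectors `F e₀ e₁`, `F e₀ e₂`, `F e₀ e₃`. -/
def electricDet {T : Type*} (F : T → T → Fin 3 → ℝ) (e : Fin 4 → T) : ℝ :=
  F (e 0) (e 1) ⬝ᵥ (F (e 0) (e 2) ⨯₃ F (e 0) (e 3))

lemma trace_wedgeMatrix {T : Type*} (F : T → T → Fin 3 → ℝ) (v : Fin 4 → T) :
    (wedgeMatrix F v).trace = wedge (fun x y : Fin 3 → ℝ ↦ x ⬝ᵥ y) F F v := by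
  simp [Matrix.trace, wedgeMatrix, wedge, Fin.sum_univ_three, dotProduct]
  ring

section Values

variable {T : Type*} {F : T → T → Fin 3 → ℝ} (hself : ∀ u, F u u = 0)
  (hswap : ∀ u v, F u v = -F v u)
include hself

lemma urbantke_self_zero (e : Fin 4 → T) :
    urbantke F e (e 0) (e 0) = 6 * electricDet F e := by
  simp only [urbantke, electricDet, wedge, hself (e _)]
  simp [cross_apply, dotProduct, Fin.sum_univ_three]
  ring

include hswap in
/-- If the Urbantke form is a non-zero multiple of the identity in a basis, then in this basis
the triple is self-dual or anti-self-dual. In terms of the matrix `C` with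
`F(eₖ,eₗ) = ∑ Cⱼᵢ F(e₀,eᵢ)` the hypothesis says that `C` is symmetric and is its own cofactor
matrix up to scale, which forces `C = ±1`. -/
lemma selfDual_or_antiSelfDual_of_urbantke {e : Fin 4 → T} {lam : ℝ} (hlam : lam ≠ 0)
    (h : ∀ i j, urbantke F e (e i) (e j) = if i = j then lam else 0) :
    electricDet F e = lam / 6 ∧ ∃ ε : ℝ, ε ^ 2 = 1 ∧
      F (e 2) (e 3) = ε • F (e 0) (e 1) ∧ F (e 3) (e 1) = ε • F (e 0) (e 2) ∧
      F (e 1) (e 2) = ε • F (e 0) (e 3) := by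
  have hD : electricDet F e = lam / 6 := by
    have := urbantke_self_zero hself e
    rw [h 0 0, if_pos rfl] at this
    linarith
  refine ⟨hD, ?_⟩
  have hD0 : electricDet F e ≠ 0 := by rw [hD]; positivity
  set t1 := F (e 0) (e 1) with ht1
  set t2 := F (e 0) (e 2) with ht2
  set t3 := F (e 0) (e 3) with ht3
  -- Cramer's rule: every vector is a combination of `t1`, `t2`, `t3`.
  have cramer : ∀ x : Fin 3 → ℝ, ∃ a b c : ℝ, x = a • t1 + b • t2 + c • t3 := by
    intro x
    refine ⟨(x ⬝ᵥ (t2 ⨯₃ t3)) / electricDet F e, (x ⬝ᵥ (t3 ⨯₃ t1)) / electricDet F e,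
      (x ⬝ᵥ (t1 ⨯₃ t2)) / electricDet F e, ?_⟩
    have key : electricDet F e • x = (x ⬝ᵥ (t2 ⨯₃ t3)) • t1 + (x ⬝ᵥ (t3 ⨯₃ t1)) • t2
        + (x ⬝ᵥ (t1 ⨯₃ t2)) • t3 := by
      ext i
      fin_cases i <;>
      · simp [electricDet, ← ht1, ← ht2, ← ht3, cross_apply, dotProduct, Fin.sum_univ_three]
        ring
    calc x = (electricDet F e)⁻¹ • electricDet F e • x := by rw [smul_smul, inv_mul_cancel₀ hD0, one_smul]
      _ = _ := by
        rw [key]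
        simp only [smul_add, smul_smul, div_eq_inv_mul]
  obtain ⟨a1, b1, c1, h1⟩ := cramer (F (e 2) (e 3))
  obtain ⟨a2, b2, c2, h2⟩ := cramer (F (e 3) (e 1))
  obtain ⟨a3, b3, c3, h3⟩ := cramer (F (e 1) (e 2))
  have hDe : electricDet F e = t1 0 * (t2 1 * t3 2 - t2 2 * t3 1) + t1 1 * (t2 2 * t3 0 - t2 0 * t3 2)
      + t1 2 * (t2 0 * t3 1 - t2 1 * t3 0) := by
    simp [electricDet, ← ht1, ← ht2, ← ht3, cross_apply, dotProduct, Fin.sum_univ_three]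
  set D := electricDet F e with hDdef
  have hsw10 : F (e 1) (e 0) = -t1 := hswap _ _
  have hsw20 : F (e 2) (e 0) = -t2 := hswap _ _
  have hsw30 : F (e 3) (e 0) = -t3 := hswap _ _
  have h2' : F (e 1) (e 3) = -(a2 • t1 + b2 • t2 + c2 • t3) := by rw [hswap, h2]
  have h3' : F (e 2) (e 1) = -(a3 • t1 + b3 • t2 + c3 • t3) := by rw [hswap, h3]
  have h1' : F (e 3) (e 2) = -(a1 • t1 + b1 • t2 + c1 • t3) := by rw [hswap, h1]
  have e01 : urbantke F e (e 0) (e 1) = -3 * D * (c2 - b3) := by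
    simp only [urbantke, wedge, hself (e _), hsw10, hsw20, hsw30, h1, h1', h2, h2', h3, h3', ← ht1,
      ← ht2, ← ht3]
    simp [cross_apply, dotProduct, Fin.sum_univ_three, hDe]
    ring
  have e02 : urbantke F e (e 0) (e 2) = -3 * D * (a3 - c1) := by
    simp only [urbantke, wedge, hself (e _), hsw10, hsw20, hsw30, h1, h1', h2, h2', h3, h3', ← ht1,
      ← ht2, ← ht3]
    simp [cross_apply, dotProduct, Fin.sum_univ_three, hDe]
    ring
  have e03 : urbantke F e (e 0) (e 3) = -3 * D * (b1 - a2) := by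
    simp only [urbantke, wedge, hself (e _), hsw10, hsw20, hsw30, h1, h1', h2, h2', h3, h3', ← ht1,
      ← ht2, ← ht3]
    simp [cross_apply, dotProduct, Fin.sum_univ_three, hDe]
    ring
  have hlD : lam = 6 * D := by rw [hD]; ring
  have s1 : b3 = c2 := by
    have := e01; rw [h 0 1] at this; simp at this
    rcases this with h | h
    · exact absurd h hD0
    · linarith
  have s2 : c1 = a3 := by
    have := e02; rw [h 0 2] at this; simp at this
    rcases this with h | h
    · exact absurd h hD0
    · linarith
  have s3 : a2 = b1 := by
    have := e03; rw [h 0 3] at this; simp at this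
    rcases this with h | h
    · exact absurd h hD0
    · linarith
  subst s1 s2 s3
  have e11 : urbantke F e (e 1) (e 1) = 6 * D * (b2 * c3 - b3 * b3) := by
    simp only [urbantke, wedge, hself (e _), hsw10, hsw20, hsw30, h1, h1', h2, h2', h3, h3', ← ht1,
      ← ht2, ← ht3]
    simp [cross_apply, dotProduct, Fin.sum_univ_three, hDe]
    ring
  have e22 : urbantke F e (e 2) (e 2) = 6 * D * (a1 * c3 - c1 * c1) := by
    simp only [urbantke, wedge, hself (e _), hsw10, hsw20, hsw30, h1, h1', h2, h2', h3, h3', ← ht1,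
      ← ht2, ← ht3]
    simp [cross_apply, dotProduct, Fin.sum_univ_three, hDe]
    ring
  have e33 : urbantke F e (e 3) (e 3) = 6 * D * (a1 * b2 - a2 * a2) := by
    simp only [urbantke, wedge, hself (e _), hsw10, hsw20, hsw30, h1, h1', h2, h2', h3, h3', ← ht1,
      ← ht2, ← ht3]
    simp [cross_apply, dotProduct, Fin.sum_univ_three, hDe]
    ring
  have e12 : urbantke F e (e 1) (e 2) = 6 * D * (c1 * b3 - a2 * c3) := by
    simp only [urbantke, wedge, hself (e _), hsw10, hsw20, hsw30, h1, h1', h2, h2', h3, h3', ← ht1,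
      ← ht2, ← ht3]
    simp [cross_apply, dotProduct, Fin.sum_univ_three, hDe]
    ring
  have e13 : urbantke F e (e 1) (e 3) = 6 * D * (a2 * b3 - b2 * c1) := by
    simp only [urbantke, wedge, hself (e _), hsw10, hsw20, hsw30, h1, h1', h2, h2', h3, h3', ← ht1,
      ← ht2, ← ht3]
    simp [cross_apply, dotProduct, Fin.sum_univ_three, hDe]
    ring
  have e23 : urbantke F e (e 2) (e 3) = 6 * D * (a2 * c1 - a1 * b3) := by
    simp only [urbantke, wedge, hself (e _), hsw10, hsw20, hsw30, h1, h1', h2, h2', h3, h3', ← ht1,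
      ← ht2, ← ht3]
    simp [cross_apply, dotProduct, Fin.sum_univ_three, hDe]
    ring
  have h6 : (6 * D) ≠ 0 := mul_ne_zero (by norm_num) hD0
  have q11 : b2 * c3 - b3 * b3 = 1 := mul_left_cancel₀ h6 (by rw [← e11, h, if_pos rfl, hlD, mul_one])
  have q22 : a1 * c3 - c1 * c1 = 1 := mul_left_cancel₀ h6 (by rw [← e22, h, if_pos rfl, hlD, mul_one])
  have q33 : a1 * b2 - a2 * a2 = 1 := mul_left_cancel₀ h6 (by rw [← e33, h, if_pos rfl, hlD, mul_one])
  have q12 : c1 * b3 - a2 * c3 = 0 := mul_left_cancel₀ h6 (by rw [← e12, h, if_neg (by decide), mul_zero])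
  have q13 : a2 * b3 - b2 * c1 = 0 := mul_left_cancel₀ h6 (by rw [← e13, h, if_neg (by decide), mul_zero])
  have q23 : a2 * c1 - a1 * b3 = 0 := mul_left_cancel₀ h6 (by rw [← e23, h, if_neg (by decide), mul_zero])
  -- The matrix times the transpose of its cofactor matrix is its determinant.
  have d12 : a2 = 0 := by linear_combination (-a2) * q11 - b2 * q12 - b3 * q13
  have d13 : c1 = 0 := by linear_combination (-c1) * q11 - b3 * q12 - c3 * q13
  have d23 : b3 = 0 := by linear_combination (-c1) * q12 - b3 * q22 - c3 * q23
  subst d12 d13 d23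
  have ha : b2 = a1 := by linear_combination a1 * q11 - b2 * q22
  have hc : c3 = a1 := by linear_combination a1 * q11 - c3 * q33
  subst ha hc
  refine ⟨c3, by linear_combination q11, ?_, ?_, ?_⟩
  · rw [h1]; simp
  · rw [h2]; simp
  · rw [h3]; simp

end Values

end LinearAlgebra

section LinearAlgebra

open scoped Matrix

variable {T : Type*} [AddCommGroup T] [Module ℝ T]

/-- The wedge product of two alternating bilinear maps as an alternating 4-form. -/
def wedgeAlternating {W W' : Type*} [AddCommGroup W] [Module ℝ W] [AddCommGroup W'] [Module ℝ W']
    (m : W →ₗ[ℝ] W' →ₗ[ℝ] ℝ) (α : T →ₗ[ℝ] T →ₗ[ℝ] W) (β : T →ₗ[ℝ] T →ₗ[ℝ] W')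
    (hα : ∀ u v, α u v = -α v u) (hβ : ∀ u v, β u v = -β v u) : T [⋀^Fin 4]→ₗ[ℝ] ℝ where
  toFun v := wedge (fun x y ↦ m x y) (fun a b ↦ α a b) (fun a b ↦ β a b) v
  map_update_add' {inst} v i x y := by
    obtain rfl := Subsingleton.elim inst (instDecidableEqFin 4)
    fin_cases i <;> simp [wedge, Function.update] <;> ring
  map_update_smul' {inst} v i r x := by
    obtain rfl := Subsingleton.elim inst (instDecidableEqFin 4)
    fin_cases i <;> simp [wedge, Function.update] <;> ring
  map_eq_zero_of_eq' v i j h hij := by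
    have hα' : ∀ u, α u u = 0 := fun u ↦ by
      have h2 : (2 : ℝ) • α u u = 0 := by rw [two_smul]; nth_rewrite 1 [hα u u]; simp
      simpa using h2
    have hβ' : ∀ u, β u u = 0 := fun u ↦ by
      have h2 : (2 : ℝ) • β u u = 0 := by rw [two_smul]; nth_rewrite 1 [hβ u u]; simp
      simpa using h2
    fin_cases i <;> fin_cases j <;> simp at hij h <;>
      simp [wedge, h, hα', hβ', hα (v 1) (v 0), hα (v 2) (v 0), hα (v 3) (v 0), hα (v 2) (v 1),
        hα (v 3) (v 1), hα (v 3) (v 2), hβ (v 1) (v 0), hβ (v 2) (v 0), hβ (v 3) (v 0),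
        hβ (v 2) (v 1), hβ (v 3) (v 1), hβ (v 3) (v 2)]

/-- Alternating 4-forms on a four-dimensional space are determined by their value on a basis. -/
lemma wedge_eq_det_mul {W W' : Type*} [AddCommGroup W] [Module ℝ W] [AddCommGroup W'] [Module ℝ W']
    (m : W →ₗ[ℝ] W' →ₗ[ℝ] ℝ) (α : T →ₗ[ℝ] T →ₗ[ℝ] W) (β : T →ₗ[ℝ] T →ₗ[ℝ] W')
    (hα : ∀ u v, α u v = -α v u) (hβ : ∀ u v, β u v = -β v u)
    (e : Module.Basis (Fin 4) ℝ T) (v : Fin 4 → T) :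
    wedge (fun x y ↦ m x y) (fun a b ↦ α a b) (fun a b ↦ β a b) v =
      e.det v * wedge (fun x y ↦ m x y) (fun a b ↦ α a b) (fun a b ↦ β a b) e := by
  have h := congrArg (fun f ↦ f v) ((wedgeAlternating m α β hα hβ).eq_smul_basis_det e)
  simp only [AlternatingMap.smul_apply, smul_eq_mul] at h
  rw [mul_comm]
  exact h

variable {F : T →ₗ[ℝ] T →ₗ[ℝ] (Fin 3 → ℝ)}

/-- The dot product as a bilinear map. -/
abbrev dotₗ : (Fin 3 → ℝ) →ₗ[ℝ] (Fin 3 → ℝ) →ₗ[ℝ] ℝ := dotProductBilin ℝ ℝ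

variable (hF : ∀ u v, F u v = -F v u)
include hF

lemma urbantke_eq_det_mul (e : Module.Basis (Fin 4) ℝ T) (v : Fin 4 → T) (u w : T) :
    urbantke (fun a b ↦ F a b) v u w = e.det v * urbantke (fun a b ↦ F a b) e u w := by
  let X : T →ₗ[ℝ] T →ₗ[ℝ] (Fin 3 → ℝ) :=
    crossProduct.compl₁₂ (F u) (F w) - (crossProduct.compl₁₂ (F u) (F w)).flip
  exact wedge_eq_det_mul dotₗ X F (fun a b ↦ by simp [X]) hF e v

lemma wedgeMatrix_eq_det_smul (e : Module.Basis (Fin 4) ℝ T) (v : Fin 4 → T) :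
    wedgeMatrix (fun a b ↦ F a b) v = e.det v • wedgeMatrix (fun a b ↦ F a b) e := by
  ext i j
  exact wedge_eq_det_mul (LinearMap.mul ℝ ℝ) (F.compr₂ (LinearMap.proj i))
    (F.compr₂ (LinearMap.proj j)) (fun a b ↦ by simp [hF a b]) (fun a b ↦ by simp [hF a b]) e v

omit hF in
lemma urbantke_symm (v : Fin 4 → T) (u w : T) :
    urbantke (fun a b ↦ F a b) v u w = urbantke (fun a b ↦ F a b) v w u := by
  have : ∀ a b, F u a ⨯₃ F w b - F u b ⨯₃ F w a = F w a ⨯₃ F u b - F w b ⨯₃ F u a := by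
    intro a b
    rw [← cross_anticomm (F w b) (F u a), ← cross_anticomm (F u b) (F w a)]
    abel
  simp only [urbantke, this]

/-- The Urbantke form as a bilinear form. -/
def urbantkeForm (F : T →ₗ[ℝ] T →ₗ[ℝ] (Fin 3 → ℝ)) (v : Fin 4 → T) : LinearMap.BilinForm ℝ T :=
  LinearMap.mk₂ ℝ (urbantke (fun a b ↦ F a b) v)
    (fun u u' w ↦ by simp [urbantke, wedge, add_dotProduct, sub_dotProduct]; ring)
    (fun r u w ↦ by simp [urbantke, wedge, smul_dotProduct, sub_dotProduct]; ring)
    (fun u w w' ↦ by simp [urbantke, wedge, add_dotProduct, sub_dotProduct]; ring)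
    (fun r u w ↦ by simp [urbantke, wedge, smul_dotProduct, sub_dotProduct]; ring)

omit hF in
@[simp] lemma urbantkeForm_apply (v : Fin 4 → T) (u w : T) :
    urbantkeForm F v u w = urbantke (fun a b ↦ F a b) v u w := rfl

omit hF in
/-- A positive definite form on a four-dimensional space has an orthonormal basis. -/
lemma exists_orthonormal_basis (b : Module.Basis (Fin 4) ℝ T) (B : LinearMap.BilinForm ℝ T)
    (hs : ∀ u v, B u v = B v u) (hp : ∀ u, u ≠ 0 → 0 < B u u) :
    ∃ e : Module.Basis (Fin 4) ℝ T, ∀ i j, B (e i) (e j) = if i = j then 1 else 0 := by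
  let core : InnerProductSpace.Core ℝ T :=
    { inner := fun u v ↦ B u v
      conj_inner_symm := fun u v ↦ by simp [hs u v]
      re_inner_nonneg := fun u ↦ by
        rcases eq_or_ne u 0 with rfl | h
        · simp
        · exact (hp u h).le
      add_left := by simp
      smul_left := by simp
      definite := fun u h ↦ by
        by_contra h0
        exact (hp u h0).ne' h }
  let : NormedAddCommGroup T := core.toNormedAddCommGroup
  let : InnerProductSpace ℝ T := InnerProductSpace.ofCore core.toCore
  have : FiniteDimensional ℝ T := Module.Basis.finiteDimensional_of_finite b
  have hfin : Module.finrank ℝ T = 4 := by simpa using Module.finrank_eq_card_basis b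
  let e := (stdOrthonormalBasis ℝ T).reindex (finCongr hfin)
  refine ⟨e.toBasis, fun i j ↦ ?_⟩
  have := orthonormal_iff_ite.mp e.orthonormal i j
  rw [OrthonormalBasis.coe_toBasis]
  exact this

omit hF in
/-- A family orthonormal for a symmetric bilinear form on a four-dimensional space is a basis. -/
lemma exists_basis_of_orthonormal (b : Module.Basis (Fin 4) ℝ T) {B : LinearMap.BilinForm ℝ T}
    {e : Fin 4 → T} (he : ∀ i j, B (e i) (e j) = if i = j then 1 else 0) :
    ∃ e' : Module.Basis (Fin 4) ℝ T, ⇑e' = e := by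
  have : FiniteDimensional ℝ T := Module.Basis.finiteDimensional_of_finite b
  have hfin : Module.finrank ℝ T = 4 := by simpa using Module.finrank_eq_card_basis b
  have hli : LinearIndependent ℝ e := by
    rw [Fintype.linearIndependent_iff]
    intro g hg i
    have := congrArg (fun u ↦ B u (e i)) hg
    simpa [he] using this
  exact ⟨basisOfLinearIndependentOfCardEqFinrank hli (by simp [hfin]), by simp⟩

omit hF in
/-- A symmetric bilinear form without isotropic vectors does not change its sign. -/
lemma mul_pos_of_anisotropic {B : LinearMap.BilinForm ℝ T} (hs : ∀ u v, B u v = B v u)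
    (h0 : ∀ u, u ≠ 0 → B u u ≠ 0) {u v : T} (hu : u ≠ 0) (hv : v ≠ 0) : 0 < B u u * B v v := by
  by_contra hneg
  push Not at hneg
  have huv : B u u * B v v < 0 := lt_of_le_of_ne hneg (mul_ne_zero (h0 u hu) (h0 v hv))
  -- the discriminant of `t ↦ B (u + t v) (u + t v)` is positive
  set a := B v v with ha
  set b := B u v with hb
  set c := B u u with hc
  have hd : 0 ≤ b ^ 2 - c * a := by nlinarith [sq_nonneg b]
  set t := (-b + Real.sqrt (b ^ 2 - c * a)) / a with ht
  have ha0 : a ≠ 0 := h0 v hv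
  have hroot : B (u + t • v) (u + t • v) = 0 := by
    have h1 : B (u + t • v) (u + t • v) = c + 2 * t * b + t ^ 2 * a := by
      simp only [map_add, LinearMap.add_apply, map_smul, LinearMap.smul_apply, smul_eq_mul, hs v u]
      ring
    have h2 := Real.sq_sqrt hd
    have h3 : t * a = -b + Real.sqrt (b ^ 2 - c * a) := by rw [ht]; field_simp
    rw [h1]
    apply mul_left_cancel₀ ha0
    linear_combination (t * a + b + Real.sqrt (b ^ 2 - c * a)) * h3 + h2
  have hz : u + t • v = 0 := by
    by_contra hne
    exact h0 _ hne hroot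
  have hu' : u = -(t • v) := eq_neg_of_add_eq_zero_left hz
  have hcc : c = t ^ 2 * a := by
    rw [hc, hu']
    simp only [map_neg, LinearMap.neg_apply, map_smul, LinearMap.smul_apply, smul_eq_mul, ← ha]
    ring
  rw [hcc] at huv
  nlinarith [mul_nonneg (sq_nonneg t) (sq_nonneg a)]

variable (hdef : ∀ u v, LinearIndependent ℝ ![u, v] → F u v ≠ 0)
include hdef

/-- The Urbantke form of a definite triple has no isotropic vectors: for `u ≠ 0` the contraction
`F u` induces an isomorphism from `T / u` to `ℝ³`, so that `u` can be completed to a basis in which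
the form takes the value `6` on `u`. -/
lemma urbantke_self_ne_zero (b : Module.Basis (Fin 4) ℝ T) {u : T} (hu : u ≠ 0) :
    urbantke (fun a b ↦ F a b) b u u ≠ 0 := by
  have : FiniteDimensional ℝ T := Module.Basis.finiteDimensional_of_finite b
  have hfin : Module.finrank ℝ T = 4 := by simpa using Module.finrank_eq_card_basis b
  have hself : ∀ u, F u u = 0 := fun u ↦ self_eq_neg.mp (hF u u)
  have hker : LinearMap.ker (F u) = Submodule.span ℝ {u} := by
    apply le_antisymm
    · intro v hv
      by_contra hns
      refine hdef u v ?_ hv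
      rw [LinearIndependent.pair_iff' hu]
      intro a ha
      exact hns (Submodule.mem_span_singleton.mpr ⟨a, ha⟩)
    · rw [Submodule.span_singleton_le_iff_mem]
      exact hself u
  -- The kernel of `F u` is the line through `u`, so the rank of `F u` is three.
  have hsurj : Function.Surjective (F u) := by
    have h := LinearMap.finrank_range_add_finrank_ker (F u)
    rw [hker, finrank_span_singleton hu, hfin] at h
    rw [← LinearMap.range_eq_top]
    apply Submodule.eq_top_of_finrank_eq
    simp
    omega
  -- Complete `u` by preimages of the standard basis of `ℝ³`.
  choose s hs using hsurj
  let e : Fin 4 → T := ![u, s (Pi.single 0 1), s (Pi.single 1 1), s (Pi.single 2 1)]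
  have hli : LinearIndependent ℝ e := by
    rw [Fintype.linearIndependent_iff]
    intro g hg
    have h1 := congrArg (F u) hg
    simp only [Fin.sum_univ_four, e, map_add, map_smul, map_zero] at h1
    simp [hs, hself] at h1
    have c1 := congrFun h1 0
    have c2 := congrFun h1 1
    have c3 := congrFun h1 2
    simp at c1 c2 c3
    simp [Fin.sum_univ_four, e, c1, c2, c3, hu] at hg
    intro i
    fin_cases i <;> assumption
  let e' := basisOfLinearIndependentOfCardEqFinrank hli (by simp [hfin])
  have he' : ⇑e' = e := by simp [e']
  have h6 : urbantke (fun a b ↦ F a b) e u u = 6 := by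
    have := urbantke_self_zero (F := fun a b ↦ F a b) hself e
    rw [show e 0 = u from rfl] at this
    rw [this]
    have : electricDet (fun a b ↦ F a b) e = 1 := by
      simp [electricDet, e, hs, cross_apply, dotProduct, Fin.sum_univ_three]
    rw [this]; norm_num
  intro h
  have := urbantke_eq_det_mul hF b e u u
  rw [h, h6] at this
  simp at this

end LinearAlgebra

/-! ### The metric of a definite triple -/

section LinearAlgebra

open scoped Matrix

variable {T : Type*} [AddCommGroup T] [Module ℝ T]

/-- `g` is an inner product with volume form `μ = (k/3) ∑ Fᵢ ∧ Fᵢ` for which, in the orientation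
given by `μ`, the 2-forms `Fᵢ` are self-dual. -/
def IsTripleMetric (k : ℝ) (F : T →ₗ[ℝ] T →ₗ[ℝ] (Fin 3 → ℝ)) (g : LinearMap.BilinForm ℝ T) : Prop :=
  (∀ u v, g u v = g v u) ∧ (∀ u, u ≠ 0 → 0 < g u u) ∧
  ∀ e : Fin 4 → T, (∀ i j, g (e i) (e j) = if i = j then 1 else 0) →
    |k / 3 * (wedgeMatrix (fun a b ↦ F a b) e).trace| = 1 ∧
    (0 < k / 3 * (wedgeMatrix (fun a b ↦ F a b) e).trace →
      F (e 0) (e 1) = F (e 2) (e 3) ∧ F (e 0) (e 2) = F (e 3) (e 1) ∧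
      F (e 0) (e 3) = F (e 1) (e 2))

/-- The factor by which the Urbantke form in the basis `b` differs from the metric of the triple.
The sign makes the form positive, the square root gives it the volume form `μ`. -/
noncomputable def metricScale (k : ℝ) {T : Type*} (F : T → T → Fin 3 → ℝ) (b : Fin 4 → T) : ℝ :=
  urbantke F b (b 0) (b 0) / |urbantke F b (b 0) (b 0)| *
    √(2 * (k / 3 * (wedgeMatrix F b).trace) / (9 * (wedgeMatrix F b).det))

section Values

variable {T : Type*} {F : T → T → Fin 3 → ℝ} {e : Fin 4 → T} {ε : ℝ}
  (hself : ∀ u, F u u = 0) (hswap : ∀ u v, F u v = -F v u) (hε : ε ^ 2 = 1)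
  (h1 : F (e 2) (e 3) = ε • F (e 0) (e 1)) (h2 : F (e 3) (e 1) = ε • F (e 0) (e 2))
  (h3 : F (e 1) (e 2) = ε • F (e 0) (e 3))
include hswap h1 h2 h3

lemma wedgeMatrix_apply_of_dual (i j : Fin 3) :
    wedgeMatrix F e i j = 2 * ε * (F (e 0) (e 1) i * F (e 0) (e 1) j
      + F (e 0) (e 2) i * F (e 0) (e 2) j + F (e 0) (e 3) i * F (e 0) (e 3) j) := by
  simp [wedgeMatrix, wedge, h1, hswap (e 1) (e 3), h2, h3]
  ring

lemma trace_wedgeMatrix_of_dual :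
    (wedgeMatrix F e).trace = 2 * ε * ∑ i, (F (e 0) (e 1) i ^ 2
      + F (e 0) (e 2) i ^ 2 + F (e 0) (e 3) i ^ 2) := by
  simp [Matrix.trace, wedgeMatrix_apply_of_dual hswap h1 h2 h3, Fin.sum_univ_three]
  ring

include hε in
lemma det_wedgeMatrix_of_dual :
    (wedgeMatrix F e).det = 8 * ε * electricDet F e ^ 2 := by
  have : (wedgeMatrix F e).det = 8 * ε ^ 3 * electricDet F e ^ 2 := by
    simp [Matrix.det_fin_three, wedgeMatrix_apply_of_dual hswap h1 h2 h3, electricDet, cross_apply,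
      dotProduct, Fin.sum_univ_three]
    ring
  rw [this]
  linear_combination 8 * ε * electricDet F e ^ 2 * hε

include hself in
lemma urbantke_of_selfDual (hε1 : ε = 1) (i j : Fin 4) :
    urbantke F e (e i) (e j) = if i = j then 6 * electricDet F e else 0 := by
  subst hε1
  rw [one_smul] at h1 h2 h3
  fin_cases i <;> fin_cases j <;>
  · simp [urbantke, wedge, electricDet, hself, h1, h2, h3, hswap (e 1) (e 3), hswap (e 1) (e 0),
      hswap (e 2) (e 0), hswap (e 3) (e 0), hswap (e 2) (e 1), hswap (e 3) (e 2), cross_apply,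
      dotProduct, Fin.sum_univ_three]
    try ring

end Values

variable {F : T →ₗ[ℝ] T →ₗ[ℝ] (Fin 3 → ℝ)} {k : ℝ} (hF : ∀ u v, F u v = -F v u)
  (hdef : ∀ u v, LinearIndependent ℝ ![u, v] → F u v ≠ 0) (b : Module.Basis (Fin 4) ℝ T)
include hF

/-- The sign which makes the Urbantke form positive definite. -/
lemma urbantke_pos (hdef : ∀ u v, LinearIndependent ℝ ![u, v] → F u v ≠ 0) {u : T} (hu : u ≠ 0) :
    0 < urbantke (fun x y ↦ F x y) b (b 0) (b 0) / |urbantke (fun x y ↦ F x y) b (b 0) (b 0)| *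
      urbantke (fun x y ↦ F x y) b u u := by
  have h := mul_pos_of_anisotropic (B := urbantkeForm F b) (fun u v ↦ urbantke_symm b u v)
    (fun u hu ↦ urbantke_self_ne_zero hF hdef b hu) (b.ne_zero 0) hu
  have h0 := urbantke_self_ne_zero hF hdef b (b.ne_zero 0)
  simp only [urbantkeForm_apply] at h
  rw [div_mul_eq_mul_div]
  exact div_pos h (abs_pos.mpr h0)

/-- For a definite triple there is a basis `e` in which the Urbantke form is a non-zero multiple
of the identity. -/
lemma exists_urbantke_diagonal (b : Module.Basis (Fin 4) ℝ T)
    (hdef : ∀ u v, LinearIndependent ℝ ![u, v] → F u v ≠ 0) :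
    ∃ (e : Module.Basis (Fin 4) ℝ T) (lam : ℝ), lam ≠ 0 ∧
      ∀ i j, urbantke (fun x y ↦ F x y) e (e i) (e j) = if i = j then lam else 0 := by
  set s := urbantke (fun x y ↦ F x y) b (b 0) (b 0) /
    |urbantke (fun x y ↦ F x y) b (b 0) (b 0)| with hs
  have h0 := urbantke_self_ne_zero hF hdef b (b.ne_zero 0)
  have hs0 : s ≠ 0 := div_ne_zero h0 (abs_ne_zero.mpr h0)
  obtain ⟨e, he⟩ := exists_orthonormal_basis b (s • urbantkeForm F b)
    (fun u v ↦ by simp [urbantke_symm b u v]) (fun u hu ↦ urbantke_pos hF b hdef hu)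
  -- Passing from `b` to `e` multiplies the Urbantke form by `b.det e`.
  have hd : b.det e ≠ 0 := (b.isUnit_det e).ne_zero
  refine ⟨e, b.det e / s, div_ne_zero hd hs0, fun i j ↦ ?_⟩
  have := he i j
  simp only [LinearMap.smul_apply, urbantkeForm_apply, smul_eq_mul] at this
  rw [urbantke_eq_det_mul hF b e, eq_div_of_mul_eq hs0 ((mul_comm _ _).trans this)]
  split_ifs <;> ring

omit hF in
lemma trace_wedgeMatrix_smul (d : ℝ) (M : Matrix (Fin 3) (Fin 3) ℝ) :
    (d • M).trace = d * M.trace ∧ (d • M).det = d ^ 3 * M.det := by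
  simp [Matrix.det_smul]

include hdef

/-- For a definite triple the matrix `Fᵢ ∧ Fⱼ` is definite; in particular its trace and its
determinant have the same sign. -/
lemma trace_div_det_pos :
    0 < (wedgeMatrix (fun x y ↦ F x y) b).trace / (wedgeMatrix (fun x y ↦ F x y) b).det := by
  have hself : ∀ u, F u u = 0 := fun u ↦ self_eq_neg.mp (hF u u)
  obtain ⟨e, lam, hlam, he⟩ := exists_urbantke_diagonal hF b hdef
  obtain ⟨hD, ε, hε, h1, h2, h3⟩ := selfDual_or_antiSelfDual_of_urbantke (F := fun x y ↦ F x y)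
    hself hF hlam he
  have htr := trace_wedgeMatrix_of_dual (F := fun x y ↦ F x y) hF h1 h2 h3
  have hdet := det_wedgeMatrix_of_dual (F := fun x y ↦ F x y) hF hε h1 h2 h3
  set D := electricDet (fun x y ↦ F x y) e with hDd
  set S := ∑ i, (F (e 0) (e 1) i ^ 2 + F (e 0) (e 2) i ^ 2 + F (e 0) (e 3) i ^ 2) with hS
  have hD0 : D ≠ 0 := by rw [hD]; positivity
  have hSpos : 0 < S := by
    have hnn : ∀ i, 0 ≤ F (e 0) (e 1) i ^ 2 + F (e 0) (e 2) i ^ 2 + F (e 0) (e 3) i ^ 2 :=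
      fun i ↦ by positivity
    rcases (Finset.sum_nonneg fun i _ ↦ hnn i).lt_or_eq with h | h
    · exact h
    · exfalso
      apply hdef (e 0) (e 1) ?_
      · ext i
        have := (Finset.sum_eq_zero_iff_of_nonneg fun i _ ↦ hnn i).mp h.symm i (Finset.mem_univ i)
        have h1 : F (e 0) (e 1) i ^ 2 = 0 := by
          nlinarith [sq_nonneg (F (e 0) (e 1) i), sq_nonneg (F (e 0) (e 2) i), sq_nonneg (F (e 0) (e 3) i)]
        simpa using h1
      · have := e.linearIndependent.comp (![0, 1] : Fin 2 → Fin 4) (by decide)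
        convert this using 1
        ext i; fin_cases i <;> rfl
  have hε0 : ε ≠ 0 := by rintro rfl; norm_num at hε
  rw [wedgeMatrix_eq_det_smul hF e b]
  obtain ⟨ht, hd⟩ := trace_wedgeMatrix_smul (e.det b) (wedgeMatrix (fun x y ↦ F x y) e)
  have hdb : e.det b ≠ 0 := (e.isUnit_det b).ne_zero
  rw [ht, hd, htr, hdet]
  have : e.det b * (2 * ε * S) / (e.det b ^ 3 * (8 * ε * D ^ 2)) = S / (4 * e.det b ^ 2 * D ^ 2) := by
    field_simp; ring
  rw [this]
  positivity

/-- The rescaled Urbantke form is a metric of the triple. -/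
lemma isTripleMetric_urbantke (hk : 0 < k) :
    IsTripleMetric k F (metricScale k (fun x y ↦ F x y) b • urbantkeForm F b) := by
  have hself : ∀ u, F u u = 0 := fun u ↦ self_eq_neg.mp (hF u u)
  have hpos := trace_div_det_pos hF hdef b
  set τ := (wedgeMatrix (fun x y ↦ F x y) b).trace with hτ
  set δ := (wedgeMatrix (fun x y ↦ F x y) b).det with hδ
  have hratio : 0 < 2 * (k / 3 * τ) / (9 * δ) := by
    have : 2 * (k / 3 * τ) / (9 * δ) = 2 * k / 27 * (τ / δ) := by
      rw [show τ / δ = τ * δ⁻¹ from rfl, div_eq_mul_inv _ (9 * δ), mul_inv]; ring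
    rw [this]; positivity
  have hδ0 : δ ≠ 0 := by intro h; rw [h] at hpos; simp at hpos
  have h0 := urbantke_self_ne_zero hF hdef b (b.ne_zero 0)
  set s := urbantke (fun x y ↦ F x y) b (b 0) (b 0) /
    |urbantke (fun x y ↦ F x y) b (b 0) (b 0)| with hs
  have hs2 : s ^ 2 = 1 := by
    rw [hs, div_pow, sq_abs, div_self (pow_ne_zero 2 h0)]
  set ρ := metricScale k (fun x y ↦ F x y) b with hρ
  have hρs : ρ = s * √(2 * (k / 3 * τ) / (9 * δ)) := rfl
  have hρ2 : ρ ^ 2 = 2 * (k / 3 * τ) / (9 * δ) := by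
    rw [hρs, mul_pow, hs2, Real.sq_sqrt hratio.le, one_mul]
  have hρ0 : ρ ≠ 0 := by
    intro h
    rw [h] at hρ2
    exact hratio.ne (by rw [← hρ2]; ring)
  refine ⟨fun u v ↦ by simp [urbantke_symm b u v], fun u hu ↦ ?_, fun e' he' ↦ ?_⟩
  · have := urbantke_pos hF b hdef hu
    have h2 : (ρ • urbantkeForm F b) u u =
        √(2 * (k / 3 * τ) / (9 * δ)) * (s * urbantke (fun x y ↦ F x y) b u u) := by
      simp only [LinearMap.smul_apply, urbantkeForm_apply, smul_eq_mul, hρs]; ring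
    rw [h2]
    exact mul_pos (Real.sqrt_pos.mpr hratio) this
  -- In an orthonormal basis for the rescaled form, the triple is self-dual or anti-self-dual; the sign
  -- `ε` turns out to be the value of the volume form.
  · obtain ⟨e, rfl⟩ := exists_basis_of_orthonormal b he'
    have hd : b.det e ≠ 0 := (b.isUnit_det e).ne_zero
    set d := b.det e with hdd
    have he : ∀ i j, urbantke (fun x y ↦ F x y) e (e i) (e j) = if i = j then d / ρ else 0 := by
      intro i j
      have := he' i j
      simp only [LinearMap.smul_apply, urbantkeForm_apply, smul_eq_mul] at this
      rw [urbantke_eq_det_mul hF b e, eq_div_of_mul_eq hρ0 ((mul_comm _ _).trans this)]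
      split_ifs <;> ring
    obtain ⟨hD, ε, hε, h1, h2, h3⟩ := selfDual_or_antiSelfDual_of_urbantke (F := fun x y ↦ F x y)
      hself hF (div_ne_zero hd hρ0) he
    have hdet := det_wedgeMatrix_of_dual (F := fun x y ↦ F x y) hF hε h1 h2 h3
    obtain ⟨ht, hdet'⟩ := trace_wedgeMatrix_smul d (wedgeMatrix (fun x y ↦ F x y) b)
    rw [← wedgeMatrix_eq_det_smul hF b e] at ht hdet'
    rw [hdet', hD] at hdet
    rw [ht]
    rw [← hτ, ← hδ] at *
    have hεμ : k / 3 * (d * τ) = ε := by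
      -- compare the two expressions for the determinant
      have hkτ : k / 3 * τ = 9 * δ * ρ ^ 2 / 2 := by rw [hρ2]; field_simp
      have hdδ : d * δ * 36 * ρ ^ 2 = 8 * ε := by
        field_simp at hdet
        linear_combination hdet
      linear_combination d * hkτ + hdδ / 8
    rw [hεμ]
    have hε' : ε = 1 ∨ ε = -1 := sq_eq_one_iff.mp hε
    rcases hε' with rfl | rfl
    · simp only [one_smul] at h1 h2 h3
      exact ⟨by simp, fun _ ↦ ⟨h1.symm, h2.symm, h3.symm⟩⟩
    · exact ⟨by simp, fun h ↦ by norm_num at h⟩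

omit hF hdef in
lemma wedgeMatrix_trace_neg_zero (e : Fin 4 → T) :
    (wedgeMatrix (fun x y ↦ F x y) ![-e 0, e 1, e 2, e 3]).trace =
      -(wedgeMatrix (fun x y ↦ F x y) e).trace := by
  simp [trace_wedgeMatrix, wedge]
  ring

omit hF hdef in
/-- A metric of a triple has an orthonormal basis on which the volume form is `1`. -/
lemma IsTripleMetric.exists_oriented_basis {g : LinearMap.BilinForm ℝ T} (hg : IsTripleMetric k F g)
    (b : Module.Basis (Fin 4) ℝ T) :
    ∃ e : Module.Basis (Fin 4) ℝ T, (∀ i j, g (e i) (e j) = if i = j then 1 else 0) ∧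
      k / 3 * (wedgeMatrix (fun x y ↦ F x y) e).trace = 1 := by
  obtain ⟨e, he⟩ := exists_orthonormal_basis b g hg.1 hg.2.1
  rcases eq_or_eq_neg_of_abs_eq (hg.2.2 e he).1 with h | h
  · exact ⟨e, he, h⟩
  -- Otherwise change the sign of the first vector.
  · have he' : ∀ i j, g ((![-e 0, e 1, e 2, e 3] : Fin 4 → T) i)
        ((![-e 0, e 1, e 2, e 3] : Fin 4 → T) j) = if i = j then 1 else 0 := by
      intro i j
      fin_cases i <;> fin_cases j <;> simp [he]
    obtain ⟨e', h'⟩ := exists_basis_of_orthonormal b he'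
    refine ⟨e', by rwa [h'], ?_⟩
    rw [h', wedgeMatrix_trace_neg_zero]
    linarith

/-- The metric of a triple is unique: evaluating the Urbantke form in an oriented orthonormal
basis recovers the metric. -/
lemma IsTripleMetric.eq_urbantke {g : LinearMap.BilinForm ℝ T} (hg : IsTripleMetric k F g) :
    g = metricScale k (fun x y ↦ F x y) b • urbantkeForm F b := by
  have hself : ∀ u, F u u = 0 := fun u ↦ self_eq_neg.mp (hF u u)
  obtain ⟨e, he, hμ⟩ := hg.exists_oriented_basis b
  obtain ⟨h1, h2, h3⟩ := (hg.2.2 e he).2 (by rw [hμ]; norm_num)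
  have h1' : F (e 2) (e 3) = (1 : ℝ) • F (e 0) (e 1) := by rw [one_smul, h1]
  have h2' : F (e 3) (e 1) = (1 : ℝ) • F (e 0) (e 2) := by rw [one_smul, h2]
  have h3' : F (e 1) (e 2) = (1 : ℝ) • F (e 0) (e 3) := by rw [one_smul, h3]
  have hu := urbantke_of_selfDual (F := fun x y ↦ F x y) hself hF h1' h2' h3' rfl
  have hdet := det_wedgeMatrix_of_dual (F := fun x y ↦ F x y) hF (by norm_num) h1' h2' h3'
  set D := electricDet (fun x y ↦ F x y) e with hD
  have hd : e.det b ≠ 0 := (e.isUnit_det b).ne_zero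
  set d := e.det b with hdd
  have key : ∀ u v, urbantke (fun x y ↦ F x y) b u v = d * (6 * D) * g u v := by
    have : urbantkeForm F b = (d * (6 * D)) • g := by
      refine e.ext fun i ↦ e.ext fun j ↦ ?_
      simp only [LinearMap.smul_apply, urbantkeForm_apply, smul_eq_mul,
        urbantke_eq_det_mul hF e b, hu, he, ← hdd]
      split_ifs <;> simp
    intro u v
    rw [← urbantkeForm_apply, this]; simp
  obtain ⟨ht, hdet'⟩ := trace_wedgeMatrix_smul d (wedgeMatrix (fun x y ↦ F x y) e)
  rw [← wedgeMatrix_eq_det_smul hF e b] at ht hdet'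
  have hbb := hg.2.1 (b 0) (b.ne_zero 0)
  have hD0 : D ≠ 0 := by
    have := urbantke_self_ne_zero hF hdef e (e.ne_zero 0)
    rw [hu, if_pos rfl] at this
    exact right_ne_zero_of_mul this
  -- The factor does not depend on `D`, because `D²` is determined by the determinant of `Fᵢ ∧ Fⱼ`.
  have hscale : metricScale k (fun x y ↦ F x y) b = (d * (6 * D))⁻¹ := by
      have hq : d * (6 * D) ≠ 0 := mul_ne_zero hd (mul_ne_zero (by norm_num) hD0)
      rw [metricScale, key, ht, hdet', hdet]
      have : 2 * (k / 3 * (d * (wedgeMatrix (fun x y ↦ F x y) e).trace)) / (9 * (d ^ 3 * (8 * 1 * D ^ 2)))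
          = ((d * (6 * D))⁻¹) ^ 2 := by
        rw [show k / 3 * (d * (wedgeMatrix (fun x y ↦ F x y) e).trace) = d by linear_combination d * hμ]
        field_simp; ring
      rw [this, Real.sqrt_sq_eq_abs, abs_mul (d * (6 * D)), abs_of_pos hbb, abs_inv]
      have ha : |d * (6 * D)| ≠ 0 := abs_ne_zero.mpr hq
      field_simp
      rw [sq_abs]
      ring
  ext u v
  have hq : d * (6 * D) ≠ 0 := mul_ne_zero hd (mul_ne_zero (by norm_num) hD0)
  simp only [LinearMap.smul_apply, urbantkeForm_apply, smul_eq_mul, key, hscale]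
  rw [← mul_assoc, inv_mul_cancel₀ hq, one_mul]

end LinearAlgebra

/-! ### Inner products in terms of the Gram matrix -/

section LinearAlgebra

open scoped Matrix

variable {T : Type*} [AddCommGroup T] [Module ℝ T]

/-- The Gram matrix of four vectors. -/
def gram (g : LinearMap.BilinForm ℝ T) (b : Fin 4 → T) : Matrix (Fin 4) (Fin 4) ℝ :=
  Matrix.of fun i j ↦ g (b i) (b j)

variable {g : LinearMap.BilinForm ℝ T} {e : Module.Basis (Fin 4) ℝ T}
  (he : ∀ i j, g (e i) (e j) = if i = j then 1 else 0) (b : Module.Basis (Fin 4) ℝ T)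
include he

lemma gram_mul_toMatrix : gram g b * (b.toMatrix e * (b.toMatrix e)ᵀ) = 1 := by
  have hg : gram g b = (e.toMatrix b)ᵀ * e.toMatrix b := by
    ext i j
    have hi := (e.sum_repr (b i)).symm
    have hj := (e.sum_repr (b j)).symm
    simp only [gram, Matrix.of_apply, Matrix.mul_apply, Matrix.transpose_apply,
      Module.Basis.toMatrix_apply]
    have key : ∀ c d : Fin 4 → ℝ, g (∑ a, c a • e a) (∑ a, d a • e a) = ∑ a, c a * d a := by
      intro c d
      simp [map_sum, LinearMap.sum_apply, he, mul_comm]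
    conv_lhs => rw [hi, hj]
    exact key _ _
  rw [hg, Matrix.mul_assoc, ← Matrix.mul_assoc (e.toMatrix b), e.toMatrix_mul_toMatrix_flip b, Matrix.one_mul,
    ← Matrix.transpose_mul, b.toMatrix_mul_toMatrix_flip e, Matrix.transpose_one]

lemma gram_inv_eq : (gram g b)⁻¹ = b.toMatrix e * (b.toMatrix e)ᵀ :=
  Matrix.inv_eq_right_inv (gram_mul_toMatrix he b)

lemma isUnit_det_gram : IsUnit (gram g b).det := by
  have h := congrArg Matrix.det (gram_mul_toMatrix he b)
  rw [Matrix.det_mul, Matrix.det_one] at h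
  exact IsUnit.of_mul_eq_one _ h

/-- A contraction with the inverse Gram matrix can be computed in an orthonormal basis. -/
lemma sum_gram_inv_mul (B : T →ₗ[ℝ] T →ₗ[ℝ] ℝ) :
    ∑ i, ∑ j, (gram g b)⁻¹ i j * B (b i) (b j) = ∑ a, B (e a) (e a) := by
  have hea : ∀ a, e a = ∑ i, b.toMatrix e i a • b i := fun a ↦ by
    simp [Module.Basis.toMatrix_apply, b.sum_repr]
  have hB : ∀ a, B (e a) (e a) = ∑ i, ∑ j, b.toMatrix e i a * b.toMatrix e j a * B (b i) (b j) := by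
    intro a
    conv_lhs => rw [hea a]
    simp only [map_sum, LinearMap.sum_apply, map_smul, LinearMap.smul_apply, smul_eq_mul,
      Finset.mul_sum]
    rw [Finset.sum_comm]
    refine Finset.sum_congr rfl fun i _ ↦ Finset.sum_congr rfl fun j _ ↦ ?_
    ring
  simp only [hB, gram_inv_eq he b, Matrix.mul_apply, Matrix.transpose_apply, Finset.sum_mul]
  rw [Finset.sum_comm' (t' := Finset.univ) (s' := fun _ ↦ Finset.univ) (by simp)]
  rw [Finset.sum_comm]
  conv_rhs => rw [Finset.sum_comm]
  refine Finset.sum_congr rfl fun i _ ↦ ?_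
  conv_rhs => rw [Finset.sum_comm]

/-- The contraction of two bilinear maps with the inverse Gram matrix, in an orthonormal basis. -/
lemma sum_gram_inv_mul₂ (S R : T →ₗ[ℝ] T →ₗ[ℝ] (Fin 3 → ℝ)) :
    ∑ i, ∑ j, ∑ k, ∑ l, (gram g b)⁻¹ i k * (gram g b)⁻¹ j l * (S (b i) (b j) ⬝ᵥ R (b k) (b l))
      = ∑ a, ∑ c, S (e a) (e c) ⬝ᵥ R (e a) (e c) := by
  have h1 : ∀ u w, ∑ j, ∑ l, (gram g b)⁻¹ j l * (S u (b j) ⬝ᵥ R w (b l))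
      = ∑ c, S u (e c) ⬝ᵥ R w (e c) := fun u w ↦
    sum_gram_inv_mul he b (dotₗ.compl₁₂ (S u) (R w))
  have h2 := sum_gram_inv_mul he b (∑ c, dotₗ.compl₁₂ (S.flip (e c)) (R.flip (e c)))
  simp only [LinearMap.sum_apply, LinearMap.compl₁₂_apply, LinearMap.flip_apply,
    dotProductBilin_apply_apply] at h2
  rw [← h2]
  refine Finset.sum_congr rfl fun i _ ↦ ?_
  rw [Finset.sum_comm]
  refine Finset.sum_congr rfl fun k _ ↦ ?_
  rw [← h1, Finset.mul_sum]
  refine Finset.sum_congr rfl fun j _ ↦ ?_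
  rw [Finset.mul_sum]
  refine Finset.sum_congr rfl fun l _ ↦ ?_
  ring

omit he

variable {F : T →ₗ[ℝ] T →ₗ[ℝ] (Fin 3 → ℝ)} {k : ℝ} (hF : ∀ u v, F u v = -F v u)
include hF

/-- The inner product of a self-dual 2-form with another 2-form is given by the wedge product. -/
lemma IsTripleMetric.mul_inner_eq_wedge (hg : IsTripleMetric k F g)
    {S R : T →ₗ[ℝ] T →ₗ[ℝ] (Fin 3 → ℝ)} (hS : ∀ u v, S u v = -S v u) (hR : ∀ u v, R u v = -R v u)
    (hSF : ∃ C : (Fin 3 → ℝ) →ₗ[ℝ] (Fin 3 → ℝ), ∀ u v, S u v = C (F u v)) :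
    (k / 3 * (wedgeMatrix (fun x y ↦ F x y) b).trace) * ((1 / 2) * ∑ i, ∑ j, ∑ p, ∑ l,
      (gram g b)⁻¹ i p * (gram g b)⁻¹ j l * (S (b i) (b j) ⬝ᵥ R (b p) (b l))) =
      wedge (fun x y : Fin 3 → ℝ ↦ x ⬝ᵥ y) (fun x y ↦ S x y) (fun x y ↦ R x y) b := by
  obtain ⟨e, he, hμ⟩ := hg.exists_oriented_basis b
  obtain ⟨h1, h2, h3⟩ := (hg.2.2 e he).2 (by rw [hμ]; norm_num)
  obtain ⟨C, hC⟩ := hSF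
  have s1 : S (e 0) (e 1) = S (e 2) (e 3) := by rw [hC, hC, h1]
  have s2 : S (e 0) (e 2) = S (e 3) (e 1) := by rw [hC, hC, h2]
  have s3 : S (e 0) (e 3) = S (e 1) (e 2) := by rw [hC, hC, h3]
  have hself : ∀ u, S u u = 0 := fun u ↦ self_eq_neg.mp (hS u u)
  have hw : wedge (fun x y : Fin 3 → ℝ ↦ x ⬝ᵥ y) (fun x y ↦ S x y) (fun x y ↦ R x y) b = _ :=
    wedge_eq_det_mul dotₗ S R hS hR e b
  rw [sum_gram_inv_mul₂ he b, hw, wedgeMatrix_eq_det_smul hF e b,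
    (trace_wedgeMatrix_smul _ _).1]
  have hsum : (1 / 2) * ∑ a, ∑ c, S (e a) (e c) ⬝ᵥ R (e a) (e c) =
      wedge (fun x y ↦ dotₗ x y) (fun x y ↦ S x y) (fun x y ↦ R x y) e := by
    simp only [Fin.sum_univ_four, wedge, hself, hS (e 1) (e 0), hS (e 2) (e 0), hS (e 3) (e 0),
      hS (e 2) (e 1), hS (e 3) (e 2), hS (e 1) (e 3), hR (e 1) (e 0), hR (e 2) (e 0), hR (e 3) (e 0),
      hR (e 2) (e 1), hR (e 3) (e 2), hR (e 3) (e 1), dotProductBilin_apply_apply, s1, s2, s3]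
    simp
    ring
  rw [hsum]
  linear_combination e.det b * wedge (fun x y ↦ dotₗ x y) (fun x y ↦ S x y) (fun x y ↦ R x y) e * hμ

end LinearAlgebra

/-! ### Local orthonormal frames and local representatives -/

section Frame

variable {X : Type*} [TopologicalSpace X] [ChartedSpace R4 X]
  {V : X → Type*} [TopologicalSpace (TotalSpace R3 V)]
  [∀ x, NormedAddCommGroup (V x)] [∀ x, InnerProductSpace ℝ (V x)]
  [FiberBundle R3 V]

/-- A section of a bundle with model fibre `F` is smooth on a set. -/
abbrev SmoothSecOn (F : Type*) [NormedAddCommGroup F] [NormedSpace ℝ F] {E : X → Type*}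
    [TopologicalSpace (TotalSpace F E)] [∀ x, TopologicalSpace (E x)] [FiberBundle F E]
    (s : Π x : X, E x) (U : Set X) : Prop :=
  ContMDiffOn (𝓡 4) ((𝓡 4).prod 𝓘(ℝ, F)) ∞ (fun x ↦ TotalSpace.mk' F x (s x)) U

/-- A section of a bundle with model fibre `F` is smooth at a point. -/
abbrev SmoothSecAt (F : Type*) [NormedAddCommGroup F] [NormedSpace ℝ F] {E : X → Type*}
    [TopologicalSpace (TotalSpace F E)] [∀ x, TopologicalSpace (E x)] [FiberBundle F E]
    (s : Π x : X, E x) (x₀ : X) : Prop :=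
  ContMDiffAt (𝓡 4) ((𝓡 4).prod 𝓘(ℝ, F)) ∞ (fun x ↦ TotalSpace.mk' F x (s x)) x₀

/-- A section of a bundle with model fibre `F` is differentiable at a point. -/
abbrev DiffSecAt (F : Type*) [NormedAddCommGroup F] [NormedSpace ℝ F] {E : X → Type*}
    [TopologicalSpace (TotalSpace F E)] [∀ x, TopologicalSpace (E x)] [FiberBundle F E]
    (s : Π x : X, E x) (x₀ : X) : Prop :=
  MDifferentiableAt (𝓡 4) ((𝓡 4).prod 𝓘(ℝ, F)) (fun x ↦ TotalSpace.mk' F x (s x)) x₀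

variable (V) in
/-- A smooth orthonormal frame of the bundle over an open subset of the domain of the chart at
`p`. The chart is independent of the point around which the frame is constructed. -/
structure ChartFrame (p : X) where
  /-- the domain -/
  U : Set X
  /-- the sections -/
  fr : Fin 3 → Π x : X, V x
  isOpen : IsOpen U
  subset : U ⊆ (chartAt R4 p).source
  orthonormal : ∀ x ∈ U, Orthonormal ℝ fun k ↦ fr k x
  smooth : ∀ k, SmoothSecOn R3 (fr k) U

variable [IsManifold (𝓡 4) ∞ X] [VectorBundle ℝ R3 V] [ContMDiffVectorBundle ∞ R3 V (𝓡 4)]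
  [IsContMDiffRiemannianBundle (𝓡 4) ∞ R3 V]

lemma contMDiffOn_gramSchmidt {f : Fin 3 → Π x : X, V x} {U : Set X}
    (hf : ∀ k, SmoothSecOn R3 (f k) U) (hli : ∀ x ∈ U, LinearIndependent ℝ fun k ↦ f k x)
    (n : Fin 3) :
    SmoothSecOn R3 (fun x ↦ InnerProductSpace.gramSchmidt ℝ (fun k ↦ f k x) n) U := by
  induction n using WellFoundedLT.induction with
  | ind n ih =>
    have hsum : SmoothSecOn R3 (fun x ↦ f n x - ∑ i ∈ Finset.Iio n,
        (inner ℝ (InnerProductSpace.gramSchmidt ℝ (fun k ↦ f k x) i) (f n x) /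
          inner ℝ (InnerProductSpace.gramSchmidt ℝ (fun k ↦ f k x) i)
            (InnerProductSpace.gramSchmidt ℝ (fun k ↦ f k x) i)) •
            InnerProductSpace.gramSchmidt ℝ (fun k ↦ f k x) i) U := by
      refine (hf n).sub_section (.sum_section fun i hi ↦ ?_)
      have hi' := ih i (Finset.mem_Iio.mp hi)
      refine ContMDiffOn.smul_section ?_ hi'
      refine (hi'.inner_bundle (hf n)).div₀ (hi'.inner_bundle hi') fun x hx ↦ ?_
      exact inner_self_ne_zero.mpr (InnerProductSpace.gramSchmidt_ne_zero i (hli x hx))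
    refine hsum.congr fun x hx ↦ ?_
    refine congrArg (TotalSpace.mk' R3 x) ?_
    beta_reduce
    rw [InnerProductSpace.gramSchmidt_def]
    refine congrArg _ (Finset.sum_congr rfl fun i _ ↦ ?_)
    rw [Submodule.starProjection_singleton, real_inner_self_eq_norm_sq]
    rfl

lemma exists_chartFrame (p x₀ : X) (hx₀ : x₀ ∈ (chartAt R4 p).source) :
    ∃ L : ChartFrame V p, x₀ ∈ L.U := by
  let t := trivializationAt R3 V x₀
  let b := (EuclideanSpace.basisFun (Fin 3) ℝ).toBasis
  let f := t.localFrame b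
  have hli : ∀ x ∈ (chartAt R4 p).source ∩ t.baseSet, LinearIndependent ℝ fun k ↦ f k x :=
    fun x hx ↦ (t.isLocalFrameOn_localFrame_baseSet (𝓡 4) ∞ b).linearIndependent hx.2
  have hf : ∀ k, SmoothSecOn R3 (f k) ((chartAt R4 p).source ∩ t.baseSet) :=
    fun k ↦ (t.contMDiffOn_localFrame_baseSet ∞ b k).mono Set.inter_subset_right
  have hgs := contMDiffOn_gramSchmidt hf hli
  refine ⟨⟨(chartAt R4 p).source ∩ t.baseSet,
    fun k x ↦ InnerProductSpace.gramSchmidtNormed ℝ (fun k ↦ f k x) k,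
    (chartAt R4 p).open_source.inter t.open_baseSet, Set.inter_subset_left,
    fun x hx ↦ InnerProductSpace.gramSchmidtNormed_orthonormal (hli x hx), fun k ↦ ?_⟩,
    hx₀, mem_baseSet_trivializationAt' x₀⟩
  have hne : ∀ x ∈ (chartAt R4 p).source ∩ t.baseSet,
      InnerProductSpace.gramSchmidt ℝ (fun k ↦ f k x) k ≠ 0 :=
    fun x hx ↦ InnerProductSpace.gramSchmidt_ne_zero k (hli x hx)
  have hn : ContMDiffOn (𝓡 4) 𝓘(ℝ, ℝ) ∞
      (fun x ↦ (√(inner ℝ (InnerProductSpace.gramSchmidt ℝ (fun k ↦ f k x) k)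
        (InnerProductSpace.gramSchmidt ℝ (fun k ↦ f k x) k)))⁻¹)
      ((chartAt R4 p).source ∩ t.baseSet) := by
    intro x hx
    have h0 : inner ℝ (InnerProductSpace.gramSchmidt ℝ (fun k ↦ f k x) k)
        (InnerProductSpace.gramSchmidt ℝ (fun k ↦ f k x) k) ≠ 0 := inner_self_ne_zero.mpr (hne x hx)
    have h1 : ContDiffAt ℝ ∞ (fun r : ℝ ↦ (√r)⁻¹)
        (inner ℝ (InnerProductSpace.gramSchmidt ℝ (fun k ↦ f k x) k)
        (InnerProductSpace.gramSchmidt ℝ (fun k ↦ f k x) k)) :=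
      (Real.contDiffAt_sqrt h0).inv (by
        rw [Real.sqrt_ne_zero']
        exact lt_of_le_of_ne real_inner_self_nonneg h0.symm)
    exact ContMDiffAt.comp_contMDiffWithinAt (g := fun r : ℝ ↦ (√r)⁻¹)
      (f := fun x ↦ inner ℝ (InnerProductSpace.gramSchmidt ℝ (fun k ↦ f k x) k)
        (InnerProductSpace.gramSchmidt ℝ (fun k ↦ f k x) k)) x h1.contMDiffAt
      ((hgs k).inner_bundle (hgs k) x hx)
  refine (hn.smul_section (hgs k)).congr fun x hx ↦ ?_
  refine congrArg (TotalSpace.mk' R3 x) ?_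
  beta_reduce
  simp only [← norm_eq_sqrt_real_inner]
  rfl

end Frame

/-! ### Coordinate representatives -/

section Coord

variable {X : Type*} [TopologicalSpace X] [ChartedSpace R4 X] [IsManifold (𝓡 4) ∞ X]

/-- The derivative of the inverse of the chart at `p`, at the point with coordinates `y`; it sends
the standard basis to the coordinate vectors `coordField p y`. -/
noncomputable def coordMap (p : X) (y : R4) :
    R4 →L[ℝ] TangentSpace (𝓡 4) ((extChartAt (𝓡 4) p).symm y) :=
  mfderiv 𝓘(ℝ, R4) (𝓡 4) (extChartAt (𝓡 4) p).symm y

/-- The coordinate expression of a vector field in the chart at `p`. -/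
noncomputable def vrep (p : X) (W : Π x : X, TangentSpace (𝓡 4) x) (y : R4) : R4 :=
  (coordMap p y).inverse (W ((extChartAt (𝓡 4) p).symm y))

lemma coordMap_single (p : X) (y : R4) (i : Fin 4) :
    coordMap p y (EuclideanSpace.single i 1) = coordField p y i := rfl

lemma coordMap_isInvertible {p : X} {y : R4} (hy : y ∈ (extChartAt (𝓡 4) p).target) :
    (coordMap p y).IsInvertible := by
  have h := isInvertible_mfderivWithin_extChartAt_symm (I := 𝓡 4) hy
  rwa [ModelWithCorners.range_eq_univ, mfderivWithin_univ] at h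

lemma coordMap_vrep {p : X} {y : R4} (hy : y ∈ (extChartAt (𝓡 4) p).target)
    (W : Π x : X, TangentSpace (𝓡 4) x) :
    coordMap p y (vrep p W y) = W ((extChartAt (𝓡 4) p).symm y) := by
  obtain ⟨e, he⟩ := coordMap_isInvertible hy
  rw [vrep, ← he, ContinuousLinearMap.inverse_equiv]
  exact e.apply_symm_apply _

lemma contMDiffAt_extChartAt_symm' {p : X} {y : R4} (hy : y ∈ (extChartAt (𝓡 4) p).target) :
    ContMDiffAt 𝓘(ℝ, R4) (𝓡 4) ∞ (extChartAt (𝓡 4) p).symm y :=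
  (contMDiffOn_extChartAt_symm (I := 𝓡 4) p).contMDiffAt ((isOpen_extChartAt_target p).mem_nhds hy)

lemma differentiableAt_vrep {p : X} {y : R4} (hy : y ∈ (extChartAt (𝓡 4) p).target)
    {W : Π x : X, TangentSpace (𝓡 4) x}
    (hW : DiffSecAt R4 W ((extChartAt (𝓡 4) p).symm y)) :
    DifferentiableAt ℝ (vrep p W) y := by
  have h := hW.mpullback_vectorField (I := 𝓘(ℝ, R4)) (contMDiffAt_extChartAt_symm' hy)
    (coordMap_isInvertible hy) (by norm_cast)
  have h2 := ((contMDiff_snd_tangentBundle_modelSpace R4 𝓘(ℝ, R4)).contMDiffAt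
    (n := 1)).mdifferentiableAt one_ne_zero |>.comp _ h
  exact h2.differentiableAt

lemma vrep_mlieBracket {p : X} {y : R4} (hy : y ∈ (extChartAt (𝓡 4) p).target)
    {U W : Π x : X, TangentSpace (𝓡 4) x}
    (hU : DiffSecAt R4 U ((extChartAt (𝓡 4) p).symm y))
    (hW : DiffSecAt R4 W ((extChartAt (𝓡 4) p).symm y)) :
    vrep p (VectorField.mlieBracket (𝓡 4) U W) y =
      fderiv ℝ (vrep p W) y (vrep p U y) - fderiv ℝ (vrep p U) y (vrep p W y) := by
  have h2 : IsManifold (𝓡 4) (minSmoothness ℝ 2) X := by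
    rw [minSmoothness_of_isRCLikeNormedField]
    exact IsManifold.of_le (n := ∞) (by norm_cast)
  have h := VectorField.mpullback_mlieBracket (I := 𝓘(ℝ, R4)) hU hW
    (contMDiffAt_extChartAt_symm' hy)
    (by rw [minSmoothness_of_isRCLikeNormedField]; norm_cast)
  have e : VectorField.mlieBracket 𝓘(ℝ, R4) (vrep p U) (vrep p W) =
      VectorField.lieBracket ℝ (vrep p U) (vrep p W) :=
    (VectorField.mlieBracketWithin_univ (I := 𝓘(ℝ, R4))).symm.trans
      (VectorField.mlieBracketWithin_eq_lieBracketWithin.trans VectorField.lieBracketWithin_univ)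
  exact h.trans (congrFun e y)

/-- The constant vector field `w` in the chart at `p`, as a field on `X`. -/
noncomputable def coordVec (p : X) (w : R4) (x : X) : TangentSpace (𝓡 4) x :=
  Trivialization.symmL ℝ (trivializationAt R4 (TangentSpace (𝓡 4)) p) x w

lemma coordVec_symm {p : X} {y : R4} (hy : y ∈ (extChartAt (𝓡 4) p).target) (w : R4) :
    coordVec p w ((extChartAt (𝓡 4) p).symm y) = coordMap p y w := by
  have hx : (extChartAt (𝓡 4) p).symm y ∈ (chartAt R4 p).source := by
    simpa using (extChartAt (𝓡 4) p).map_target hy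
  rw [coordVec, TangentBundle.symmL_trivializationAt hx, ModelWithCorners.range_eq_univ,
    mfderivWithin_univ, (extChartAt (𝓡 4) p).right_inv hy]
  rfl

lemma contMDiffOn_coordVec (p : X) (w : R4) :
    SmoothSecOn R4 (coordVec p w) (chartAt R4 p).source := by
  have h := (trivializationAt R4 (TangentSpace (𝓡 4) (M := X)) p).contMDiffOn_section_baseSet_iff
    (IB := 𝓡 4) (n := ∞) (s := coordVec p w)
  rw [TangentBundle.trivializationAt_baseSet] at h
  refine h.mpr (contMDiffOn_const (c := w) |>.congr fun x hx ↦ ?_)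
  rw [coordVec, Trivialization.symmL_apply, Trivialization.mk_symm, Trivialization.apply_symm_apply]
  all_goals simpa [Trivialization.mem_target] using hx

end Coord

section Rep

open scoped Matrix

variable {X : Type*} [TopologicalSpace X] [ChartedSpace R4 X] [IsManifold (𝓡 4) ∞ X]
  {V : X → Type*} [TopologicalSpace (TotalSpace R3 V)]
  [∀ x, NormedAddCommGroup (V x)] [∀ x, InnerProductSpace ℝ (V x)]
  [FiberBundle R3 V] [VectorBundle ℝ R3 V]

variable (V) in
lemma finrank_fibre (x : X) : Module.finrank ℝ (V x) = 3 := by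
  rw [(VectorBundle.continuousLinearEquivAt ℝ R3 V x).toLinearEquiv.finrank_eq]
  simp

variable {p : X} (L : ChartFrame V p)

/-- The coordinates of an element of a fibre with respect to the frame. -/
noncomputable def ChartFrame.coord (x : X) : V x →L[ℝ] (Fin 3 → ℝ) :=
  ContinuousLinearMap.pi fun k ↦ innerSL ℝ (L.fr k x)

lemma ChartFrame.coord_apply (x : X) (s : V x) (k : Fin 3) :
    L.coord x s k = inner ℝ (L.fr k x) s := rfl

/-- The orthonormal basis of a fibre given by the frame. -/
noncomputable def ChartFrame.onb {x : X} (hx : x ∈ L.U) : OrthonormalBasis (Fin 3) ℝ (V x) :=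
  (basisOfOrthonormalOfCardEqFinrank (L.orthonormal x hx)
    (by rw [finrank_fibre, Fintype.card_fin])).toOrthonormalBasis
    (by rw [coe_basisOfOrthonormalOfCardEqFinrank]; exact L.orthonormal x hx)

lemma ChartFrame.onb_apply {x : X} (hx : x ∈ L.U) (k : Fin 3) : L.onb hx k = L.fr k x := by
  rw [ChartFrame.onb, Module.Basis.coe_toOrthonormalBasis, coe_basisOfOrthonormalOfCardEqFinrank]

lemma ChartFrame.sum_coord_smul {x : X} (hx : x ∈ L.U) (s : V x) :
    ∑ k, L.coord x s k • L.fr k x = s := by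
  simpa [ChartFrame.onb_apply, OrthonormalBasis.repr_apply_apply, L.coord_apply] using
    (L.onb hx).sum_repr s

lemma ChartFrame.inner_eq {x : X} (hx : x ∈ L.U) (s t : V x) :
    inner ℝ s t = L.coord x s ⬝ᵥ L.coord x t := by
  rw [← (L.onb hx).sum_inner_mul_inner s t]
  simp [dotProduct, L.coord_apply, ChartFrame.onb_apply, real_inner_comm]

lemma ChartFrame.coord_injective {x : X} (hx : x ∈ L.U) : Function.Injective (L.coord x) := by
  intro s t h
  rw [← L.sum_coord_smul hx s, h, L.sum_coord_smul hx]

lemma ChartFrame.coord_fr {x : X} (hx : x ∈ L.U) (k : Fin 3) :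
    L.coord x (L.fr k x) = Pi.single k 1 := by
  ext j
  rw [L.coord_apply, (orthonormal_iff_ite.mp (L.orthonormal x hx)) j k, Pi.single_apply]

/-- The domain of the frame in the coordinates of the chart. -/
def ChartFrame.dom : Set R4 :=
  (extChartAt (𝓡 4) p).target ∩ (extChartAt (𝓡 4) p).symm ⁻¹' L.U

lemma ChartFrame.isOpen_dom : IsOpen L.dom :=
  (continuousOn_extChartAt_symm p).isOpen_inter_preimage (isOpen_extChartAt_target p) L.isOpen

lemma ChartFrame.exists_dom {x : X} (hx : x ∈ L.U) :
    extChartAt (𝓡 4) p x ∈ L.dom ∧ (extChartAt (𝓡 4) p).symm (extChartAt (𝓡 4) p x) = x := by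
  have hs : x ∈ (extChartAt (𝓡 4) p).source := by simpa using L.subset hx
  refine ⟨⟨(extChartAt (𝓡 4) p).map_source hs, ?_⟩, (extChartAt (𝓡 4) p).left_inv hs⟩
  rwa [Set.mem_preimage, (extChartAt (𝓡 4) p).left_inv hs]

/-- The coordinate expression of a section. -/
noncomputable def ChartFrame.rep (S : Π x : X, V x) (y : R4) : Fin 3 → ℝ :=
  L.coord _ (S ((extChartAt (𝓡 4) p).symm y))

section Smooth

variable [ContMDiffVectorBundle ∞ R3 V (𝓡 4)] [IsContMDiffRiemannianBundle (𝓡 4) ∞ R3 V]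

lemma ChartFrame.smoothAt {y : R4} (hy : y ∈ L.dom) (k : Fin 3) :
    SmoothSecAt R3 (L.fr k) ((extChartAt (𝓡 4) p).symm y) :=
  (L.smooth k).contMDiffAt (L.isOpen.mem_nhds hy.2)

lemma ChartFrame.diffAt {y : R4} (hy : y ∈ L.dom) (k : Fin 3) :
    DiffSecAt R3 (L.fr k) ((extChartAt (𝓡 4) p).symm y) :=
  (L.smoothAt hy k).mdifferentiableAt (by simp)

lemma ChartFrame.differentiableAt_rep {y : R4} (hy : y ∈ L.dom) {S : Π x : X, V x}
    (hS : DiffSecAt R3 S ((extChartAt (𝓡 4) p).symm y)) : DifferentiableAt ℝ (L.rep S) y := by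
  refine differentiableAt_pi.mpr fun k ↦ ?_
  have h := (MDifferentiableAt.inner_bundle (L.diffAt hy k) hS).comp y
    ((contMDiffAt_extChartAt_symm' hy.1).mdifferentiableAt (by simp))
  exact h.differentiableAt

lemma ChartFrame.contDiffAt_rep {y : R4} (hy : y ∈ L.dom) {S : Π x : X, V x}
    (hS : SmoothSecAt R3 S ((extChartAt (𝓡 4) p).symm y)) : ContDiffAt ℝ ∞ (L.rep S) y := by
  refine contDiffAt_pi.mpr fun k ↦ ?_
  have h := (ContMDiffAt.inner_bundle (L.smoothAt hy k) hS).comp y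
    (contMDiffAt_extChartAt_symm' hy.1)
  exact h.contDiffAt

/-- The coordinates, under `𝔰𝔬(3) ≅ ℝ³`, of a 1-form with values in the skew endomorphisms whose
values on the frame are given. -/
noncomputable def ChartFrame.formRep (T : Π x : X, Fin 3 → TangentSpace (𝓡 4) x →L[ℝ] V x)
    (y : R4) : R4 →L[ℝ] (Fin 3 → ℝ) :=
  ContinuousLinearMap.pi fun m ↦ innerSL ℝ (L.fr (m + 2) ((extChartAt (𝓡 4) p).symm y)) ∘L
    (T ((extChartAt (𝓡 4) p).symm y) (m + 1)) ∘L coordMap p y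

lemma ChartFrame.formRep_apply (T : Π x : X, Fin 3 → TangentSpace (𝓡 4) x →L[ℝ] V x)
    (y w : R4) (m : Fin 3) : L.formRep T y w m =
      inner ℝ (L.fr (m + 2) _) (T ((extChartAt (𝓡 4) p).symm y) (m + 1) (coordMap p y w)) := rfl

lemma ChartFrame.contDiffOn_formRep {T : Π x : X, Fin 3 → TangentSpace (𝓡 4) x →L[ℝ] V x}
    (hT : ∀ k, SmoothSecOn (R4 →L[ℝ] R3) (fun x ↦ T x k) L.U) :
    ContDiffOn ℝ ∞ (L.formRep T) L.dom := by
  refine contDiffOn_clm_apply.mpr fun w ↦ contDiffOn_pi.mpr fun m ↦ ?_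
  have h1 : SmoothSecOn R3 (fun x ↦ T x (m + 1) (coordVec p w x)) L.U :=
    (hT (m + 1)).clm_bundle_apply ((contMDiffOn_coordVec p w).mono L.subset)
  have h2 := ContMDiffOn.inner_bundle (L.smooth (m + 2)) h1
  have h3 := (h2.comp ((contMDiffOn_extChartAt_symm (I := 𝓡 4) (n := ∞) p).mono
    Set.inter_subset_left) Set.inter_subset_right).contDiffOn
  refine h3.congr fun y hy ↦ ?_
  rw [L.formRep_apply, ← coordVec_symm hy.1]
  rfl

/-- A local smooth section agrees near a given point with a global smooth section. The covariant
derivative and the smoothness of 2-forms refer to global sections, so frames are extended in this way. -/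
lemma exists_smooth_extension {F : Type*} [NormedAddCommGroup F] [NormedSpace ℝ F]
    {E : X → Type*} [TopologicalSpace (TotalSpace F E)] [∀ x, AddCommGroup (E x)]
    [∀ x, Module ℝ (E x)] [∀ x, TopologicalSpace (E x)] [FiberBundle F E] [VectorBundle ℝ F E]
    [T2Space X] {s : Π x : X, E x} {U : Set X} (hU : IsOpen U) (hs : SmoothSecOn F s U) {x₀ : X}
    (hx₀ : x₀ ∈ U) :
    ∃ S : Π x : X, E x,
      ContMDiff (𝓡 4) ((𝓡 4).prod 𝓘(ℝ, F)) ∞ (fun x ↦ TotalSpace.mk' F x (S x)) ∧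
      ∀ᶠ x in nhds x₀, S x = s x := by
  obtain ⟨ψ, -, hψ⟩ := (SmoothBumpFunction.nhds_basis_tsupport (I := 𝓡 4) x₀).mem_iff.mp
    (hU.mem_nhds hx₀)
  refine ⟨fun x ↦ ψ x • s x,
    ContMDiffOn.smul_section_of_tsupport ψ.contMDiff.contMDiffOn hU hψ hs, ?_⟩
  filter_upwards [ψ.eventuallyEq_one] with x hx
  rw [hx, Pi.one_apply, one_smul]

end Smooth

end Rep

/-! ### Connections and curvature in a local frame -/

section ConnRep

open scoped Matrix

variable {X : Type*} [TopologicalSpace X] [ChartedSpace R4 X] [IsManifold (𝓡 4) ∞ X]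
  {V : X → Type*} [TopologicalSpace (TotalSpace R3 V)]
  [∀ x, NormedAddCommGroup (V x)] [∀ x, InnerProductSpace ℝ (V x)]
  [FiberBundle R3 V] [VectorBundle ℝ R3 V]
  [ContMDiffVectorBundle ∞ R3 V (𝓡 4)] [IsContMDiffRiemannianBundle (𝓡 4) ∞ R3 V]
  {p : X} (L : ChartFrame V p)

/-- In the frame `L` the connection `A` is `d + γ ×`, with a smooth 1-form `γ` with values in
`ℝ³ ≅ 𝔰𝔬(3)`. -/
structure ChartFrame.IsConnRep (A : CovariantDerivative (𝓡 4) R3 V)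
    (γ : R4 → R4 →L[ℝ] (Fin 3 → ℝ)) : Prop where
  smooth : ContDiffOn ℝ ∞ γ L.dom
  coord_eq : ∀ y ∈ L.dom, ∀ S : Π x : X, V x,
    DiffSecAt R3 S ((extChartAt (𝓡 4) p).symm y) → ∀ w : R4,
      L.coord _ (A S ((extChartAt (𝓡 4) p).symm y) (coordMap p y w)) =
        fderiv ℝ (L.rep S) y w + γ y w ⨯₃ L.rep S y

/-- A skew 3 × 3 matrix acts as the cross product with a vector. -/
lemma skew_cross {W : Fin 3 → Fin 3 → ℝ} (hW : ∀ j k, W j k + W k j = 0) (f : Fin 3 → ℝ) (j : Fin 3) :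
    -∑ k, f k * W j k = ((fun m ↦ W (m + 1) (m + 2)) ⨯₃ f) j := by
  have h00 := hW 0 0
  have h11 := hW 1 1
  have h22 := hW 2 2
  have h01 := hW 0 1
  have h12 := hW 1 2
  have h20 := hW 2 0
  have e1 : (1 : Fin 3) + 1 = 2 := rfl
  have e2 : (1 : Fin 3) + 2 = 0 := rfl
  have e3 : (2 : Fin 3) + 1 = 0 := rfl
  have e4 : (2 : Fin 3) + 2 = 1 := rfl
  fin_cases j <;>
  simp only [Fin.zero_eta, Fin.mk_one, Fin.reduceFinMk, cross_apply, Fin.sum_univ_three,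
    Matrix.cons_val, zero_add, e1, e2, e3, e4]
  · linear_combination -(f 0 / 2) * h00 - f 2 * h20
  · linear_combination -(f 1 / 2) * h11 - f 0 * h01
  · linear_combination -(f 2 / 2) * h22 - f 1 * h12

lemma fderiv_apply_eq {E ι : Type*} [NormedAddCommGroup E] [NormedSpace ℝ E] [Fintype ι]
    {f : E → ι → ℝ} {y : E} (hf : DifferentiableAt ℝ f y) (w : E) (j : ι) :
    fderiv ℝ f y w j = fderiv ℝ (fun x ↦ f x j) y w := by
  rw [((hasFDerivAt_pi'.mp hf.hasFDerivAt) j).fderiv]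
  rfl

lemma inner_deriv_eq {A : CovariantDerivative (𝓡 4) R3 V} (hA : A.IsMetricCompatible)
    {y : R4} (hy : y ∈ (extChartAt (𝓡 4) p).target) {S T : Π x : X, V x}
    (hS : DiffSecAt R3 S ((extChartAt (𝓡 4) p).symm y))
    (hT : DiffSecAt R3 T ((extChartAt (𝓡 4) p).symm y)) (w : R4) :
    fderiv ℝ (fun y ↦ inner ℝ (S ((extChartAt (𝓡 4) p).symm y))
        (T ((extChartAt (𝓡 4) p).symm y))) y w =
      inner ℝ (A S _ (coordMap p y w)) (T ((extChartAt (𝓡 4) p).symm y)) +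
        inner ℝ (S ((extChartAt (𝓡 4) p).symm y)) (A T _ (coordMap p y w)) := by
  have h := hA.mvfderiv_inner_eq (fun x ↦ coordVec p w x) hS hT
  have h2 := mvfderiv_comp_apply y (MDifferentiableAt.inner_bundle hS hT)
    ((contMDiffAt_extChartAt_symm' hy).mdifferentiableAt (by simp)) w
  simp only [coordVec_symm hy] at h
  refine Eq.trans ?_ (h2.trans h)
  rw [mvfderiv, mfderiv_eq_fderiv]
  rfl

/-- In an orthonormal frame the matrix of a metric connection is skew, i.e. a cross product. -/
lemma ChartFrame.exists_isConnRep [T2Space X] {A : CovariantDerivative (𝓡 4) R3 V}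
    (hA : A.IsMetricCompatible) (hs : A.ContMDiffCovariantDerivative ∞) :
    ∃ γ, L.IsConnRep A γ := by
  refine ⟨L.formRep fun x k ↦ A (L.fr k) x, L.contDiffOn_formRep fun k x hx ↦ ?_,
    fun y hy S hS w ↦ ?_⟩
  -- `A` is known to be smooth on global sections only; being local, it does not distinguish the frame
  -- from an extension of it.
  · obtain ⟨S, hS, hSx⟩ := exists_smooth_extension L.isOpen (L.smooth k) hx
    have h1 := hs.contMDiff.contMDiff (σ := S) (by simpa using hS.contMDiffOn)
    rw [contMDiffOn_univ] at h1
    refine ((h1 x).congr_of_eventuallyEq ?_).contMDiffWithinAt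
    filter_upwards [hSx.eventually_nhds, L.isOpen.mem_nhds hx] with x' hx' hxU
    refine congrArg (TotalSpace.mk' _ x') ?_
    exact A.isCovariantDerivativeOnUniv.congr_of_eventuallyEq
      (((L.smooth k).contMDiffAt (L.isOpen.mem_nhds hxU)).mdifferentiableAt (by simp))
      ((hS x').mdifferentiableAt (by simp)) Filter.univ_mem (hx'.mono fun _ h ↦ h.symm)
  -- Differentiate `⟨eⱼ, S⟩`, with the expansion of `S` in the frame.
  · have hconst : ∀ j k, inner ℝ (A (L.fr j) _ (coordMap p y w))
        (L.fr k ((extChartAt (𝓡 4) p).symm y)) +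
        inner ℝ (L.fr j ((extChartAt (𝓡 4) p).symm y)) (A (L.fr k) _ (coordMap p y w)) = 0 := by
      intro j k
      rw [← inner_deriv_eq hA hy.1 (L.diffAt hy j) (L.diffAt hy k)]
      have : (fun y ↦ inner ℝ (L.fr j ((extChartAt (𝓡 4) p).symm y))
          (L.fr k ((extChartAt (𝓡 4) p).symm y))) =ᶠ[nhds y] fun _ ↦ if j = k then (1 : ℝ) else 0 := by
        filter_upwards [L.isOpen_dom.mem_nhds hy] with z hz
        exact orthonormal_iff_ite.mp (L.orthonormal _ hz.2) j k
      rw [this.fderiv_eq]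
      simp
    have hexp : ∀ j, inner ℝ (A (L.fr j) _ (coordMap p y w)) (S ((extChartAt (𝓡 4) p).symm y)) =
        ∑ k, L.rep S y k * inner ℝ (A (L.fr j) _ (coordMap p y w))
          (L.fr k ((extChartAt (𝓡 4) p).symm y)) := by
      intro j
      conv_lhs => rw [← L.sum_coord_smul hy.2 (S ((extChartAt (𝓡 4) p).symm y))]
      simp only [inner_sum, inner_smul_right]
      rfl
    ext j
    have h1 := inner_deriv_eq hA hy.1 (L.diffAt hy j) hS w
    rw [Pi.add_apply, fderiv_apply_eq (L.differentiableAt_rep hy hS)]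
    have h2 : L.coord _ (A S ((extChartAt (𝓡 4) p).symm y) (coordMap p y w)) j =
        fderiv ℝ (fun x ↦ L.rep S x j) y w -
          inner ℝ (A (L.fr j) _ (coordMap p y w)) (S ((extChartAt (𝓡 4) p).symm y)) :=
      eq_sub_of_add_eq' h1.symm
    rw [h2, hexp, sub_eq_add_neg]
    congr 1
    rw [skew_cross (W := fun j k ↦ inner ℝ (A (L.fr j) _ (coordMap p y w))
      (L.fr k ((extChartAt (𝓡 4) p).symm y)))
      (fun j k ↦ by rw [real_inner_comm (L.fr j _), hconst])]
    have h3 : (fun m ↦ inner ℝ (A (L.fr (m + 1)) _ (coordMap p y w))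
        (L.fr (m + 2) ((extChartAt (𝓡 4) p).symm y))) =
        L.formRep (fun x k ↦ A (L.fr k) x) y w :=
      funext fun m ↦ by rw [L.formRep_apply, real_inner_comm]
    rw [h3]

lemma ChartFrame.eq_sum_rep {x : X} (hx : x ∈ L.U) (T : Π x : X, V x) :
    T x = ∑ k, L.rep T (extChartAt (𝓡 4) p x) k • L.fr k x := by
  have h := (L.exists_dom hx).2
  rw [ChartFrame.rep, h, L.sum_coord_smul hx]

lemma ChartFrame.diffSecAt_of_rep {y : R4} (hy : y ∈ L.dom) {T : Π x : X, V x}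
    (hT : DifferentiableAt ℝ (L.rep T) y) : DiffSecAt R3 T ((extChartAt (𝓡 4) p).symm y) := by
  have hs : (extChartAt (𝓡 4) p).symm y ∈ (chartAt R4 p).source := L.subset hy.2
  have h1 : DiffSecAt R3 (fun x ↦ ∑ k, L.rep T (extChartAt (𝓡 4) p x) k • L.fr k x)
      ((extChartAt (𝓡 4) p).symm y) := by
    refine MDifferentiableAt.sum_section fun k _ ↦ MDifferentiableAt.smul_section ?_ (L.diffAt hy k)
    have h2 : DifferentiableAt ℝ (fun z ↦ L.rep T z k)
        (extChartAt (𝓡 4) p ((extChartAt (𝓡 4) p).symm y)) := by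
      rw [(extChartAt (𝓡 4) p).right_inv hy.1]
      exact differentiableAt_pi.mp hT k
    exact h2.mdifferentiableAt.comp _ (mdifferentiableAt_extChartAt hs)
  refine h1.congr_of_eventuallyEq ?_
  filter_upwards [L.isOpen.mem_nhds hy.2] with x hx
  exact congrArg (TotalSpace.mk' R3 x) (L.eq_sum_rep hx T)

lemma ChartFrame.smoothSecAt_of_rep {y : R4} (hy : y ∈ L.dom) {T : Π x : X, V x}
    (hT : ContDiffAt ℝ ∞ (L.rep T) y) : SmoothSecAt R3 T ((extChartAt (𝓡 4) p).symm y) := by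
  have hs : (extChartAt (𝓡 4) p).symm y ∈ (chartAt R4 p).source := L.subset hy.2
  have h1 : SmoothSecAt R3 (fun x ↦ ∑ k, L.rep T (extChartAt (𝓡 4) p x) k • L.fr k x)
      ((extChartAt (𝓡 4) p).symm y) := by
    refine ContMDiffAt.sum_section fun k _ ↦ ContMDiffAt.smul_section ?_ (L.smoothAt hy k)
    have h2 : ContDiffAt ℝ ∞ (fun z ↦ L.rep T z k)
        (extChartAt (𝓡 4) p ((extChartAt (𝓡 4) p).symm y)) := by
      rw [(extChartAt (𝓡 4) p).right_inv hy.1]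
      exact contDiffAt_pi.mp hT k
    exact h2.contMDiffAt.comp _ (contMDiffAt_extChartAt' hs)
  refine h1.congr_of_eventuallyEq ?_
  filter_upwards [L.isOpen.mem_nhds hy.2] with x hx
  exact congrArg (TotalSpace.mk' R3 x) (L.eq_sum_rep hx T)

/-- The cross product as a continuous bilinear map. -/
noncomputable def crossL : (Fin 3 → ℝ) →L[ℝ] (Fin 3 → ℝ) →L[ℝ] (Fin 3 → ℝ) :=
  LinearMap.toContinuousBilinearMap crossProduct

lemma crossL_apply (a b : Fin 3 → ℝ) : crossL a b = a ⨯₃ b := rfl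

lemma fderiv_connRep {γ : R4 → R4 →L[ℝ] (Fin 3 → ℝ)} {f : R4 → Fin 3 → ℝ} {w : R4 → R4} {y : R4}
    (hγ : ContDiffAt ℝ ∞ γ y) (hf : ContDiffAt ℝ ∞ f y) (hw : DifferentiableAt ℝ w y) :
    DifferentiableAt ℝ (fun z ↦ fderiv ℝ f z (w z) + γ z (w z) ⨯₃ f z) y ∧ ∀ u,
    fderiv ℝ (fun z ↦ fderiv ℝ f z (w z) + γ z (w z) ⨯₃ f z) y u =
      fderiv ℝ (fderiv ℝ f) y u (w y) + fderiv ℝ f y (fderiv ℝ w y u) +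
      ((fderiv ℝ γ y u (w y) + γ y (fderiv ℝ w y u)) ⨯₃ f y + γ y (w y) ⨯₃ fderiv ℝ f y u) := by
  have hγ' := (hγ.differentiableAt (by simp)).hasFDerivAt
  have hf' := (hf.differentiableAt (by simp)).hasFDerivAt
  have hf'' := ((hf.fderiv_right (m := 1) (by norm_cast)).differentiableAt one_ne_zero).hasFDerivAt
  have h1 := hf''.clm_apply hw.hasFDerivAt
  have h2 := crossL.hasFDerivAt_of_bilinear (hγ'.clm_apply hw.hasFDerivAt) hf'
  have h3 := h1.add h2
  refine ⟨h3.differentiableAt, fun u ↦ ?_⟩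
  refine (congrArg (fun l ↦ l u) h3.fderiv).trans ?_
  simp only [add_apply, ContinuousLinearMap.comp_apply,
    ContinuousLinearMap.flip_apply, ContinuousLinearMap.precompR_apply,
    ContinuousLinearMap.precompL_apply, ContinuousLinearMap.compL_apply, crossL_apply]
  abel_nf

lemma eventually_diffSecAt {F : Type*} [NormedAddCommGroup F] [NormedSpace ℝ F]
    {E : X → Type*} [TopologicalSpace (TotalSpace F E)] [∀ x, AddCommGroup (E x)]
    [∀ x, Module ℝ (E x)] [∀ x, TopologicalSpace (E x)] [FiberBundle F E] [VectorBundle ℝ F E]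
    [ContMDiffVectorBundle ∞ F E (𝓡 4)] {x₀ : X} (s : E x₀) :
    ∀ᶠ x in nhds x₀, SmoothSecAt F (extend F s) x := by
  obtain ⟨U, hU, h⟩ := exists_contMDiffOn_extend (I := 𝓡 4) (k := ∞) F s
  obtain ⟨W, hW, hWo, hxW⟩ := mem_nhds_iff.mp hU
  filter_upwards [hWo.mem_nhds hxW] with x hx
  exact h.contMDiffAt (Filter.mem_of_superset (hWo.mem_nhds hx) hW)

/-- The curvature of the connection `d + γ ×`. -/
noncomputable def curvRep (γ : R4 → R4 →L[ℝ] (Fin 3 → ℝ)) (y u v : R4) : Fin 3 → ℝ :=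
  fderiv ℝ γ y u v - fderiv ℝ γ y v u + γ y u ⨯₃ γ y v

/-- The exterior derivative of the 1-form `α` for the connection `d + γ ×`. -/
noncomputable def extRep (γ α : R4 → R4 →L[ℝ] (Fin 3 → ℝ)) (y u v : R4) : Fin 3 → ℝ :=
  fderiv ℝ α y u v - fderiv ℝ α y v u + (γ y u ⨯₃ α y v - γ y v ⨯₃ α y u)

lemma vrep_extend {y : R4} (hy : y ∈ (extChartAt (𝓡 4) p).target) (u : R4) :
    vrep p (extend R4 (coordMap p y u)) y = u := by
  obtain ⟨e, he⟩ := coordMap_isInvertible hy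
  rw [vrep, extend_apply_self, ← he, ContinuousLinearMap.inverse_equiv]
  exact e.symm_apply_apply _

variable {L}

lemma ChartFrame.eventually_symm {y : R4} (hy : y ∈ L.dom) {P : X → Prop}
    (hP : ∀ᶠ x in nhds ((extChartAt (𝓡 4) p).symm y), P x) :
    ∀ᶠ z in nhds y, z ∈ L.dom ∧ P ((extChartAt (𝓡 4) p).symm z) :=
  Filter.Eventually.and (L.isOpen_dom.mem_nhds hy)
    ((contMDiffAt_extChartAt_symm' hy.1).continuousAt.eventually hP)

/-- The curvature of `d + γ ×`, computed from extensions of the vectors to vector fields; the bracket of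
the fields becomes the bracket in the chart, and the derivatives of the extensions cancel. -/
lemma ChartFrame.IsConnRep.curvatureAux_eq {A : CovariantDerivative (𝓡 4) R3 V}
    {γ : R4 → R4 →L[ℝ] (Fin 3 → ℝ)} (h : L.IsConnRep A γ) {y : R4} (hy : y ∈ L.dom) (u v : R4)
    (s : V ((extChartAt (𝓡 4) p).symm y)) :
    L.coord _ (curvatureAux A _ (coordMap p y u) (coordMap p y v) s) =
      curvRep γ y u v ⨯₃ L.coord _ s := by
  have hγ := h.smooth.contDiffAt (L.isOpen_dom.mem_nhds hy)
  have hS := eventually_diffSecAt (F := R3) s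
  have hf := L.contDiffAt_rep hy hS.self_of_nhds
  have key : ∀ (a b : TangentSpace (𝓡 4) ((extChartAt (𝓡 4) p).symm y)) (u v : R4),
      coordMap p y u = a → coordMap p y v = b →
      L.coord _ (A (fun x ↦ A (extend R3 s) x (extend R4 b x)) _ a) =
        fderiv ℝ (fderiv ℝ (L.rep (extend R3 s))) y u v +
        fderiv ℝ (L.rep (extend R3 s)) y (fderiv ℝ (vrep p (extend R4 b)) y u) +
        ((fderiv ℝ γ y u v + γ y (fderiv ℝ (vrep p (extend R4 b)) y u)) ⨯₃
          L.rep (extend R3 s) y + γ y v ⨯₃ fderiv ℝ (L.rep (extend R3 s)) y u) +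
        γ y u ⨯₃ (fderiv ℝ (L.rep (extend R3 s)) y v + γ y v ⨯₃ L.rep (extend R3 s) y) := by
    rintro a b u v rfl hb
    have hw := differentiableAt_vrep hy.1 (mdifferentiableAt_extend (𝓡 4) R4 b)
    have hv : vrep p (extend R4 b) y = v := by rw [← hb, vrep_extend hy.1]
    have hev : L.rep (fun x ↦ A (extend R3 s) x (extend R4 b x)) =ᶠ[nhds y]
        fun z ↦ fderiv ℝ (L.rep (extend R3 s)) z (vrep p (extend R4 b) z) +
          γ z (vrep p (extend R4 b) z) ⨯₃ L.rep (extend R3 s) z := by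
      filter_upwards [L.eventually_symm hy hS] with z hz
      rw [← h.coord_eq z hz.1 _ (hz.2.mdifferentiableAt (by simp)), coordMap_vrep hz.1.1]
      rfl
    obtain ⟨hd, hd'⟩ := fderiv_connRep hγ hf hw
    rw [h.coord_eq y hy _ (L.diffSecAt_of_rep hy (hd.congr_of_eventuallyEq hev)), hev.fderiv_eq,
      hev.self_of_nhds, hd' u, hv]
    beta_reduce
    rw [hv]
  have hbr := vrep_mlieBracket hy.1
    (mdifferentiableAt_extend (𝓡 4) R4 (coordMap p y u))
    (mdifferentiableAt_extend (𝓡 4) R4 (coordMap p y v))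
  rw [vrep_extend hy.1, vrep_extend hy.1] at hbr
  -- The second derivatives of the section cancel by symmetry.
  have hsym := (hf.isSymmSndFDerivAt (by
    rw [minSmoothness_of_isRCLikeNormedField]; norm_cast)) u v
  have hs : L.rep (extend R3 s) y = L.coord _ s := by rw [ChartFrame.rep, extend_apply_self]
  rw [curvatureAux, map_sub, map_sub, key _ _ u v rfl rfl, key _ _ v u rfl rfl,
    ← coordMap_vrep hy.1 (VectorField.mlieBracket _ _ _),
    h.coord_eq y hy _ (hS.self_of_nhds.mdifferentiableAt (by simp)), hbr, hsym, hs, curvRep]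
  simp only [map_add, map_sub, add_apply, sub_apply, LinearMap.add_apply, LinearMap.sub_apply,
    cross_cross]
  abel

end ConnRep

/-! ### Skew endomorphisms and 1-forms in a local frame -/

section FormRep

open scoped Matrix

variable {X : Type*} [TopologicalSpace X] [ChartedSpace R4 X] [IsManifold (𝓡 4) ∞ X]
  {V : X → Type*} [TopologicalSpace (TotalSpace R3 V)]
  [∀ x, NormedAddCommGroup (V x)] [∀ x, InnerProductSpace ℝ (V x)]
  [FiberBundle R3 V] [VectorBundle ℝ R3 V]
  {p : X} (L : ChartFrame V p)

/-- The isomorphism `ℝ³ ≅ 𝔰𝔬(3)` in a fibre: `hat a` is the cross product with `a`. -/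
noncomputable def ChartFrame.hat (x : X) : (Fin 3 → ℝ) →ₗ[ℝ] Module.End ℝ (V x) :=
  ((crossProduct (R := ℝ)).compr₂ (Fintype.linearCombination ℝ fun k ↦ L.fr k x)).compl₂
    (L.coord x).toLinearMap

/-- The inverse `𝔰𝔬(3) → ℝ³` of `hat`, extended to all endomorphisms. -/
noncomputable def ChartFrame.vee (x : X) : Module.End ℝ (V x) →ₗ[ℝ] (Fin 3 → ℝ) :=
  LinearMap.pi fun m ↦ ((innerₛₗ ℝ (L.fr (m + 2) x))).comp (LinearMap.applyₗ (L.fr (m + 1) x))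

lemma ChartFrame.vee_apply (x : X) (ξ : Module.End ℝ (V x)) (m : Fin 3) :
    L.vee x ξ m = inner ℝ (L.fr (m + 2) x) (ξ (L.fr (m + 1) x)) := rfl

lemma ChartFrame.hat_apply (x : X) (a : Fin 3 → ℝ) (s : V x) :
    L.hat x a s = ∑ k, (a ⨯₃ L.coord x s) k • L.fr k x := rfl

lemma ChartFrame.coord_sum {x : X} (hx : x ∈ L.U) (f : Fin 3 → ℝ) :
    L.coord x (∑ k, f k • L.fr k x) = f := by
  simp only [map_sum, map_smul, L.coord_fr hx]
  ext j
  simp [Finset.sum_apply, Pi.single_apply]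

lemma ChartFrame.coord_hat {x : X} (hx : x ∈ L.U) (a : Fin 3 → ℝ) (s : V x) :
    L.coord x (L.hat x a s) = a ⨯₃ L.coord x s := by
  rw [L.hat_apply, L.coord_sum hx]

lemma ChartFrame.vee_of_coord {x : X} (hx : x ∈ L.U) {ξ : Module.End ℝ (V x)} {a : Fin 3 → ℝ}
    (h : ∀ s, L.coord x (ξ s) = a ⨯₃ L.coord x s) : L.vee x ξ = a := by
  ext m
  rw [L.vee_apply, ← L.coord_apply, h, L.coord_fr hx]
  fin_cases m <;> simp [cross_apply]

lemma ChartFrame.eq_hat_of_coord {x : X} (hx : x ∈ L.U) {ξ : Module.End ℝ (V x)} {a : Fin 3 → ℝ}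
    (h : ∀ s, L.coord x (ξ s) = a ⨯₃ L.coord x s) : ξ = L.hat x a :=
  LinearMap.ext fun s ↦ L.coord_injective hx (by rw [h, L.coord_hat hx])

lemma ChartFrame.vee_hat {x : X} (hx : x ∈ L.U) (a : Fin 3 → ℝ) : L.vee x (L.hat x a) = a :=
  L.vee_of_coord hx (L.coord_hat hx a)

lemma ChartFrame.coord_of_skew {x : X} (hx : x ∈ L.U) {ξ : Module.End ℝ (V x)}
    (h : ∀ s t, inner ℝ (ξ s) t = -inner ℝ s (ξ t)) (s : V x) :
    L.coord x (ξ s) = L.vee x ξ ⨯₃ L.coord x s := by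
  ext j
  rw [L.coord_apply, ← neg_inj, ← neg_neg (inner ℝ _ _), ← h]
  have hexp : inner ℝ (ξ (L.fr j x)) s = ∑ k, L.coord x s k * inner ℝ (ξ (L.fr j x)) (L.fr k x) := by
    conv_lhs => rw [← L.sum_coord_smul hx s]
    simp only [inner_sum, inner_smul_right]
  rw [hexp, neg_neg, ← neg_inj, neg_neg,
    skew_cross (W := fun j k ↦ inner ℝ (ξ (L.fr j x)) (L.fr k x))
      (fun j k ↦ by rw [h (L.fr k x), real_inner_comm]; ring)]
  have h3 : (fun m ↦ inner ℝ (ξ (L.fr (m + 1) x)) (L.fr (m + 2) x)) = L.vee x ξ :=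
    funext fun m ↦ by rw [L.vee_apply, real_inner_comm]
  rw [h3]

lemma ChartFrame.hat_vee {x : X} (hx : x ∈ L.U) {ξ : Module.End ℝ (V x)}
    (h : ∀ s t, inner ℝ (ξ s) t = -inner ℝ s (ξ t)) : L.hat x (L.vee x ξ) = ξ :=
  (L.eq_hat_of_coord hx (L.coord_of_skew hx h)).symm

lemma ChartFrame.hat_skew {x : X} (hx : x ∈ L.U) (a : Fin 3 → ℝ) (s t : V x) :
    inner ℝ (L.hat x a s) t = -inner ℝ s (L.hat x a t) := by
  rw [L.inner_eq hx, L.inner_eq hx, L.coord_hat hx, L.coord_hat hx]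
  simp [cross_apply, dotProduct, Fin.sum_univ_three]
  ring

lemma ChartFrame.soInner_eq {x : X} (hx : x ∈ L.U) (c : ℝ) (a : Fin 3 → ℝ) (ξ : Module.End ℝ (V x)) :
    soInner c (L.hat x a) ξ = c * (a ⬝ᵥ (fun m ↦ L.vee x ξ m -
      inner ℝ (L.fr (m + 1) x) (ξ (L.fr (m + 2) x)))) := by
  have : FiniteDimensional ℝ (V x) := Module.finite_of_finrank_eq_succ (finrank_fibre V x)
  rw [soInner, LinearMap.trace_eq_sum_inner _ (L.onb hx)]
  simp only [L.onb_apply, Module.End.mul_apply, L.vee_apply, ← L.coord_apply, L.coord_hat hx]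
  have e1 : (1 : Fin 3) + 1 = 2 := rfl
  have e2 : (1 : Fin 3) + 2 = 0 := rfl
  have e3 : (2 : Fin 3) + 1 = 0 := rfl
  have e4 : (2 : Fin 3) + 2 = 1 := rfl
  simp only [Fin.sum_univ_three, cross_apply, dotProduct, Matrix.cons_val, zero_add, e1, e2, e3, e4]
  ring

lemma ChartFrame.soInner_hat {x : X} (hx : x ∈ L.U) (c : ℝ) (a b : Fin 3 → ℝ) :
    soInner c (L.hat x a) (L.hat x b) = 2 * c * (a ⬝ᵥ b) := by
  rw [L.soInner_eq hx, L.vee_hat hx]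
  have h : ∀ m, inner ℝ (L.fr (m + 1) x) (L.hat x b (L.fr (m + 2) x)) = -b m := by
    intro m
    rw [← neg_neg (inner ℝ _ _), ← L.hat_skew hx, real_inner_comm, ← L.vee_apply, L.vee_hat hx]
  simp only [h, dotProduct, Fin.sum_univ_three]
  ring

lemma fibre_linear_ext {x : X} {W : Type*} [AddCommGroup W] [Module ℝ W] {f g : V x →ₗ[ℝ] W}
    (h : ∀ i, f (fibreBasis x i) = g (fibreBasis x i)) : f = g :=
  (fibreBasis x).ext h

variable [ContMDiffVectorBundle ∞ R3 V (𝓡 4)] [IsContMDiffRiemannianBundle (𝓡 4) ∞ R3 V]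

variable {L} in
lemma ChartFrame.IsConnRep.curvature_eq {A : CovariantDerivative (𝓡 4) R3 V}
    {γ : R4 → R4 →L[ℝ] (Fin 3 → ℝ)} (h : L.IsConnRep A γ) {y : R4} (hy : y ∈ L.dom) (u v : R4) :
    curvature A _ (coordMap p y u) (coordMap p y v) = L.hat _ (curvRep γ y u v) := by
  refine fibre_linear_ext fun i ↦ ?_
  rw [curvature, Module.Basis.constr_basis]
  exact L.coord_injective hy.2 (by rw [h.curvatureAux_eq hy, L.coord_hat hy.2])

/-- The coordinates of a 1-form with values in the skew endomorphisms. -/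
noncomputable def ChartFrame.oneRep (a : OneForm V) : R4 → R4 →L[ℝ] (Fin 3 → ℝ) :=
  L.formRep fun x k ↦ a.toFun x (L.fr k x)

lemma ChartFrame.contDiffOn_oneRep (a : OneForm V) : ContDiffOn ℝ ∞ (L.oneRep a) L.dom :=
  L.contDiffOn_formRep fun k ↦ (a.smooth.contMDiffOn (s := L.U)).clm_bundle_apply (L.smooth k)

lemma ChartFrame.endo_eq (a : OneForm V) {y : R4} (hy : y ∈ L.dom) (w : R4) :
    a.endo _ (coordMap p y w) = L.hat _ (L.oneRep a y w) :=
  (L.hat_vee hy.2 (a.skew _ _)).symm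

lemma ChartFrame.coord_oneForm (a : OneForm V) {y : R4} (hy : y ∈ L.dom) (w : R4)
    (s : V ((extChartAt (𝓡 4) p).symm y)) :
    L.coord _ (a.toFun _ s (coordMap p y w)) = L.oneRep a y w ⨯₃ L.coord _ s := by
  rw [← L.coord_hat hy.2, ← L.endo_eq a hy]
  rfl

variable {L}

lemma ChartFrame.IsConnRep.addForm {A : CovariantDerivative (𝓡 4) R3 V}
    {γ : R4 → R4 →L[ℝ] (Fin 3 → ℝ)} (h : L.IsConnRep A γ) (t : ℝ) (a : OneForm V) :
    L.IsConnRep (addForm A t a) (γ + t • L.oneRep a) where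
  smooth := h.smooth.add ((L.contDiffOn_oneRep a).const_smul t)
  coord_eq y hy S hS w := by
    have : DefiniteConnection.addForm A t a S ((extChartAt (𝓡 4) p).symm y) (coordMap p y w) =
      A S _ (coordMap p y w) + t • a.toFun _ (S ((extChartAt (𝓡 4) p).symm y)) (coordMap p y w) := rfl
    rw [this, map_add, map_smul, h.coord_eq y hy S hS, L.coord_oneForm a hy]
    simp only [Pi.add_apply, Pi.smul_apply, add_apply, smul_apply, map_add, map_smul,
      LinearMap.add_apply, LinearMap.smul_apply, ChartFrame.rep]
    abel

lemma ChartFrame.IsConnRep.covExtDerivAux_eq {A : CovariantDerivative (𝓡 4) R3 V}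
    {γ : R4 → R4 →L[ℝ] (Fin 3 → ℝ)} (h : L.IsConnRep A γ) (a : OneForm V) {y : R4} (hy : y ∈ L.dom)
    (u v : R4) (s : V ((extChartAt (𝓡 4) p).symm y)) :
    L.coord _ (covExtDerivAux A a _ (coordMap p y u) (coordMap p y v) s) =
      extRep γ (L.oneRep a) y u v ⨯₃ L.coord _ s := by
  have hα := (L.contDiffOn_oneRep a).contDiffAt (L.isOpen_dom.mem_nhds hy)
  have hS := eventually_diffSecAt (F := R3) s
  have hf := L.contDiffAt_rep hy hS.self_of_nhds
  have hs : L.rep (extend R3 s) y = L.coord _ s := by rw [ChartFrame.rep, extend_apply_self]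
  have hS' := hS.self_of_nhds.mdifferentiableAt (by simp)
  have key : ∀ (b : TangentSpace (𝓡 4) ((extChartAt (𝓡 4) p).symm y)) (u v : R4),
      coordMap p y v = b →
      L.coord _ (A (fun x ↦ a.toFun x (extend R3 s x) (extend R4 b x)) _ (coordMap p y u)) =
        ((fderiv ℝ (L.oneRep a) y u v + L.oneRep a y (fderiv ℝ (vrep p (extend R4 b)) y u)) ⨯₃
          L.rep (extend R3 s) y + L.oneRep a y v ⨯₃ fderiv ℝ (L.rep (extend R3 s)) y u) +
        γ y u ⨯₃ (L.oneRep a y v ⨯₃ L.rep (extend R3 s) y) := by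
    rintro b u v hb
    have hw := differentiableAt_vrep hy.1 (mdifferentiableAt_extend (𝓡 4) R4 b)
    have hv : vrep p (extend R4 b) y = v := by rw [← hb, vrep_extend hy.1]
    have hev : L.rep (fun x ↦ a.toFun x (extend R3 s x) (extend R4 b x)) =ᶠ[nhds y]
        fun z ↦ L.oneRep a z (vrep p (extend R4 b) z) ⨯₃ L.rep (extend R3 s) z := by
      filter_upwards [L.isOpen_dom.mem_nhds hy] with z hz
      rw [ChartFrame.rep, ChartFrame.rep, ← L.coord_oneForm a hz, coordMap_vrep hz.1]
    have h2 := crossL.hasFDerivAt_of_bilinear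
      ((hα.differentiableAt (by simp)).hasFDerivAt.clm_apply hw.hasFDerivAt)
      (hf.differentiableAt (by simp)).hasFDerivAt
    rw [h.coord_eq y hy _ (L.diffSecAt_of_rep hy (h2.differentiableAt.congr_of_eventuallyEq hev)),
      hev.fderiv_eq, hev.self_of_nhds]
    beta_reduce
    rw [hv]
    congr 1
    refine (congrArg (fun l ↦ l u) h2.fderiv).trans ?_
    simp only [add_apply, ContinuousLinearMap.comp_apply,
      ContinuousLinearMap.flip_apply, ContinuousLinearMap.precompR_apply,
      ContinuousLinearMap.precompL_apply, ContinuousLinearMap.compL_apply, crossL_apply, hv]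
    abel_nf
  have hbr := vrep_mlieBracket hy.1
    (mdifferentiableAt_extend (𝓡 4) R4 (coordMap p y u))
    (mdifferentiableAt_extend (𝓡 4) R4 (coordMap p y v))
  rw [vrep_extend hy.1, vrep_extend hy.1] at hbr
  rw [covExtDerivAux, map_sub, map_sub, map_sub, map_sub, key _ u v rfl, key _ v u rfl,
    ← coordMap_vrep hy.1 (VectorField.mlieBracket _ _ _), L.coord_oneForm a hy,
    L.coord_oneForm a hy, L.coord_oneForm a hy, h.coord_eq y hy _ hS', h.coord_eq y hy _ hS',
    hbr, hs, extRep]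
  simp only [map_add, map_sub, add_apply, sub_apply, LinearMap.add_apply, LinearMap.sub_apply,
    cross_cross]
  abel

/-- The coordinate expression of `d_A a`. -/
lemma ChartFrame.IsConnRep.covExtDeriv_eq {A : CovariantDerivative (𝓡 4) R3 V}
    {γ : R4 → R4 →L[ℝ] (Fin 3 → ℝ)} (h : L.IsConnRep A γ) (a : OneForm V) {y : R4} (hy : y ∈ L.dom)
    (u v : R4) : covExtDeriv A a _ (coordMap p y u) (coordMap p y v) =
      L.hat _ (extRep γ (L.oneRep a) y u v) := by
  refine fibre_linear_ext fun i ↦ ?_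
  rw [covExtDeriv, Module.Basis.constr_basis]
  exact L.coord_injective hy.2 (by rw [h.covExtDerivAux_eq a hy, L.coord_hat hy.2])

/-- The curvature of `A + ta` is `F + t d_A a + t² a ∧ a`. -/
lemma curvRep_add {γ α : R4 → R4 →L[ℝ] (Fin 3 → ℝ)} {y : R4} (hγ : DifferentiableAt ℝ γ y)
    (hα : DifferentiableAt ℝ α y) (t : ℝ) (u v : R4) :
    curvRep (γ + t • α) y u v =
      curvRep γ y u v + t • extRep γ α y u v + t ^ 2 • (α y u ⨯₃ α y v) := by
  rw [curvRep, fderiv_add hγ (hα.const_smul t), fderiv_const_smul hα, curvRep, extRep]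
  simp only [Pi.add_apply, Pi.smul_apply, add_apply, smul_apply, map_add, map_smul,
    LinearMap.add_apply, LinearMap.smul_apply]
  rw [← cross_anticomm (α y u) (γ y v)]
  module

end FormRep

/-! ### The energy density and the metric in a local frame -/

section Pointwise

open scoped Matrix

variable {X : Type*} [TopologicalSpace X] [ChartedSpace R4 X] [IsManifold (𝓡 4) ∞ X]
  {V : X → Type*} [TopologicalSpace (TotalSpace R3 V)]
  [∀ x, NormedAddCommGroup (V x)] [∀ x, InnerProductSpace ℝ (V x)]
  [FiberBundle R3 V] [VectorBundle ℝ R3 V]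
  {p : X} (L : ChartFrame V p)

/-- The matrix of `Q(A)`, in terms of the matrix of the 4-forms `Fᵢ ∧ Fⱼ`. -/
noncomputable def qMat (M : Matrix (Fin 3) (Fin 3) ℝ) : Matrix (Fin 3) (Fin 3) ℝ := (3 / M.trace) • M

/-- The matrix of `B_A`, in terms of the matrix of the 4-forms `Fᵢ ∧ Fⱼ`. -/
noncomputable def bMat (M : Matrix (Fin 3) (Fin 3) ℝ) : Matrix (Fin 3) (Fin 3) ℝ :=
  (4 : ℝ) • qMat M - (2 / 3 * (qMat M * qMat M).trace) • 1

lemma qMat_smul {d : ℝ} (hd : d ≠ 0) (M : Matrix (Fin 3) (Fin 3) ℝ) : qMat (d • M) = qMat M := by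
  rw [qMat, qMat, Matrix.trace_smul, smul_smul]
  congr 1
  by_cases h : M.trace = 0
  · simp [h]
  · simp only [smul_eq_mul]
    field_simp

lemma bMat_smul {d : ℝ} (hd : d ≠ 0) (M : Matrix (Fin 3) (Fin 3) ℝ) : bMat (d • M) = bMat M := by
  rw [bMat, bMat, qMat_smul hd]

/-- The skew part of an endomorphism, as a vector in `ℝ³`. -/
noncomputable def ChartFrame.skewPart (x : X) : Module.End ℝ (V x) →ₗ[ℝ] (Fin 3 → ℝ) :=
  (2⁻¹ : ℝ) • (L.vee x - LinearMap.pi fun m ↦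
    ((innerₛₗ ℝ (L.fr (m + 1) x))).comp (LinearMap.applyₗ (L.fr (m + 2) x)))

lemma ChartFrame.skewPart_apply (x : X) (ξ : Module.End ℝ (V x)) (m : Fin 3) :
    L.skewPart x ξ m = 2⁻¹ * (L.vee x ξ m - inner ℝ (L.fr (m + 1) x) (ξ (L.fr (m + 2) x))) := rfl

variable {x : X} (hx : x ∈ L.U)
include hx

lemma ChartFrame.hat_injective : Function.Injective (L.hat x) :=
  Function.LeftInverse.injective (L.vee_hat hx)

lemma ChartFrame.skewPart_hat (a : Fin 3 → ℝ) : L.skewPart x (L.hat x a) = a := by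
  ext m
  have h : inner ℝ (L.fr (m + 1) x) (L.hat x a (L.fr (m + 2) x)) = -a m := by
    rw [← neg_neg (inner ℝ _ _), ← L.hat_skew hx, real_inner_comm, ← L.vee_apply, L.vee_hat hx]
  rw [L.skewPart_apply, L.vee_hat hx, h]
  ring

lemma ChartFrame.soInner_hat_left (c : ℝ) (a : Fin 3 → ℝ) (ξ : Module.End ℝ (V x)) :
    soInner c (L.hat x a) ξ = 2 * c * (a ⬝ᵥ L.skewPart x ξ) := by
  rw [L.soInner_eq hx]
  simp only [dotProduct, Fin.sum_univ_three, L.skewPart_apply]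
  ring

variable {A : CovariantDerivative (𝓡 4) R3 V} {F : TangentSpace (𝓡 4) x →ₗ[ℝ]
  TangentSpace (𝓡 4) x →ₗ[ℝ] (Fin 3 → ℝ)} (hF : ∀ u v, curvature A x u v = L.hat x (F u v))
include hF

lemma ChartFrame.volForm_eq (c : ℝ) (v : Fin 4 → TangentSpace (𝓡 4) x) :
    volForm c A x v = 2 * c / 3 * (wedgeMatrix (fun a b ↦ F a b) v).trace := by
  rw [trace_wedgeMatrix, volForm]
  simp only [wedge, hF, L.soInner_hat hx]
  ring

lemma ChartFrame.isMetricOf_iff (c : ℝ) (g : LinearMap.BilinForm ℝ (TangentSpace (𝓡 4) x)) :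
    IsMetricOf c A x g ↔ IsTripleMetric (2 * c) F g := by
  simp only [IsMetricOf, IsTripleMetric, L.volForm_eq hx hF, hF, (L.hat_injective hx).eq_iff]

/-- `Q(A)` is `3 (Fᵢ ∧ Fⱼ) / ∑ Fₖ ∧ Fₖ` on the skew endomorphisms and vanishes on the symmetric ones.
The constant `c` of the inner product on `𝔰𝔬(E)` cancels. -/
lemma ChartFrame.Q_eq {c : ℝ} (hc : c ≠ 0) :
    Q c A x = (L.hat x).comp (((qMat (wedgeMatrix (fun a b ↦ F a b) (stdVec x))).mulVecLin).comp
      (L.skewPart x)) := by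
  ext1 ξ
  have h1 : wedge (fun (r : ℝ) (η : Module.End ℝ (V x)) ↦ r • η)
      (fun u v ↦ soInner c (curvature A x u v) ξ) (curvature A x) (stdVec x) =
      L.hat x ((2 * c) • (wedgeMatrix (fun a b ↦ F a b) (stdVec x) *ᵥ L.skewPart x ξ)) := by
    simp only [wedge, hF, L.soInner_hat_left hx, ← map_smul (L.hat x), ← map_sub (L.hat x),
      ← map_add (L.hat x)]
    congr 1
    ext i
    simp only [Pi.add_apply, Pi.sub_apply, Pi.smul_apply, smul_eq_mul, dotProduct, Matrix.mulVec,
      Fin.sum_univ_three, wedgeMatrix, Matrix.of_apply, wedge]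
    ring
  change (volForm c A x (stdVec x))⁻¹ • wedge (fun (r : ℝ) (η : Module.End ℝ (V x)) ↦ r • η)
      (fun u v ↦ soInner c (curvature A x u v) ξ) (curvature A x) (stdVec x) = _
  rw [h1, ← map_smul, L.volForm_eq hx hF, smul_smul]
  simp only [LinearMap.comp_apply, Matrix.mulVecLin_apply, qMat, Matrix.smul_mulVec]
  congr 2
  by_cases ht : (wedgeMatrix (fun a b ↦ F a b) (stdVec x)).trace = 0
  · simp [ht]
  · field_simp

lemma ChartFrame.normSqQ_eq {c : ℝ} (hc : c ≠ 0) :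
    normSqQ c A x = (qMat (wedgeMatrix (fun a b ↦ F a b) (stdVec x)) *
      qMat (wedgeMatrix (fun a b ↦ F a b) (stdVec x))).trace := by
  have : FiniteDimensional ℝ (V x) := Module.finite_of_finrank_eq_succ (finrank_fibre V x)
  set N := qMat (wedgeMatrix (fun a b ↦ F a b) (stdVec x)) with hN
  have h1 : Q c A x ∘ₗ Q c A x = (L.hat x) ∘ₗ ((N * N).mulVecLin ∘ₗ L.skewPart x) := by
    rw [L.Q_eq hx hF hc, ← hN]
    ext1 ξ
    simp only [LinearMap.comp_apply, Matrix.mulVecLin_apply, L.skewPart_hat hx,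
      Matrix.mulVec_mulVec]
  have h2 : ((N * N).mulVecLin ∘ₗ L.skewPart x) ∘ₗ L.hat x = Matrix.toLin' (N * N) := by
    refine LinearMap.ext fun ξ ↦ ?_
    simp only [LinearMap.comp_apply, L.skewPart_hat hx, Matrix.toLin'_apply, Matrix.mulVecLin_apply]
  rw [normSqQ, h1, LinearMap.trace_comp_comm', h2, Matrix.trace_toLin'_eq]

lemma ChartFrame.twistedCurvature_eq {c : ℝ} (hc : c ≠ 0) (u v : TangentSpace (𝓡 4) x) :
    twistedCurvature c A x u v =
      L.hat x (bMat (wedgeMatrix (fun a b ↦ F a b) (stdVec x)) *ᵥ F u v) := by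
  rw [twistedCurvature, B, L.normSqQ_eq hx hF hc, hF, L.Q_eq hx hF hc, bMat, Matrix.sub_mulVec,
    Matrix.smul_mulVec, Matrix.smul_mulVec, Matrix.one_mulVec]
  simp only [LinearMap.sub_apply, LinearMap.smul_apply, LinearMap.comp_apply, LinearMap.id_apply,
    Matrix.mulVecLin_apply, L.skewPart_hat hx, map_sub, map_smul]

end Pointwise

section Local

open scoped Matrix

variable {X : Type*} [TopologicalSpace X] [ChartedSpace R4 X] [IsManifold (𝓡 4) ∞ X]
  {V : X → Type*} [TopologicalSpace (TotalSpace R3 V)]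
  [∀ x, NormedAddCommGroup (V x)] [∀ x, InnerProductSpace ℝ (V x)]
  [FiberBundle R3 V] [VectorBundle ℝ R3 V]
  {p : X} {L : ChartFrame V p}

/-- The standard basis of `ℝ⁴`. -/
noncomputable abbrev stdR4 (i : Fin 4) : R4 := EuclideanSpace.single i 1

/-- The matrix of the 4-forms `Fᵢ ∧ Fⱼ` in a chart. -/
noncomputable def curvMat (γ : R4 → R4 →L[ℝ] (Fin 3 → ℝ)) (y : R4) : Matrix (Fin 3) (Fin 3) ℝ :=
  wedgeMatrix (curvRep γ y) stdR4

/-- The matrix of the metric `g_A` in a chart. -/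
noncomputable def metricMat (c : ℝ) (γ : R4 → R4 →L[ℝ] (Fin 3 → ℝ)) (y : R4) :
    Matrix (Fin 4) (Fin 4) ℝ :=
  metricScale (2 * c) (curvRep γ y) stdR4 •
    Matrix.of fun i j ↦ urbantke (curvRep γ y) stdR4 (stdR4 i) (stdR4 j)

/-- The linear isomorphism `coordMap`. -/
noncomputable def coordEquiv {y : R4} (hy : y ∈ (extChartAt (𝓡 4) p).target) :
    R4 ≃ₗ[ℝ] TangentSpace (𝓡 4) ((extChartAt (𝓡 4) p).symm y) :=
  (Classical.choose (coordMap_isInvertible hy)).toLinearEquiv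

lemma coordEquiv_apply {y : R4} (hy : y ∈ (extChartAt (𝓡 4) p).target) (u : R4) :
    coordEquiv hy u = coordMap p y u :=
  congrArg (fun l ↦ l u) (Classical.choose_spec (coordMap_isInvertible hy))

/-- The basis of the tangent space consisting of the coordinate vectors of the chart at `p`. -/
noncomputable def coordBasis {y : R4} (hy : y ∈ (extChartAt (𝓡 4) p).target) :
    Module.Basis (Fin 4) ℝ (TangentSpace (𝓡 4) ((extChartAt (𝓡 4) p).symm y)) :=
  ((EuclideanSpace.basisFun (Fin 4) ℝ).toBasis).map (coordEquiv hy)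

lemma coe_coordBasis {y : R4} (hy : y ∈ (extChartAt (𝓡 4) p).target) :
    ⇑(coordBasis hy) = coordField p y := by
  ext1 i
  rw [coordBasis, Module.Basis.map_apply, coordEquiv_apply, OrthonormalBasis.coe_toBasis,
    EuclideanSpace.basisFun_apply, coordMap_single]

/-- The standard basis of a tangent space. -/
noncomputable def stdBasis (x : X) : Module.Basis (Fin 4) ℝ (TangentSpace (𝓡 4) x) :=
  show Module.Basis (Fin 4) ℝ R4 from (EuclideanSpace.basisFun (Fin 4) ℝ).toBasis

lemma coe_stdBasis (x : X) : ⇑(stdBasis x) = stdVec x := by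
  ext1 i
  exact (congrFun (OrthonormalBasis.coe_toBasis (EuclideanSpace.basisFun (Fin 4) ℝ)) i).trans
    (EuclideanSpace.basisFun_apply _ _ i)

/-- A bilinear form on `ℝ⁴` transported to a tangent space. -/
noncomputable def pushForm {W : Type*} [AddCommGroup W] [Module ℝ W] {y : R4}
    (hy : y ∈ (extChartAt (𝓡 4) p).target) (S : R4 →ₗ[ℝ] R4 →ₗ[ℝ] W) :
    TangentSpace (𝓡 4) ((extChartAt (𝓡 4) p).symm y) →ₗ[ℝ]
      TangentSpace (𝓡 4) ((extChartAt (𝓡 4) p).symm y) →ₗ[ℝ] W :=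
  S.compl₁₂ (coordEquiv hy).symm.toLinearMap (coordEquiv hy).symm.toLinearMap

lemma pushForm_apply {W : Type*} [AddCommGroup W] [Module ℝ W] {y : R4}
    (hy : y ∈ (extChartAt (𝓡 4) p).target) (S : R4 →ₗ[ℝ] R4 →ₗ[ℝ] W) (u v : R4) :
    pushForm hy S (coordMap p y u) (coordMap p y v) = S u v := by
  rw [pushForm, ← coordEquiv_apply hy, ← coordEquiv_apply hy, LinearMap.compl₁₂_apply]
  simp only [LinearEquiv.coe_coe, LinearEquiv.symm_apply_apply]

lemma exists_coordMap {y : R4} (hy : y ∈ (extChartAt (𝓡 4) p).target)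
    (u : TangentSpace (𝓡 4) ((extChartAt (𝓡 4) p).symm y)) : ∃ w, coordMap p y w = u :=
  ⟨(coordEquiv hy).symm u, by rw [← coordEquiv_apply hy, LinearEquiv.apply_symm_apply]⟩

/-- The curvature in a chart as a bilinear map. -/
noncomputable def curvRepₗ (γ : R4 → R4 →L[ℝ] (Fin 3 → ℝ)) (y : R4) :
    R4 →ₗ[ℝ] R4 →ₗ[ℝ] (Fin 3 → ℝ) :=
  LinearMap.mk₂ ℝ (curvRep γ y)
    (fun _ _ _ ↦ by simp only [curvRep, map_add, add_apply, LinearMap.add_apply]; abel)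
    (fun _ _ _ ↦ by simp only [curvRep, map_smul, smul_apply, LinearMap.smul_apply]; module)
    (fun _ _ _ ↦ by simp only [curvRep, map_add, add_apply, LinearMap.add_apply]; abel)
    (fun _ _ _ ↦ by simp only [curvRep, map_smul, smul_apply, LinearMap.smul_apply]; module)

lemma curvRep_neg (γ : R4 → R4 →L[ℝ] (Fin 3 → ℝ)) (y u v : R4) :
    curvRep γ y u v = -curvRep γ y v u := by
  rw [curvRep, curvRep, ← cross_anticomm (γ y v) (γ y u)]
  abel

/-- The covariant exterior derivative in a chart as a bilinear map. -/
noncomputable def extRepₗ (γ α : R4 → R4 →L[ℝ] (Fin 3 → ℝ)) (y : R4) :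
    R4 →ₗ[ℝ] R4 →ₗ[ℝ] (Fin 3 → ℝ) :=
  LinearMap.mk₂ ℝ (extRep γ α y)
    (fun _ _ _ ↦ by simp only [extRep, map_add, add_apply, LinearMap.add_apply]; abel)
    (fun _ _ _ ↦ by simp only [extRep, map_smul, smul_apply, LinearMap.smul_apply]; module)
    (fun _ _ _ ↦ by simp only [extRep, map_add, add_apply, LinearMap.add_apply]; abel)
    (fun _ _ _ ↦ by simp only [extRep, map_smul, smul_apply, LinearMap.smul_apply]; module)

lemma extRep_neg (γ α : R4 → R4 →L[ℝ] (Fin 3 → ℝ)) (y u v : R4) :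
    extRep γ α y u v = -extRep γ α y v u := by
  rw [extRep, extRep]
  abel

variable [ContMDiffVectorBundle ∞ R3 V (𝓡 4)] [IsContMDiffRiemannianBundle (𝓡 4) ∞ R3 V]
  {A : CovariantDerivative (𝓡 4) R3 V} {γ : R4 → R4 →L[ℝ] (Fin 3 → ℝ)} (h : L.IsConnRep A γ)
  {y : R4} (hy : y ∈ L.dom)
include h hy

lemma ChartFrame.IsConnRep.curvature_eq_pushForm
    (u v : TangentSpace (𝓡 4) ((extChartAt (𝓡 4) p).symm y)) :
    curvature A _ u v = L.hat _ (pushForm hy.1 (curvRepₗ γ y) u v) := by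
  obtain ⟨u, rfl⟩ := exists_coordMap hy.1 u
  obtain ⟨v, rfl⟩ := exists_coordMap hy.1 v
  rw [h.curvature_eq hy, pushForm_apply]
  rfl

omit h [ContMDiffVectorBundle ∞ R3 V (𝓡 4)] [IsContMDiffRiemannianBundle (𝓡 4) ∞ R3 V] in
lemma wedgeMatrix_pushForm : wedgeMatrix (fun a b ↦ pushForm hy.1 (curvRepₗ γ y) a b)
    (coordField p y) = curvMat γ y := by
  ext i j
  simp only [wedgeMatrix, Matrix.of_apply, wedge, curvMat, ← coordMap_single, pushForm_apply]
  rfl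

omit h [ContMDiffVectorBundle ∞ R3 V (𝓡 4)] [IsContMDiffRiemannianBundle (𝓡 4) ∞ R3 V] in
lemma pushForm_neg (u v : TangentSpace (𝓡 4) ((extChartAt (𝓡 4) p).symm y)) :
    pushForm hy.1 (curvRepₗ γ y) u v = -pushForm hy.1 (curvRepₗ γ y) v u :=
  curvRep_neg γ y _ _

omit h [ContMDiffVectorBundle ∞ R3 V (𝓡 4)] [IsContMDiffRiemannianBundle (𝓡 4) ∞ R3 V] in
/-- The standard basis of the tangent space and the coordinate vectors of the chart give proportional
matrices; `qMat` and `bMat` do not see the factor. -/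
lemma exists_wedgeMatrix_stdVec : ∃ d : ℝ, d ≠ 0 ∧
    wedgeMatrix (fun a b ↦ pushForm hy.1 (curvRepₗ γ y) a b) (stdVec _) = d • curvMat γ y := by
  refine ⟨(coordBasis hy.1).det (stdBasis _), ?_, ?_⟩
  · exact ((coordBasis hy.1).isUnit_det (stdBasis _)).ne_zero
  · rw [← wedgeMatrix_pushForm hy, ← coe_coordBasis hy.1, ← coe_stdBasis]
    exact wedgeMatrix_eq_det_smul (pushForm_neg hy) _ _

lemma ChartFrame.IsConnRep.volForm_eq (c : ℝ) :
    volForm c A _ (coordField p y) = 2 * c / 3 * (curvMat γ y).trace := by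
  rw [L.volForm_eq hy.2 (h.curvature_eq_pushForm hy), wedgeMatrix_pushForm hy]

lemma ChartFrame.IsConnRep.normSqQ_eq {c : ℝ} (hc : c ≠ 0) :
    normSqQ c A ((extChartAt (𝓡 4) p).symm y) = (qMat (curvMat γ y) * qMat (curvMat γ y)).trace := by
  obtain ⟨d, hd, he⟩ := exists_wedgeMatrix_stdVec (γ := γ) hy
  rw [L.normSqQ_eq hy.2 (h.curvature_eq_pushForm hy) hc, he, qMat_smul hd]

lemma ChartFrame.IsConnRep.twistedCurvature_eq {c : ℝ} (hc : c ≠ 0) (u v : R4) :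
    twistedCurvature c A _ (coordMap p y u) (coordMap p y v) =
      L.hat _ (bMat (curvMat γ y) *ᵥ curvRep γ y u v) := by
  obtain ⟨d, hd, he⟩ := exists_wedgeMatrix_stdVec (γ := γ) hy
  rw [L.twistedCurvature_eq hy.2 (h.curvature_eq_pushForm hy) hc, he, bMat_smul hd, pushForm_apply]
  rfl

variable (hA : IsDefinite A)
include hA

lemma ChartFrame.IsConnRep.definite (u v : TangentSpace (𝓡 4) ((extChartAt (𝓡 4) p).symm y))
    (huv : LinearIndependent ℝ ![u, v]) : pushForm hy.1 (curvRepₗ γ y) u v ≠ 0 := by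
  intro h0
  apply hA.definite _ u v huv
  rw [h.curvature_eq_pushForm hy, h0, map_zero]

lemma ChartFrame.IsConnRep.trace_ne_zero :
    (curvMat γ y).trace ≠ 0 ∧ 0 < (curvMat γ y).trace / (curvMat γ y).det := by
  have h1 := trace_div_det_pos (pushForm_neg hy) (h.definite hy hA) (coordBasis hy.1)
  rw [coe_coordBasis, wedgeMatrix_pushForm hy] at h1
  refine ⟨fun h0 ↦ ?_, h1⟩
  rw [h0, zero_div] at h1
  exact h1.false

lemma ChartFrame.IsConnRep.existsUnique_metric {c : ℝ} (hc : 0 < c) :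
    ∃! g, IsMetricOf c A ((extChartAt (𝓡 4) p).symm y) g := by
  simp only [L.isMetricOf_iff hy.2 (h.curvature_eq_pushForm hy)]
  exact ⟨_, isTripleMetric_urbantke (pushForm_neg hy) (h.definite hy hA) (coordBasis hy.1)
    (by positivity), fun g hg ↦ hg.eq_urbantke (pushForm_neg hy) (h.definite hy hA) _⟩

lemma ChartFrame.IsConnRep.isTripleMetric_gA {c : ℝ} (hc : 0 < c) :
    IsTripleMetric (2 * c) (pushForm hy.1 (curvRepₗ γ y)) (gA c A _) := by
  rw [← L.isMetricOf_iff hy.2 (h.curvature_eq_pushForm hy)]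
  exact Classical.epsilon_spec (h.existsUnique_metric hy hA hc).exists

lemma ChartFrame.IsConnRep.gram_gA {c : ℝ} (hc : 0 < c) :
    gram (gA c A _) (coordField p y) = metricMat c γ y := by
  rw [(h.isTripleMetric_gA hy hA hc).eq_urbantke (pushForm_neg hy) (h.definite hy hA)
    (coordBasis hy.1)]
  ext i j
  simp only [gram, Matrix.of_apply, LinearMap.smul_apply, urbantkeForm_apply, metricMat,
    Matrix.smul_apply, metricScale, coe_coordBasis, wedgeMatrix_pushForm hy, urbantke, wedge,
    ← coordMap_single, pushForm_apply]
  rfl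

lemma ChartFrame.IsConnRep.isUnit_metricMat {c : ℝ} (hc : 0 < c) : IsUnit (metricMat c γ y).det := by
  obtain ⟨e, he, -⟩ := (h.isTripleMetric_gA hy hA hc).exists_oriented_basis (coordBasis hy.1)
  rw [← h.gram_gA hy hA hc, ← coe_coordBasis hy.1]
  exact isUnit_det_gram he _

lemma ChartFrame.IsConnRep.inner₁_eq {c : ℝ} (hc : 0 < c) (a b : OneForm V) :
    inner₁ c A a b ((extChartAt (𝓡 4) p).symm y) = ∑ i, ∑ j, (metricMat c γ y)⁻¹ i j *
      (2 * c * (L.oneRep a y (stdR4 i) ⬝ᵥ L.oneRep b y (stdR4 j))) := by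
  obtain ⟨e, he, -⟩ := (h.isTripleMetric_gA hy hA hc).exists_oriented_basis (coordBasis hy.1)
  let B : R4 →ₗ[ℝ] R4 →ₗ[ℝ] ℝ := (2 * c) • dotₗ.compl₁₂ (L.oneRep a y).toLinearMap
    (L.oneRep b y).toLinearMap
  have hB : ∀ u v, B u v = 2 * c * (L.oneRep a y u ⬝ᵥ L.oneRep b y v) := fun u v ↦ rfl
  have hB' : ∀ u v, soInner c (a.endo ((extChartAt (𝓡 4) p).symm y) u) (b.endo _ v) =
      pushForm hy.1 B u v := by
    intro u v
    obtain ⟨u, rfl⟩ := exists_coordMap hy.1 u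
    obtain ⟨v, rfl⟩ := exists_coordMap hy.1 v
    rw [pushForm_apply, hB, L.endo_eq a hy, L.endo_eq b hy, L.soInner_hat hy.2]
  have h1 := sum_gram_inv_mul he (stdBasis _) (pushForm hy.1 B)
  have h2 := sum_gram_inv_mul he (coordBasis hy.1) (pushForm hy.1 B)
  rw [← h2, coe_stdBasis, coe_coordBasis, h.gram_gA hy hA hc] at h1
  simp only [← coordMap_single, pushForm_apply, hB] at h1
  rw [← h1, inner₁]
  simp only [hB']
  rfl

lemma ChartFrame.IsConnRep.inner₂_eq {c : ℝ} (hc : 0 < c)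
    {S R : Π x : X, TangentSpace (𝓡 4) x → TangentSpace (𝓡 4) x → Module.End ℝ (V x)}
    {S' R' : R4 →ₗ[ℝ] R4 →ₗ[ℝ] (Fin 3 → ℝ)}
    (hS : ∀ u v, S _ (coordMap p y u) (coordMap p y v) = L.hat _ (S' u v))
    (hR : ∀ u v, R _ (coordMap p y u) (coordMap p y v) = L.hat _ (R' u v)) :
    inner₂ c A S R ((extChartAt (𝓡 4) p).symm y) = 2 * c * ((1 / 2) * ∑ i, ∑ j, ∑ k, ∑ l,
      (metricMat c γ y)⁻¹ i k * (metricMat c γ y)⁻¹ j l *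
        (S' (stdR4 i) (stdR4 j) ⬝ᵥ R' (stdR4 k) (stdR4 l))) := by
  obtain ⟨e, he, -⟩ := (h.isTripleMetric_gA hy hA hc).exists_oriented_basis (coordBasis hy.1)
  have hSR : ∀ u v w z, soInner c (S _ u v) (R _ w z) =
      2 * c * (pushForm hy.1 S' u v ⬝ᵥ pushForm hy.1 R' w z) := by
    intro u v w z
    obtain ⟨u, rfl⟩ := exists_coordMap hy.1 u
    obtain ⟨v, rfl⟩ := exists_coordMap hy.1 v
    obtain ⟨w, rfl⟩ := exists_coordMap hy.1 w
    obtain ⟨z, rfl⟩ := exists_coordMap hy.1 z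
    rw [pushForm_apply, pushForm_apply, hS, hR, L.soInner_hat hy.2]
  have h1 := sum_gram_inv_mul₂ he (stdBasis _) (pushForm hy.1 S') (pushForm hy.1 R')
  have h2 := sum_gram_inv_mul₂ he (coordBasis hy.1) (pushForm hy.1 S') (pushForm hy.1 R')
  rw [← h2, coe_stdBasis, coe_coordBasis, h.gram_gA hy hA hc] at h1
  simp only [← coordMap_single, pushForm_apply] at h1
  rw [← h1, inner₂]
  simp only [hSR, mul_left_comm _ (2 * c), ← Finset.mul_sum]
  rfl

end Local

/-! ### Integration of densities -/

section Density

variable {X : Type*} [TopologicalSpace X] [ChartedSpace R4 X] [IsManifold (𝓡 4) ∞ X]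

/-- The coordinate expression of a density in the chart at `p`. -/
noncomputable def densRep (p : X) (δ : Π x : X, (Fin 4 → TangentSpace (𝓡 4) x) → ℝ) (y : R4) : ℝ :=
  δ ((extChartAt (𝓡 4) p).symm y) (coordField p y)

/-- A continuous density. -/
structure IsContDensity (δ : Π x : X, (Fin 4 → TangentSpace (𝓡 4) x) → ℝ) : Prop where
  det : ∀ x (b : Module.Basis (Fin 4) ℝ (TangentSpace (𝓡 4) x)) v, δ x v = |b.det v| * δ x b
  cont : ∀ p, ContinuousOn (densRep p δ) (extChartAt (𝓡 4) p).target

lemma densRep_eq {p : X} (δ : Π x : X, (Fin 4 → TangentSpace (𝓡 4) x) → ℝ) {y : R4}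
    (hy : y ∈ (extChartAt (𝓡 4) p).target) :
    densRep p δ y = δ ((extChartAt (𝓡 4) p).symm y)
      (fun i ↦ coordVec p (stdR4 i) ((extChartAt (𝓡 4) p).symm y)) := by
  simp only [densRep, coordVec_symm hy, coordMap_single]

/-- The change of coordinates from the chart at `p` to the chart at `q`. -/
noncomputable def coordTrans (p q : X) (y : R4) : R4 :=
  extChartAt (𝓡 4) q ((extChartAt (𝓡 4) p).symm y)

/-- The domain of the change of coordinates. -/
def transDom (p q : X) : Set R4 :=
  (extChartAt (𝓡 4) p).target ∩ (extChartAt (𝓡 4) p).symm ⁻¹' (chartAt R4 q).source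

lemma isOpen_transDom (p q : X) : IsOpen (transDom p q) :=
  (continuousOn_extChartAt_symm p).isOpen_inter_preimage (isOpen_extChartAt_target p)
    (chartAt R4 q).open_source

lemma mdifferentiableAt_coordTrans {p q : X} {y : R4} (hy : y ∈ transDom p q) :
    DifferentiableAt ℝ (coordTrans p q) y :=
  ((mdifferentiableAt_extChartAt (I := 𝓡 4) hy.2).comp y
    ((contMDiffAt_extChartAt_symm' hy.1).mdifferentiableAt (by simp))).differentiableAt

lemma injOn_coordTrans (p q : X) : Set.InjOn (coordTrans p q) (transDom p q) := by
  intro y hy z hz h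
  have h1 := (extChartAt (𝓡 4) q).injOn (by simpa using hy.2) (by simpa using hz.2) h
  exact (extChartAt (𝓡 4) p).symm.injOn (by simpa using hy.1) (by simpa using hz.1) h1

lemma symm_coordTrans {p q : X} {y : R4} (hy : y ∈ transDom p q) :
    (extChartAt (𝓡 4) q).symm (coordTrans p q y) = (extChartAt (𝓡 4) p).symm y :=
  (extChartAt (𝓡 4) q).left_inv (by simpa using hy.2)

lemma image_coordTrans (p q : X) : coordTrans p q '' transDom p q = transDom q p := by
  have key : ∀ p q : X, ∀ y ∈ transDom p q, coordTrans p q y ∈ transDom q p := by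
    intro p q y hy
    refine ⟨(extChartAt (𝓡 4) q).map_source (by simpa using hy.2), ?_⟩
    rw [Set.mem_preimage, symm_coordTrans hy]
    simpa using (extChartAt (𝓡 4) p).map_target hy.1
  refine Set.Subset.antisymm (Set.image_subset_iff.mpr (key p q)) fun z hz ↦ ?_
  refine ⟨coordTrans q p z, key q p z hz, ?_⟩
  rw [coordTrans, symm_coordTrans hz, (extChartAt (𝓡 4) q).right_inv hz.1]

lemma coordVec_trans {p q : X} {y : R4} (hy : y ∈ transDom p q) (w : R4) :
    coordVec p w ((extChartAt (𝓡 4) p).symm y) =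
      coordVec q (fderiv ℝ (coordTrans p q) y w) ((extChartAt (𝓡 4) p).symm y) := by
  have h1 : fderiv ℝ (coordTrans p q) y w = Trivialization.continuousLinearMapAt ℝ
      (trivializationAt R4 (TangentSpace (𝓡 4)) q) _ (coordMap p y w) := by
    rw [TangentBundle.continuousLinearMapAt_trivializationAt hy.2, ← mfderiv_eq_fderiv]
    exact congrArg (fun l ↦ l w) (mfderiv_comp y (mdifferentiableAt_extChartAt (I := 𝓡 4) hy.2)
      ((contMDiffAt_extChartAt_symm' hy.1).mdifferentiableAt (by simp)))
  rw [h1, coordVec_symm hy.1, coordVec, Trivialization.symmL_continuousLinearMapAt]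
  rw [TangentBundle.trivializationAt_baseSet]
  exact hy.2

lemma exists_coordVec_equiv {q x : X} (hx : x ∈ (chartAt R4 q).source) :
    ∃ e : R4 ≃ₗ[ℝ] TangentSpace (𝓡 4) x, ∀ w, e w = coordVec q w x := by
  have hx' : x ∈ (trivializationAt R4 (TangentSpace (𝓡 4)) q).baseSet := by
    rwa [TangentBundle.trivializationAt_baseSet]
  exact ⟨((trivializationAt R4 (TangentSpace (𝓡 4)) q).continuousLinearEquivAt ℝ x
    hx').symm.toLinearEquiv, fun w ↦ congrFun (Trivialization.symm_continuousLinearEquivAt_eq _ hx') w⟩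

/-- The transformation rule for densities. -/
lemma IsContDensity.densRep_trans {δ : Π x : X, (Fin 4 → TangentSpace (𝓡 4) x) → ℝ}
    (hδ : IsContDensity δ) {p q : X} {y : R4} (hy : y ∈ transDom p q) :
    densRep p δ y = |(fderiv ℝ (coordTrans p q) y).det| * densRep q δ (coordTrans p q y) := by
  have hq : coordTrans p q y ∈ (extChartAt (𝓡 4) q).target :=
    (extChartAt (𝓡 4) q).map_source (by simpa using hy.2)
  obtain ⟨e, he⟩ := exists_coordVec_equiv hy.2
  have hb : ∀ i, ((EuclideanSpace.basisFun (Fin 4) ℝ).toBasis.map e) i =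
      coordVec q (stdR4 i) ((extChartAt (𝓡 4) p).symm y) := by
    intro i
    rw [Module.Basis.map_apply, he, OrthonormalBasis.coe_toBasis, EuclideanSpace.basisFun_apply]
  have hv : (fun i ↦ coordVec p (stdR4 i) ((extChartAt (𝓡 4) p).symm y)) =
      e ∘ (fderiv ℝ (coordTrans p q) y).toLinearMap ∘ (EuclideanSpace.basisFun (Fin 4) ℝ).toBasis := by
    ext1 i
    rw [coordVec_trans hy, ← he]
    simp
  rw [densRep_eq δ hy.1, densRep_eq δ hq, symm_coordTrans hy,
    hδ.det _ ((EuclideanSpace.basisFun (Fin 4) ℝ).toBasis.map e), hv, Module.Basis.det_map]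
  congr 2
  · have h2 : e.symm ∘ e ∘ (fderiv ℝ (coordTrans p q) y).toLinearMap ∘
        (EuclideanSpace.basisFun (Fin 4) ℝ).toBasis = (fderiv ℝ (coordTrans p q) y).toLinearMap ∘
        (EuclideanSpace.basisFun (Fin 4) ℝ).toBasis := by
      ext1 i
      exact e.symm_apply_apply _
    rw [h2, Module.Basis.det_comp, Module.Basis.det_self, mul_one]
  · exact funext hb

open MeasureTheory

/-- The change of variables formula on the overlap of two charts. -/
lemma setIntegral_transDom {δ : Π x : X, (Fin 4 → TangentSpace (𝓡 4) x) → ℝ}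
    (hδ : IsContDensity δ) (p q : X) (f : X → ℝ) :
    ∫ y in transDom q p, f ((extChartAt (𝓡 4) q).symm y) * densRep q δ y =
      ∫ y in transDom p q, f ((extChartAt (𝓡 4) p).symm y) * densRep p δ y := by
  rw [← image_coordTrans p q, integral_image_eq_integral_abs_det_fderiv_smul volume
    (isOpen_transDom p q).measurableSet (fun y hy ↦
      (mdifferentiableAt_coordTrans hy).hasFDerivAt.hasFDerivWithinAt) (injOn_coordTrans p q)]
  refine setIntegral_congr_fun (isOpen_transDom p q).measurableSet fun y hy ↦ ?_
  simp only [smul_eq_mul]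
  rw [hδ.densRep_trans hy, symm_coordTrans hy]
  ring

/-- A function which is continuous on the open set `s` and vanishes outside the compact subset `K`
of `s` is integrable on `s`. -/
lemma integrableOn_of_continuousOn_of_compact {s K : Set R4} (hK : IsCompact K)
    (hKs : K ⊆ s) (hs : MeasurableSet s) {f : R4 → ℝ} (hf : ContinuousOn f s)
    (h0 : ∀ y ∈ s, y ∉ K → f y = 0) : IntegrableOn f s := by
  have h1 : IntegrableOn f K := (hf.mono hKs).integrableOn_compact hK
  exact h1.of_forall_sdiff_eq_zero hs fun y hy ↦ h0 y hy.1 hy.2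

variable [T2Space X] [CompactSpace X]

lemma chartPartition_support : {p : X | ∃ x, chartPartition X p x ≠ 0}.Finite := by
  have h := (chartPartition X).locallyFinite.finite_nonempty_of_compact
  refine h.subset fun p ⟨x, hx⟩ ↦ ⟨x, hx⟩

lemma chartPartition_tsupport (p : X) : tsupport (chartPartition X p) ⊆ (chartAt R4 p).source :=
  Classical.choose_spec (SmoothPartitionOfUnity.exists_isSubordinate_chartAt_source (𝓡 4) X) p

lemma chartPartition_sum (x : X) : ∑ p ∈ chartPartition_support.toFinset, chartPartition X p x = 1 := by
  rw [← (chartPartition X).sum_eq_one (Set.mem_univ x)]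
  refine (finsum_eq_sum_of_support_subset _ fun p hp ↦ ?_).symm
  simpa using ⟨x, hp⟩

lemma integrateDensity_eq_sum (δ : Π x : X, (Fin 4 → TangentSpace (𝓡 4) x) → ℝ) :
    integrateDensity δ = ∑ p ∈ chartPartition_support.toFinset,
      ∫ y in (extChartAt (𝓡 4) p).target,
        chartPartition X p ((extChartAt (𝓡 4) p).symm y) * densRep p δ y := by
  refine finsum_eq_sum_of_support_subset _ fun p hp ↦ ?_
  by_contra h
  refine hp ?_
  have h0 : ∀ x, chartPartition X p x = 0 := by simpa using h
  simp [h0]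

lemma integrableOn_densRep (p : X) {f : X → ℝ} (hf : Continuous f) {K : Set X} (hK : IsCompact K)
    (hKp : K ⊆ (chartAt R4 p).source) (h0 : ∀ x ∉ K, f x = 0)
    {δ : Π x : X, (Fin 4 → TangentSpace (𝓡 4) x) → ℝ}
    (hδ : ContinuousOn (densRep p δ) (extChartAt (𝓡 4) p).target) :
    IntegrableOn (fun y ↦ f ((extChartAt (𝓡 4) p).symm y) * densRep p δ y)
      (extChartAt (𝓡 4) p).target := by
  have hKp' : K ⊆ (extChartAt (𝓡 4) p).source := by simpa using hKp
  refine integrableOn_of_continuousOn_of_compact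
    (hK.image_of_continuousOn ((continuousOn_extChartAt p).mono hKp'))
    (Set.image_subset_iff.mpr fun x hx ↦ (extChartAt (𝓡 4) p).map_source (hKp' hx))
    (isOpen_extChartAt_target p).measurableSet
    ((hf.comp_continuousOn (continuousOn_extChartAt_symm p)).mul hδ) fun y hy hyK ↦ ?_
  rw [h0, zero_mul]
  exact fun h ↦ hyK ⟨_, h, (extChartAt (𝓡 4) p).right_inv hy⟩

lemma integrableOn_chartPartition (p : X) {δ : Π x : X, (Fin 4 → TangentSpace (𝓡 4) x) → ℝ}
    (hδ : ContinuousOn (densRep p δ) (extChartAt (𝓡 4) p).target) :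
    IntegrableOn (fun y ↦ chartPartition X p ((extChartAt (𝓡 4) p).symm y) * densRep p δ y)
      (extChartAt (𝓡 4) p).target :=
  integrableOn_densRep p (chartPartition X p).contMDiff.continuous
    (isClosed_tsupport _).isCompact (chartPartition_tsupport p)
    (fun _ hx ↦ image_eq_zero_of_notMem_tsupport hx) hδ

/-- The integral of a density with support in the domain of a chart can be computed in this
chart. -/
lemma IsContDensity.integral_eq_chart {δ : Π x : X, (Fin 4 → TangentSpace (𝓡 4) x) → ℝ}
    (hδ : IsContDensity δ) (p : X) {K : Set X} (hK : IsCompact K)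
    (hKp : K ⊆ (chartAt R4 p).source) (h0 : ∀ x ∉ K, δ x = 0) :
    integrateDensity δ = ∫ y in (extChartAt (𝓡 4) p).target, densRep p δ y := by
  -- Both integrands are supported in the overlap of the charts at `p` and `q`.
  have h1 : ∀ q, ∫ y in (extChartAt (𝓡 4) q).target,
        chartPartition X q ((extChartAt (𝓡 4) q).symm y) * densRep q δ y =
      ∫ y in (extChartAt (𝓡 4) p).target,
        chartPartition X q ((extChartAt (𝓡 4) p).symm y) * densRep p δ y := by
    intro q
    have e1 := setIntegral_eq_of_subset_of_forall_sdiff_eq_zero (μ := volume)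
      (f := fun y ↦ chartPartition X q ((extChartAt (𝓡 4) q).symm y) * densRep q δ y)
      (isOpen_extChartAt_target q).measurableSet
      (Set.inter_subset_left : transDom q p ⊆ _) fun y hy ↦ by
        have : (extChartAt (𝓡 4) q).symm y ∉ K := fun h ↦ hy.2 ⟨hy.1, hKp h⟩
        simp only [densRep, h0 _ this, Pi.zero_apply, mul_zero]
    have e2 := setIntegral_eq_of_subset_of_forall_sdiff_eq_zero (μ := volume)
      (f := fun y ↦ chartPartition X q ((extChartAt (𝓡 4) p).symm y) * densRep p δ y)
      (isOpen_extChartAt_target p).measurableSet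
      (Set.inter_subset_left : transDom p q ⊆ _) fun y hy ↦ by
        have : (extChartAt (𝓡 4) p).symm y ∉ tsupport (chartPartition X q) :=
          fun h ↦ hy.2 ⟨hy.1, chartPartition_tsupport q h⟩
        simp only [image_eq_zero_of_notMem_tsupport this, zero_mul]
    exact e1.trans ((setIntegral_transDom hδ p q _).trans e2.symm)
  have hint : ∀ q, IntegrableOn (fun y ↦ chartPartition X q ((extChartAt (𝓡 4) p).symm y) *
      densRep p δ y) (extChartAt (𝓡 4) p).target := by
    intro q
    have hKp' : K ⊆ (extChartAt (𝓡 4) p).source := by simpa using hKp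
    refine integrableOn_of_continuousOn_of_compact
      (hK.image_of_continuousOn ((continuousOn_extChartAt p).mono hKp'))
      (Set.image_subset_iff.mpr fun x hx ↦ (extChartAt (𝓡 4) p).map_source (hKp' hx))
      (isOpen_extChartAt_target p).measurableSet
      (((chartPartition X q).contMDiff.continuous.comp_continuousOn
        (continuousOn_extChartAt_symm p)).mul (hδ.cont p)) fun y hy hyK ↦ ?_
    have : (extChartAt (𝓡 4) p).symm y ∉ K :=
      fun h ↦ hyK ⟨_, h, (extChartAt (𝓡 4) p).right_inv hy⟩
    simp only [densRep, h0 _ this, Pi.zero_apply, mul_zero]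
  rw [integrateDensity_eq_sum, Finset.sum_congr rfl fun q _ ↦ h1 q,
    ← integral_finsetSum _ fun q _ ↦ hint q]
  refine integral_congr_ae (ae_of_all _ fun y ↦ ?_)
  simp only [← Finset.sum_mul, chartPartition_sum, one_mul]

lemma integrateDensity_add {δ δ' : Π x : X, (Fin 4 → TangentSpace (𝓡 4) x) → ℝ}
    (hδ : ∀ p, ContinuousOn (densRep p δ) (extChartAt (𝓡 4) p).target)
    (hδ' : ∀ p, ContinuousOn (densRep p δ') (extChartAt (𝓡 4) p).target) :
    integrateDensity (fun x v ↦ δ x v + δ' x v) = integrateDensity δ + integrateDensity δ' := by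
  simp only [integrateDensity_eq_sum]
  rw [← Finset.sum_add_distrib]
  refine Finset.sum_congr rfl fun p _ ↦ ?_
  rw [← integral_add (integrableOn_chartPartition p (hδ p)) (integrableOn_chartPartition p (hδ' p))]
  simp only [densRep, mul_add]

end Density

/-! ### Smoothness of the coordinate expressions -/

section MatrixSmooth

open scoped Matrix

variable {E : Type*} [NormedAddCommGroup E] [NormedSpace ℝ E] {s : Set E} {n : WithTop ℕ∞}
  {ι : Type*} [Fintype ι] [DecidableEq ι]

lemma contDiffOn_det {M : E → Matrix ι ι ℝ} (hM : ∀ i j, ContDiffOn ℝ n (fun y ↦ M y i j) s) :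
    ContDiffOn ℝ n (fun y ↦ (M y).det) s := by
  simp only [Matrix.det_apply]
  exact ContDiffOn.sum fun σ _ ↦ (contDiffOn_prod fun i _ ↦ hM _ _).const_smul _

lemma contDiffOn_inv {M : E → Matrix ι ι ℝ} (hM : ∀ i j, ContDiffOn ℝ n (fun y ↦ M y i j) s)
    (h0 : ∀ y ∈ s, (M y).det ≠ 0) (i j : ι) : ContDiffOn ℝ n (fun y ↦ (M y)⁻¹ i j) s := by
  simp only [Matrix.inv_def, Ring.inverse_eq_inv', Matrix.smul_apply, smul_eq_mul,
    Matrix.adjugate_apply]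
  refine ((contDiffOn_det hM).inv h0).mul (contDiffOn_det fun k l ↦ ?_)
  by_cases hk : k = j
  · subst hk
    simp only [Matrix.updateRow_self]
    exact contDiffOn_const
  · simp only [Matrix.updateRow_ne hk]
    exact hM k l

lemma contDiffOn_wedge {T : Type*} {α β : E → T → T → ℝ} {v : Fin 4 → T}
    (hα : ∀ u w, ContDiffOn ℝ n (fun y ↦ α y u w) s)
    (hβ : ∀ u w, ContDiffOn ℝ n (fun y ↦ β y u w) s) :
    ContDiffOn ℝ n (fun y ↦ wedge (fun a b : ℝ ↦ a * b) (α y) (β y) v) s := by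
  simp only [wedge]
  exact (((((((hα _ _).mul (hβ _ _)).sub ((hα _ _).mul (hβ _ _))).add ((hα _ _).mul (hβ _ _))).add
    ((hα _ _).mul (hβ _ _))).sub ((hα _ _).mul (hβ _ _))).add ((hα _ _).mul (hβ _ _)))

variable {T : Type*} {F : E → T → T → Fin 3 → ℝ} {v : Fin 4 → T}

lemma contDiffOn_crossProduct {f g : E → Fin 3 → ℝ} (hf : ContDiffOn ℝ n f s)
    (hg : ContDiffOn ℝ n g s) : ContDiffOn ℝ n (fun y ↦ f y ⨯₃ g y) s :=
  (crossL.contDiff.comp_contDiffOn hf).clm_apply hg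

lemma contDiffOn_dotProduct {f g : E → Fin 3 → ℝ} (hf : ContDiffOn ℝ n f s)
    (hg : ContDiffOn ℝ n g s) : ContDiffOn ℝ n (fun y ↦ f y ⬝ᵥ g y) s := by
  simp only [dotProduct]
  exact ContDiffOn.sum fun i _ ↦ (contDiffOn_pi.mp hf i).mul (contDiffOn_pi.mp hg i)

lemma contDiffOn_wedgeMatrix (hF : ∀ u w, ContDiffOn ℝ n (fun y ↦ F y u w) s) (i j : Fin 3) :
    ContDiffOn ℝ n (fun y ↦ wedgeMatrix (F y) v i j) s :=
  contDiffOn_wedge (fun u w ↦ contDiffOn_pi.mp (hF u w) i) fun u w ↦ contDiffOn_pi.mp (hF u w) j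

lemma contDiffOn_trace {M : E → Matrix ι ι ℝ} (hM : ∀ i j, ContDiffOn ℝ n (fun y ↦ M y i j) s) :
    ContDiffOn ℝ n (fun y ↦ (M y).trace) s := by
  simp only [Matrix.trace, Matrix.diag]
  exact ContDiffOn.sum fun i _ ↦ hM i i

lemma contDiffOn_mul_apply {M N : E → Matrix ι ι ℝ}
    (hM : ∀ i j, ContDiffOn ℝ n (fun y ↦ M y i j) s)
    (hN : ∀ i j, ContDiffOn ℝ n (fun y ↦ N y i j) s) (i j : ι) :
    ContDiffOn ℝ n (fun y ↦ (M y * N y) i j) s := by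
  simp only [Matrix.mul_apply]
  exact ContDiffOn.sum fun k _ ↦ (hM i k).mul (hN k j)

lemma contDiffOn_urbantke (hF : ∀ u w, ContDiffOn ℝ n (fun y ↦ F y u w) s) (a b : T) :
    ContDiffOn ℝ n (fun y ↦ urbantke (F y) v a b) s := by
  have h : ∀ u w, ContDiffOn ℝ n (fun y ↦ F y a u ⨯₃ F y b w - F y a w ⨯₃ F y b u) s := fun u w ↦
    (contDiffOn_crossProduct (hF _ _) (hF _ _)).sub (contDiffOn_crossProduct (hF _ _) (hF _ _))
  simp only [urbantke, wedge]
  exact (((((contDiffOn_dotProduct (h _ _) (hF _ _)).sub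
    (contDiffOn_dotProduct (h _ _) (hF _ _))).add (contDiffOn_dotProduct (h _ _) (hF _ _))).add
    (contDiffOn_dotProduct (h _ _) (hF _ _))).sub (contDiffOn_dotProduct (h _ _) (hF _ _))).add
    (contDiffOn_dotProduct (h _ _) (hF _ _))

lemma contDiffOn_abs_of_ne_zero {f : E → ℝ} (hf : ContDiffOn ℝ n f s) (h0 : ∀ y ∈ s, f y ≠ 0) :
    ContDiffOn ℝ n (fun y ↦ |f y|) s := by
  have h : (fun y ↦ |f y|) = fun y ↦ √(f y ^ 2) := funext fun y ↦ (Real.sqrt_sq_eq_abs _).symm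
  rw [h]
  exact (hf.pow 2).sqrt fun y hy ↦ pow_ne_zero 2 (h0 y hy)

lemma contDiffOn_metricScale (hF : ∀ u w, ContDiffOn ℝ n (fun y ↦ F y u w) s) (k : ℝ)
    (h0 : ∀ y ∈ s, urbantke (F y) v (v 0) (v 0) ≠ 0)
    (h1 : ∀ y ∈ s, 2 * (k / 3 * (wedgeMatrix (F y) v).trace) / (9 * (wedgeMatrix (F y) v).det) ≠ 0) :
    ContDiffOn ℝ n (fun y ↦ metricScale k (F y) v) s := by
  have hu := contDiffOn_urbantke (v := v) hF (v 0) (v 0)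
  have hd : ∀ y ∈ s, 9 * (wedgeMatrix (F y) v).det ≠ 0 := fun y hy h ↦ h1 y hy (by rw [h, div_zero])
  refine (hu.div (contDiffOn_abs_of_ne_zero hu h0) fun y hy ↦ abs_ne_zero.mpr (h0 y hy)).mul
    (ContDiffOn.sqrt ?_ h1)
  exact (contDiffOn_const.mul (contDiffOn_const.mul (contDiffOn_trace
    (contDiffOn_wedgeMatrix hF)))).div (contDiffOn_const.mul (contDiffOn_det
    (contDiffOn_wedgeMatrix hF))) hd

end MatrixSmooth

section LocalSmooth

open scoped Matrix

variable {X : Type*} [TopologicalSpace X] [ChartedSpace R4 X] [IsManifold (𝓡 4) ∞ X]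
  {V : X → Type*} [TopologicalSpace (TotalSpace R3 V)]
  [∀ x, NormedAddCommGroup (V x)] [∀ x, InnerProductSpace ℝ (V x)]
  [FiberBundle R3 V] [VectorBundle ℝ R3 V]
  {p : X} {L : ChartFrame V p}

lemma contDiffOn_fderiv_apply {G : Type*} [NormedAddCommGroup G] [NormedSpace ℝ G] {s : Set R4}
    (hs : IsOpen s) {f : R4 → G} (hf : ContDiffOn ℝ ∞ f s) (u : R4) :
    ContDiffOn ℝ ∞ (fun y ↦ fderiv ℝ f y u) s :=
  (hf.fderiv_of_isOpen hs (m := ∞) (by norm_cast)).clm_apply contDiffOn_const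

lemma contDiffOn_extRep {s : Set R4} (hs : IsOpen s) {γ α : R4 → R4 →L[ℝ] (Fin 3 → ℝ)}
    (hγ : ContDiffOn ℝ ∞ γ s) (hα : ContDiffOn ℝ ∞ α s) (u v : R4) :
    ContDiffOn ℝ ∞ (fun y ↦ extRep γ α y u v) s := by
  have h1 : ∀ u v, ContDiffOn ℝ ∞ (fun y ↦ fderiv ℝ α y u v) s := fun u v ↦
    (contDiffOn_fderiv_apply hs hα u).clm_apply contDiffOn_const
  have h2 : ∀ u v, ContDiffOn ℝ ∞ (fun y ↦ γ y u ⨯₃ α y v) s := fun u v ↦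
    contDiffOn_crossProduct (hγ.clm_apply contDiffOn_const) (hα.clm_apply contDiffOn_const)
  exact ((h1 u v).sub (h1 v u)).add ((h2 u v).sub (h2 v u))

lemma contDiffOn_curvRep {s : Set R4} (hs : IsOpen s) {γ : R4 → R4 →L[ℝ] (Fin 3 → ℝ)}
    (hγ : ContDiffOn ℝ ∞ γ s) (u v : R4) : ContDiffOn ℝ ∞ (fun y ↦ curvRep γ y u v) s := by
  have h1 : ∀ u v, ContDiffOn ℝ ∞ (fun y ↦ fderiv ℝ γ y u v) s := fun u v ↦
    (contDiffOn_fderiv_apply hs hγ u).clm_apply contDiffOn_const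
  exact ((h1 u v).sub (h1 v u)).add
    (contDiffOn_crossProduct (hγ.clm_apply contDiffOn_const) (hγ.clm_apply contDiffOn_const))

variable [ContMDiffVectorBundle ∞ R3 V (𝓡 4)] [IsContMDiffRiemannianBundle (𝓡 4) ∞ R3 V]
  {A : CovariantDerivative (𝓡 4) R3 V} {γ : R4 → R4 →L[ℝ] (Fin 3 → ℝ)} (h : L.IsConnRep A γ)
include h

lemma ChartFrame.IsConnRep.contDiffOn_curvMat (i j : Fin 3) :
    ContDiffOn ℝ ∞ (fun y ↦ curvMat γ y i j) L.dom :=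
  contDiffOn_wedgeMatrix (contDiffOn_curvRep L.isOpen_dom h.smooth) i j

variable (hA : IsDefinite A)
include hA

lemma ChartFrame.IsConnRep.contDiffOn_metricMat {c : ℝ} (hc : 0 < c) (i j : Fin 4) :
    ContDiffOn ℝ ∞ (fun y ↦ metricMat c γ y i j) L.dom := by
  have hF := contDiffOn_curvRep L.isOpen_dom h.smooth
  refine (contDiffOn_metricScale hF (2 * c) (fun y hy ↦ ?_) fun y hy ↦ ?_).mul
    (contDiffOn_urbantke hF _ _)
  · have h1 := urbantke_self_ne_zero (pushForm_neg hy) (h.definite hy hA) (coordBasis hy.1)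
      ((coordBasis hy.1).ne_zero 0)
    simp only [coe_coordBasis, urbantke, wedge, ← coordMap_single, pushForm_apply] at h1
    exact h1
  · have h1 := (h.trace_ne_zero hy hA).2
    have h2 : 2 * (2 * c / 3 * (curvMat γ y).trace) / (9 * (curvMat γ y).det) =
      4 * c / 27 * ((curvMat γ y).trace / (curvMat γ y).det) := by
      rw [mul_comm 9, ← div_div]
      ring
    change 2 * (2 * c / 3 * (curvMat γ y).trace) / (9 * (curvMat γ y).det) ≠ 0
    rw [h2]
    positivity

lemma ChartFrame.IsConnRep.contDiffOn_metricMat_inv {c : ℝ} (hc : 0 < c) (i j : Fin 4) :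
    ContDiffOn ℝ ∞ (fun y ↦ (metricMat c γ y)⁻¹ i j) L.dom :=
  contDiffOn_inv (h.contDiffOn_metricMat hA hc) (fun _ hy ↦ (h.isUnit_metricMat hy hA hc).ne_zero) i j

lemma ChartFrame.IsConnRep.contDiffOn_abs_trace (c : ℝ) :
    ContDiffOn ℝ ∞ (fun y ↦ |2 * c / 3| * |(curvMat γ y).trace|) L.dom :=
  contDiffOn_const.mul (contDiffOn_abs_of_ne_zero (contDiffOn_trace h.contDiffOn_curvMat)
    fun _ hy ↦ (h.trace_ne_zero hy hA).1)

lemma ChartFrame.IsConnRep.contDiffOn_qMat (i j : Fin 3) :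
    ContDiffOn ℝ ∞ (fun y ↦ qMat (curvMat γ y) i j) L.dom :=
  (contDiffOn_const.div (contDiffOn_trace h.contDiffOn_curvMat)
    fun _ hy ↦ (h.trace_ne_zero hy hA).1).mul (h.contDiffOn_curvMat i j)

lemma ChartFrame.IsConnRep.contDiffOn_normSq :
    ContDiffOn ℝ ∞ (fun y ↦ (qMat (curvMat γ y) * qMat (curvMat γ y)).trace) L.dom :=
  contDiffOn_trace (contDiffOn_mul_apply (h.contDiffOn_qMat hA) (h.contDiffOn_qMat hA))

lemma ChartFrame.IsConnRep.contDiffOn_bMat (i j : Fin 3) :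
    ContDiffOn ℝ ∞ (fun y ↦ bMat (curvMat γ y) i j) L.dom :=
  (contDiffOn_const.mul (h.contDiffOn_qMat hA i j)).sub
    ((contDiffOn_const.mul (h.contDiffOn_normSq hA)).mul contDiffOn_const)

end LocalSmooth

/-! ### Densities and 2-forms in a local frame -/

section TwoForm

open scoped Matrix

variable {X : Type*} [TopologicalSpace X] [ChartedSpace R4 X] [IsManifold (𝓡 4) ∞ X]

lemma contDiffAt_vrep {p : X} {y : R4} (hy : y ∈ (extChartAt (𝓡 4) p).target)
    {W : Π x : X, TangentSpace (𝓡 4) x}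
    (hW : SmoothSecAt R4 W ((extChartAt (𝓡 4) p).symm y)) : ContDiffAt ℝ ∞ (vrep p W) y := by
  have h := ContMDiffAt.mpullback_vectorField_preimage (I := 𝓘(ℝ, R4)) (m := ∞) (n := ∞) hW
    (contMDiffAt_extChartAt_symm' hy) (coordMap_isInvertible hy) (by norm_cast)
  have h2 := ((contMDiff_snd_tangentBundle_modelSpace R4 𝓘(ℝ, R4)).contMDiffAt
    (n := ∞)).comp _ h
  exact h2.contDiffAt

variable {V : X → Type*} [TopologicalSpace (TotalSpace R3 V)]
  [∀ x, NormedAddCommGroup (V x)] [∀ x, InnerProductSpace ℝ (V x)]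
  [FiberBundle R3 V] [VectorBundle ℝ R3 V]
  [ContMDiffVectorBundle ∞ R3 V (𝓡 4)] [IsContMDiffRiemannianBundle (𝓡 4) ∞ R3 V]

variable (V) in
lemma exists_chartFrame_dom {p : X} {y : R4} (hy : y ∈ (extChartAt (𝓡 4) p).target) :
    ∃ L : ChartFrame V p, y ∈ L.dom := by
  obtain ⟨L, hL⟩ := exists_chartFrame (V := V) p ((extChartAt (𝓡 4) p).symm y)
    (by simpa using (extChartAt (𝓡 4) p).map_target hy)
  exact ⟨L, hy, hL⟩

variable (V) in
lemma exists_chartFrame_at (x : X) : ∃ (p : X) (L : ChartFrame V p) (y : R4), y ∈ L.dom ∧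
    (extChartAt (𝓡 4) p).symm y = x := by
  obtain ⟨L, hL⟩ := exists_chartFrame (V := V) x x (mem_chart_source R4 x)
  exact ⟨x, L, _, (L.exists_dom hL).1, (L.exists_dom hL).2⟩

/-- The transformation behaviour of a 4-form under a change of basis. -/
lemma volForm_eq_det_mul [T2Space X] {A : CovariantDerivative (𝓡 4) R3 V} (hA : IsDefinite A)
    (c : ℝ) (x : X) (b : Module.Basis (Fin 4) ℝ (TangentSpace (𝓡 4) x))
    (v : Fin 4 → TangentSpace (𝓡 4) x) : volForm c A x v = b.det v * volForm c A x b := by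
  obtain ⟨p, L, y, hy, rfl⟩ := exists_chartFrame_at V x
  obtain ⟨γ, h⟩ := L.exists_isConnRep hA.metric hA.smooth
  rw [L.volForm_eq hy.2 (h.curvature_eq_pushForm hy), L.volForm_eq hy.2 (h.curvature_eq_pushForm hy),
    wedgeMatrix_eq_det_smul (pushForm_neg hy) b v, Matrix.trace_smul, smul_eq_mul]
  ring

/-- A function with continuous coordinate expressions times `|μ(A)|` is a continuous density. -/
lemma isContDensity_mul_volForm [T2Space X] {A : CovariantDerivative (𝓡 4) R3 V}
    (hA : IsDefinite A) (c : ℝ) {f : X → ℝ}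
    (hf : ∀ (p : X) (L : ChartFrame V p),
      ContinuousOn (fun y ↦ f ((extChartAt (𝓡 4) p).symm y)) L.dom) :
    IsContDensity fun x v ↦ f x * |volForm c A x v| where
  det x b v := by rw [volForm_eq_det_mul hA c x b v, abs_mul]; ring
  cont p y hy := by
    obtain ⟨L, hL⟩ := exists_chartFrame_dom V hy
    obtain ⟨γ, h⟩ := L.exists_isConnRep hA.metric hA.smooth
    have h1 : ContinuousOn (densRep p fun x v ↦ f x * |volForm c A x v|) L.dom := by
      refine ((hf p L).mul (h.contDiffOn_abs_trace hA c).continuousOn).congr fun z hz ↦ ?_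
      rw [densRep, h.volForm_eq hz, abs_mul]
      rfl
    exact (h1.continuousAt (L.isOpen_dom.mem_nhds hL)).continuousWithinAt

section Rep

variable {p : X} (L : ChartFrame V p)
  {β : Π x : X, TangentSpace (𝓡 4) x → TangentSpace (𝓡 4) x → Module.End ℝ (V x)}

/-- The coordinates of a 2-form with values in the skew endomorphisms. -/
noncomputable def ChartFrame.twoRep (hβ : IsTwoForm β) (y : R4) :
    R4 →ₗ[ℝ] R4 →ₗ[ℝ] (Fin 3 → ℝ) :=
  have h1 : ∀ u v w, β ((extChartAt (𝓡 4) p).symm y) u (v + w) = β _ u v + β _ u w := fun u v w ↦ by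
    rw [hβ.alt, hβ.add, hβ.alt _ v, hβ.alt _ w]; abel
  have h2 : ∀ (r : ℝ) u v, β ((extChartAt (𝓡 4) p).symm y) u (r • v) = r • β _ u v := fun r u v ↦ by
    rw [hβ.alt, hβ.smul, hβ.alt _ v, smul_neg, neg_neg]
  LinearMap.mk₂ ℝ (fun u v ↦ L.vee _ (β _ (coordMap p y u) (coordMap p y v)))
    (fun _ _ _ ↦ by rw [map_add, hβ.add, map_add])
    (fun _ _ _ ↦ by rw [map_smul, hβ.smul, map_smul])
    (fun _ _ _ ↦ by rw [map_add, h1, map_add])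
    (fun _ _ _ ↦ by rw [map_smul, h2, map_smul])

lemma ChartFrame.twoRep_apply (hβ : IsTwoForm β) (y u v : R4) :
    L.twoRep hβ y u v = L.vee _ (β _ (coordMap p y u) (coordMap p y v)) := rfl

lemma ChartFrame.twoRep_neg (hβ : IsTwoForm β) (y u v : R4) :
    L.twoRep hβ y u v = -L.twoRep hβ y v u := by
  rw [twoRep_apply, hβ.alt, map_neg, twoRep_apply]

lemma ChartFrame.twoForm_eq (hβ : IsTwoForm β) {y : R4} (hy : y ∈ L.dom) (u v : R4) :
    β _ (coordMap p y u) (coordMap p y v) = L.hat _ (L.twoRep hβ y u v) :=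
  (L.hat_vee hy.2 (hβ.skew _ _ _)).symm

lemma ChartFrame.contDiffOn_twoRep [T2Space X] (hβ : IsTwoForm β) (u v : R4) :
    ContDiffOn ℝ ∞ (fun y ↦ L.twoRep hβ y u v) L.dom := by
  refine contDiffOn_pi.mpr fun m y hy ↦ ContDiffAt.contDiffWithinAt ?_
  obtain ⟨U, hU, hUe⟩ := exists_smooth_extension (chartAt R4 p).open_source
    (contMDiffOn_coordVec p u) (L.subset hy.2)
  obtain ⟨W, hW, hWe⟩ := exists_smooth_extension (chartAt R4 p).open_source
    (contMDiffOn_coordVec p v) (L.subset hy.2)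
  obtain ⟨S, hS, hSe⟩ := exists_smooth_extension L.isOpen (L.smooth (m + 1)) hy.2
  have h1 := (ContMDiffAt.inner_bundle (L.smoothAt hy (m + 2))
    (hβ.smooth U W S hU hW hS _)).comp y (contMDiffAt_extChartAt_symm' hy.1)
  refine h1.contDiffAt.congr_of_eventuallyEq ?_
  filter_upwards [L.eventually_symm hy (hUe.and (hWe.and hSe))] with z hz
  rw [twoRep_apply, L.vee_apply, ← coordVec_symm hz.1.1, ← coordVec_symm hz.1.1, ← hz.2.1,
    ← hz.2.2.1, ← hz.2.2.2]
  rfl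

end Rep

section Algebra

variable {β β' : Π x : X, TangentSpace (𝓡 4) x → TangentSpace (𝓡 4) x → Module.End ℝ (V x)}

lemma IsTwoForm.smul_form (hβ : IsTwoForm β) {f : X → ℝ} (hf : ContMDiff (𝓡 4) 𝓘(ℝ, ℝ) ∞ f) :
    IsTwoForm fun x u v ↦ f x • β x u v where
  add x u u' v := by rw [hβ.add, smul_add]
  smul x r u v := by rw [hβ.smul, smul_comm]
  alt x u v := by rw [hβ.alt, smul_neg]
  skew x u v s t := by
    rw [LinearMap.smul_apply, LinearMap.smul_apply, inner_smul_left, inner_smul_right, hβ.skew]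
    simp
  smooth U W S hU hW hS := hf.smul_section (hβ.smooth U W S hU hW hS)

/-- A family of endomorphisms which in local frames is given by smooth alternating bilinear maps
with values in `ℝ³ ≅ 𝔰𝔬(3)` is a 2-form. -/
lemma isTwoForm_of_rep
    (h : ∀ x₀ : X, ∃ (p : X) (L : ChartFrame V p) (F : R4 → R4 →ₗ[ℝ] R4 →ₗ[ℝ] (Fin 3 → ℝ)),
      x₀ ∈ L.U ∧ (∀ u v, ContDiffOn ℝ ∞ (fun y ↦ F y u v) L.dom) ∧ (∀ y u v, F y u v = -F y v u) ∧
      ∀ y ∈ L.dom, ∀ u v, β _ (coordMap p y u) (coordMap p y v) = L.hat _ (F y u v)) :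
    IsTwoForm β := by
  have key : ∀ x : X, ∃ (L' : (Fin 3 → ℝ) →ₗ[ℝ] Module.End ℝ (V x))
      (G : TangentSpace (𝓡 4) x →ₗ[ℝ] TangentSpace (𝓡 4) x →ₗ[ℝ] (Fin 3 → ℝ)),
      (∀ a s t, inner ℝ (L' a s) t = -inner ℝ s (L' a t)) ∧ (∀ u v, G u v = -G v u) ∧
      ∀ u v, β x u v = L' (G u v) := by
    intro x
    obtain ⟨p, L, F, hx, -, hF, hβ⟩ := h x
    obtain ⟨hy, hyx⟩ := L.exists_dom hx
    generalize extChartAt (𝓡 4) p x = y at hy hyx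
    subst hyx
    refine ⟨L.hat _, pushForm hy.1 (F y), L.hat_skew hx, fun u v ↦ ?_, fun u v ↦ ?_⟩ <;>
    · obtain ⟨u, rfl⟩ := exists_coordMap hy.1 u
      obtain ⟨v, rfl⟩ := exists_coordMap hy.1 v
      simp only [pushForm_apply]
      first
      | exact hF _ _ _
      | exact hβ y hy u v
  refine ⟨fun x u u' v ↦ ?_, fun x r u v ↦ ?_, fun x u v ↦ ?_, fun x u v s t ↦ ?_,
    fun U W S hU hW hS x ↦ ?_⟩
  · obtain ⟨L', G, -, -, hβ⟩ := key x
    simp only [hβ, map_add, LinearMap.add_apply]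
  · obtain ⟨L', G, -, -, hβ⟩ := key x
    simp only [hβ, map_smul, LinearMap.smul_apply]
  · obtain ⟨L', G, -, hG, hβ⟩ := key x
    rw [hβ, hG, map_neg, hβ]
  · obtain ⟨L', G, hL, -, hβ⟩ := key x
    rw [hβ, hL]
  · obtain ⟨p, L, F, hx, hFs, -, hβ⟩ := h x
    obtain ⟨hy, hyx⟩ := L.exists_dom hx
    rw [← hyx]
    refine L.smoothSecAt_of_rep hy ?_
    have h1 : L.rep (fun x ↦ β x (U x) (W x) (S x)) =ᶠ[nhds (extChartAt (𝓡 4) p x)] fun z ↦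
        (∑ i, ∑ j, (vrep p U z i * vrep p W z j) • F z (stdR4 i) (stdR4 j)) ⨯₃ L.rep S z := by
      filter_upwards [L.isOpen_dom.mem_nhds hy] with z hz
      have h2 : ∀ w : R4, w = ∑ i, w i • stdR4 i := fun w ↦ by
        conv_lhs => rw [← (EuclideanSpace.basisFun (Fin 4) ℝ).sum_repr w]
        simp
      rw [ChartFrame.rep, ← coordMap_vrep hz.1 U, ← coordMap_vrep hz.1 W, hβ z hz, L.coord_hat hz.2]
      conv_lhs => rw [h2 (vrep p U z), h2 (vrep p W z)]
      simp only [map_sum, map_smul, LinearMap.sum_apply, LinearMap.smul_apply, smul_smul,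
        Finset.smul_sum, ChartFrame.rep]
      rw [Finset.sum_comm]
      exact Finset.sum_congr rfl fun i _ ↦ Finset.sum_congr rfl fun j _ ↦ by rw [mul_comm]
    refine ContDiffAt.congr_of_eventuallyEq ?_ h1
    have hU' := contDiffAt_euclidean.mp (contDiffAt_vrep hy.1 (hU _))
    have hW' := contDiffAt_euclidean.mp (contDiffAt_vrep hy.1 (hW _))
    have hF' := fun u v ↦ (hFs u v).contDiffAt (L.isOpen_dom.mem_nhds hy)
    have h3 : ContDiffAt ℝ ∞ (fun z ↦ ∑ i, ∑ j, (vrep p U z i * vrep p W z j) •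
        F z (stdR4 i) (stdR4 j)) (extChartAt (𝓡 4) p x) :=
      ContDiffAt.sum fun i _ ↦ ContDiffAt.sum fun j _ ↦ ((hU' i).mul (hW' j)).smul (hF' _ _)
    exact (crossL.contDiff.contDiffAt.comp _ h3).clm_apply (L.contDiffAt_rep hy (hS _))

/-- `B_A(F_A)` is a smooth 2-form with values in `𝔰𝔬(E)`. -/
lemma isTwoForm_twistedCurvature [T2Space X] {A : CovariantDerivative (𝓡 4) R3 V}
    (hA : IsDefinite A) {c : ℝ} (hc : c ≠ 0) : IsTwoForm (twistedCurvature c A) := by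
  refine isTwoForm_of_rep fun x ↦ ?_
  obtain ⟨L, hx⟩ := exists_chartFrame (V := V) x x (mem_chart_source R4 x)
  obtain ⟨γ, h⟩ := L.exists_isConnRep hA.metric hA.smooth
  refine ⟨x, L, fun y ↦ (curvRepₗ γ y).compr₂ (bMat (curvMat γ y)).mulVecLin, hx, fun u v ↦ ?_,
    fun y u v ↦ ?_, fun y hy u v ↦ h.twistedCurvature_eq hy hc u v⟩
  · refine contDiffOn_pi.mpr fun i ↦ ?_
    change ContDiffOn ℝ ∞ (fun y ↦ ∑ j, bMat (curvMat γ y) i j * curvRep γ y u v j) L.dom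
    exact ContDiffOn.sum fun j _ ↦ (h.contDiffOn_bMat hA i j).mul
      (contDiffOn_pi.mp (contDiffOn_curvRep L.isOpen_dom h.smooth u v) j)
  · change bMat (curvMat γ y) *ᵥ curvRep γ y u v = -(bMat (curvMat γ y) *ᵥ curvRep γ y v u)
    rw [curvRep_neg, Matrix.mulVec_neg]

end Algebra

end TwoForm

/-! ### Construction of 1-forms from local expressions -/

section Hom

variable {X : Type*} [TopologicalSpace X] [ChartedSpace R4 X] [IsManifold (𝓡 4) ∞ X]

/-- A map into a space of linear maps on a finite-dimensional space is smooth if it is so after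
evaluation at every vector. -/
lemma contMDiffAt_clm_of_apply {F G : Type*} [NormedAddCommGroup F] [NormedSpace ℝ F]
    [FiniteDimensional ℝ F] [NormedAddCommGroup G] [NormedSpace ℝ G] {f : X → F →L[ℝ] G} {x₀ : X}
    (h : ∀ v, ContMDiffAt (𝓡 4) 𝓘(ℝ, G) ∞ (fun x ↦ f x v) x₀) :
    ContMDiffAt (𝓡 4) 𝓘(ℝ, F →L[ℝ] G) ∞ f x₀ := by
  let b := Module.finBasis ℝ F
  have h1 : f = fun x ↦ ∑ i, ContinuousLinearMap.smulRightL ℝ F G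
      (LinearMap.toContinuousLinearMap (b.coord i)) (f x (b i)) := by
    funext x
    ext v
    rw [sum_apply]
    conv_lhs => rw [← b.sum_repr v, map_sum]
    refine Finset.sum_congr rfl fun i _ ↦ ?_
    rw [map_smul]
    rfl
  rw [h1]
  exact ContMDiffAt.sum fun i _ ↦
    (ContinuousLinearMap.contMDiff _).contMDiffAt.comp x₀ (h (b i))

variable {F₁ F₂ : Type*} [NormedAddCommGroup F₁] [NormedSpace ℝ F₁] [NormedAddCommGroup F₂]
  [NormedSpace ℝ F₂] {E₁ E₂ : X → Type*} [TopologicalSpace (TotalSpace F₁ E₁)]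
  [∀ x, AddCommGroup (E₁ x)] [∀ x, Module ℝ (E₁ x)] [∀ x, TopologicalSpace (E₁ x)]
  [FiberBundle F₁ E₁] [VectorBundle ℝ F₁ E₁] [TopologicalSpace (TotalSpace F₂ E₂)]
  [∀ x, AddCommGroup (E₂ x)] [∀ x, Module ℝ (E₂ x)] [∀ x, TopologicalSpace (E₂ x)]
  [∀ x, IsTopologicalAddGroup (E₂ x)] [∀ x, ContinuousSMul ℝ (E₂ x)]
  [FiberBundle F₂ E₂] [VectorBundle ℝ F₂ E₂]

/-- A section of a bundle of homomorphisms is smooth if its values on the vectors of a local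
trivialization are smooth. -/
lemma smoothSecAt_hom_of_apply [FiniteDimensional ℝ F₁] {T : Π x : X, E₁ x →L[ℝ] E₂ x} {x₀ : X}
    (h : ∀ v : F₁, SmoothSecAt F₂
      (fun x ↦ T x (Trivialization.symmL ℝ (trivializationAt F₁ E₁ x₀) x v)) x₀) :
    SmoothSecAt (F₁ →L[ℝ] F₂) T x₀ := by
  refine contMDiffAt_hom_bundle _ |>.mpr ⟨contMDiffAt_id, contMDiffAt_clm_of_apply fun v ↦ ?_⟩
  refine (contMDiffAt_totalSpace.mp (h v)).2.congr_of_eventuallyEq ?_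
  filter_upwards [(trivializationAt F₂ E₂ x₀).open_baseSet.mem_nhds
    (mem_baseSet_trivializationAt F₂ E₂ x₀)] with x hx
  rw [ContinuousLinearMap.inCoordinates]
  simp [Trivialization.coe_linearMapAt_of_mem _ hx]


lemma contMDiffOn_symmL_apply
    [ContMDiffVectorBundle ∞ F₁ E₁ (𝓡 4)] (p : X) (w : F₁) :
    SmoothSecOn F₁ (fun x ↦ Trivialization.symmL ℝ (trivializationAt F₁ E₁ p) x w)
      (trivializationAt F₁ E₁ p).baseSet := by
  refine ((trivializationAt F₁ E₁ p).contMDiffOn_section_baseSet_iff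
    (IB := 𝓡 4) (n := ∞)).mpr (contMDiffOn_const (c := w) |>.congr fun x hx ↦ ?_)
  rw [Trivialization.symmL_apply _ hx, Trivialization.mk_symm _ hx, Trivialization.apply_symm_apply]
  simpa [Trivialization.mem_target] using hx

end Hom

section OneForm

open scoped Matrix

variable {X : Type*} [TopologicalSpace X] [ChartedSpace R4 X] [IsManifold (𝓡 4) ∞ X]
  {V : X → Type*} [TopologicalSpace (TotalSpace R3 V)]
  [∀ x, NormedAddCommGroup (V x)] [∀ x, InnerProductSpace ℝ (V x)]
  [FiberBundle R3 V] [VectorBundle ℝ R3 V]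
  {p : X} (L : ChartFrame V p)

/-- The endomorphism-valued covector at `x` with the coordinates `α` in the frame `L`. -/
noncomputable def ChartFrame.hatForm (α : R4 →L[ℝ] (Fin 3 → ℝ)) (x : X) :
    V x →L[ℝ] TangentSpace (𝓡 4) x →L[ℝ] V x :=
  have : FiniteDimensional ℝ (V x) := Module.finite_of_finrank_eq_succ (finrank_fibre V x)
  have : FiniteDimensional ℝ (TangentSpace (𝓡 4) x) := inferInstanceAs (FiniteDimensional ℝ R4)
  have : T2Space (TangentSpace (𝓡 4) x) := inferInstanceAs (T2Space R4)
  LinearMap.toContinuousBilinearMap ((L.hat x ∘ₗ α.toLinearMap ∘ₗ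
    ((trivializationAt R4 (TangentSpace (𝓡 4)) p).continuousLinearMapAt ℝ x).toLinearMap).flip)

lemma ChartFrame.hatForm_apply (α : R4 →L[ℝ] (Fin 3 → ℝ)) (x : X) (s : V x)
    (u : TangentSpace (𝓡 4) x) : L.hatForm α x s u =
      L.hat x (α ((trivializationAt R4 (TangentSpace (𝓡 4)) p).continuousLinearMapAt ℝ x u)) s := rfl

lemma continuousLinearMapAt_coordMap {y : R4} (hy : y ∈ (extChartAt (𝓡 4) p).target) (w : R4) :
    (trivializationAt R4 (TangentSpace (𝓡 4)) p).continuousLinearMapAt ℝ _ (coordMap p y w) = w := by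
  rw [← coordVec_symm hy, coordVec]
  refine Trivialization.continuousLinearMapAt_symmL _ ?_ w
  rw [TangentBundle.trivializationAt_baseSet]
  simpa using (extChartAt (𝓡 4) p).map_target hy

variable [ContMDiffVectorBundle ∞ R3 V (𝓡 4)] [IsContMDiffRiemannianBundle (𝓡 4) ∞ R3 V]

open Classical in
/-- A 1-form with prescribed coordinates in a local frame, vanishing outside a closed subset of the
domain of the frame. -/
lemma ChartFrame.exists_oneForm {α : R4 → R4 →L[ℝ] (Fin 3 → ℝ)} (hα : ContDiffOn ℝ ∞ α L.dom)
    {K : Set X} (hK : IsClosed K) (hKU : K ⊆ L.U)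
    (h0 : ∀ y ∈ L.dom, (extChartAt (𝓡 4) p).symm y ∉ K → α y = 0) :
    ∃ a : OneForm V, (∀ y ∈ L.dom, L.oneRep a y = α y) ∧ ∀ x ∉ K, a.toFun x = 0 := by
  let T : Π x : X, V x →L[ℝ] TangentSpace (𝓡 4) x →L[ℝ] V x :=
    fun x ↦ if x ∈ L.U then L.hatForm (α (extChartAt (𝓡 4) p x)) x else 0
  have hT : ∀ y ∈ L.dom, T ((extChartAt (𝓡 4) p).symm y) = L.hatForm (α y) _ := fun y hy ↦ by
    simp only [T, if_pos (show (extChartAt (𝓡 4) p).symm y ∈ L.U from hy.2),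
      (extChartAt (𝓡 4) p).right_inv hy.1]
  have hT0 : ∀ x ∉ K, T x = 0 := by
    intro x hx
    by_cases hxU : x ∈ L.U
    · obtain ⟨hy, hyx⟩ := L.exists_dom hxU
      have h1 := h0 _ hy (by rwa [hyx])
      simp only [T, if_pos hxU, h1]
      ext s u
      simp [L.hatForm_apply]
    · exact if_neg hxU
  have hskew : ∀ (x : X) (u : TangentSpace (𝓡 4) x) (s t : V x),
      inner ℝ (T x s u) t = -inner ℝ s (T x t u) := by
    intro x u s t
    by_cases hxU : x ∈ L.U
    · simp only [T, if_pos hxU, L.hatForm_apply]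
      exact L.hat_skew hxU _ s t
    · simp only [T, if_neg hxU]
      simp
  -- On `K` the form is given by `α`, and off `K` it vanishes in a neighbourhood of each point.
  have hsmooth : ∀ x, SmoothSecAt (R3 →L[ℝ] R4 →L[ℝ] R3) T x := by
    intro x
    by_cases hx : x ∈ K
    · refine smoothSecAt_hom_of_apply fun v ↦ smoothSecAt_hom_of_apply fun w ↦ ?_
      have hS := (contMDiffOn_symmL_apply (E₁ := V) x v).contMDiffAt
        ((trivializationAt R3 V x).open_baseSet.mem_nhds (mem_baseSet_trivializationAt R3 V x))
      have hW := (contMDiffOn_symmL_apply (E₁ := TangentSpace (𝓡 4) (M := X)) x w).contMDiffAt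
        ((trivializationAt R4 (TangentSpace (𝓡 4)) x).open_baseSet.mem_nhds
          (mem_baseSet_trivializationAt R4 (TangentSpace (𝓡 4)) x))
      set S : Π z : X, V z := fun z ↦ Trivialization.symmL ℝ (trivializationAt R3 V x) z v
      set W : Π z : X, TangentSpace (𝓡 4) z := fun z ↦
        Trivialization.symmL ℝ (trivializationAt R4 (TangentSpace (𝓡 4)) x) z w
      change SmoothSecAt R3 (fun z ↦ T z (S z) (W z)) x
      obtain ⟨hy, hyx⟩ := L.exists_dom (hKU hx)
      generalize extChartAt (𝓡 4) p x = y at hy hyx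
      rw [← hyx] at hS hW ⊢
      refine L.smoothSecAt_of_rep hy ?_
      have h1 : L.rep (fun z ↦ T z (S z) (W z)) =ᶠ[nhds y]
          fun z ↦ α z (vrep p W z) ⨯₃ L.rep S z := by
        filter_upwards [L.isOpen_dom.mem_nhds hy] with z hz
        rw [ChartFrame.rep, hT z hz, L.hatForm_apply, L.coord_hat hz.2, ← coordMap_vrep hz.1 W,
          continuousLinearMapAt_coordMap hz.1]
        rfl
      refine ContDiffAt.congr_of_eventuallyEq ?_ h1
      exact (crossL.contDiff.contDiffAt.comp y ((hα.contDiffAt (L.isOpen_dom.mem_nhds hy)).clm_apply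
        (contDiffAt_vrep hy.1 hW))).clm_apply (L.contDiffAt_rep hy hS)
    · refine (Bundle.contMDiff_zeroSection ℝ
        (fun x : X ↦ V x →L[ℝ] TangentSpace (𝓡 4) x →L[ℝ] V x) x).congr_of_eventuallyEq ?_
      filter_upwards [hK.isOpen_compl.mem_nhds hx] with z hz
      exact congrArg (TotalSpace.mk' _ z) (hT0 z hz)
  refine ⟨⟨T, hskew, hsmooth⟩, fun y hy ↦ ?_, hT0⟩
  ext1 w
  have h1 := L.endo_eq ⟨T, hskew, hsmooth⟩ hy w
  have h2 : OneForm.endo ⟨T, hskew, hsmooth⟩ _ (coordMap p y w) = L.hat _ (α y w) := by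
    ext s
    change T _ s _ = _
    rw [hT y hy, L.hatForm_apply, continuousLinearMapAt_coordMap hy.1]
  exact L.hat_injective hy.2 (h1.symm.trans h2)

/-- Linear combinations of 1-forms. -/
noncomputable def OneForm.addSMul (a b : OneForm V) (r : ℝ) : OneForm V where
  toFun x := a.toFun x + r • b.toFun x
  skew x u s t := by
    simp only [add_apply, smul_apply, inner_add_left, inner_add_right, inner_smul_left,
      inner_smul_right, a.skew x u s t, b.skew x u s t]
    simp
    ring
  smooth := a.smooth.add_section (contMDiff_const.smul_section b.smooth)

end OneForm

/-! ### The adjoint of the covariant exterior derivative -/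

section Divergence

open MeasureTheory

/-- The divergence theorem: the derivative of a function with compact support has integral zero. -/
lemma setIntegral_fderiv_eq_zero {D K : Set R4} (hD : IsOpen D) (hK : IsCompact K) (hKD : K ⊆ D)
    {f : R4 → ℝ} (hf : ContDiffOn ℝ ∞ f D) (h0 : ∀ y ∈ D, y ∉ K → f y = 0) (v : R4) :
    ∫ y in D, fderiv ℝ f y v = 0 := by
  let F := D.indicator f
  have hF0 : ∀ y ∉ K, F y = 0 := fun y hy ↦ by
    by_cases hyD : y ∈ D
    · exact (Set.indicator_of_mem hyD f).trans (h0 y hyD hy)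
    · exact Set.indicator_of_notMem hyD f
  have hFf : ∀ y ∈ D, F =ᶠ[nhds y] f := fun y hy ↦ by
    filter_upwards [hD.mem_nhds hy] with z hz using Set.indicator_of_mem hz f
  have hF : ContDiff ℝ ∞ F := contDiff_iff_contDiffAt.mpr fun y ↦ by
    by_cases hy : y ∈ K
    · exact (hf.contDiffAt (hD.mem_nhds (hKD hy))).congr_of_eventuallyEq (hFf y (hKD hy))
    · refine (contDiffAt_const (c := (0 : ℝ))).congr_of_eventuallyEq ?_
      filter_upwards [hK.isClosed.isOpen_compl.mem_nhds hy] with z hz using hF0 z hz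
  have hFc : HasCompactSupport F := HasCompactSupport.intro hK fun y hy ↦ hF0 y hy
  have hF' : Continuous fun y ↦ fderiv ℝ F y v :=
    (hF.continuous_fderiv (by simp)).clm_apply continuous_const
  have hFc' : HasCompactSupport fun y ↦ fderiv ℝ F y v := hFc.fderiv_apply ℝ v
  have h1 : ∫ y in D, fderiv ℝ f y v = ∫ y, fderiv ℝ F y v := by
    rw [← setIntegral_eq_integral_of_forall_compl_eq_zero (s := D)
      (f := fun y ↦ fderiv ℝ F y v) fun y hy ↦ ?_]
    · exact setIntegral_congr_fun hD.measurableSet fun y hy ↦ by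
        simp only [(hFf y hy).fderiv_eq]
    · have hy' : y ∉ K := fun h ↦ hy (hKD h)
      have : F =ᶠ[nhds y] fun _ ↦ 0 := by
        filter_upwards [hK.isClosed.isOpen_compl.mem_nhds hy'] with z hz using hF0 z hz
      rw [this.fderiv_eq]
      simp
  rw [h1]
  have h2 := integral_mul_fderiv_eq_neg_fderiv_mul_of_integrable (μ := volume) (f := fun _ : R4 ↦ (1 : ℝ))
    (g := F) (v := v) (by simp) (by simpa using hF'.integrable_of_hasCompactSupport hFc')
    (by simpa using hF.continuous.integrable_of_hasCompactSupport hFc)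
    (fun _ _ ↦ by fun_prop) fun _ _ ↦ hF.differentiable (by simp) _
  simpa using h2

end Divergence

section Algebra

open scoped Matrix

/-- The pointwise product rule behind the formula for the adjoint: for antisymmetric `H`, the
pairing with an exterior covariant derivative is a divergence minus the pairing with the covariant
divergence of `H`. -/
lemma sum_dotProduct_extDeriv {H : Fin 4 → Fin 4 → Fin 3 → ℝ} (hH : ∀ k l, H k l = -H l k)
    (dH : Fin 4 → Fin 4 → Fin 3 → ℝ) (g a : Fin 4 → Fin 3 → ℝ) (da : Fin 4 → Fin 4 → Fin 3 → ℝ) :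
    ∑ k, ∑ l, H k l ⬝ᵥ (da k l - da l k + (g k ⨯₃ a l - g l ⨯₃ a k)) =
      2 * (∑ k, ∑ l, (dH k l ⬝ᵥ a l + H k l ⬝ᵥ da k l) +
        ∑ l, (-∑ k, (dH k l + g k ⨯₃ H k l)) ⬝ᵥ a l) := by
  have h1 : ∑ k, ∑ l, H k l ⬝ᵥ (da l k + g l ⨯₃ a k) =
      -∑ k, ∑ l, H k l ⬝ᵥ (da k l + g k ⨯₃ a l) := by
    rw [Finset.sum_comm, ← Finset.sum_neg_distrib]
    refine Finset.sum_congr rfl fun k _ ↦ ?_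
    rw [← Finset.sum_neg_distrib]
    refine Finset.sum_congr rfl fun l _ ↦ ?_
    rw [hH l k, neg_dotProduct]
  have h2 : ∑ l, (-∑ k, (dH k l + g k ⨯₃ H k l)) ⬝ᵥ a l =
      ∑ k, ∑ l, (H k l ⬝ᵥ (g k ⨯₃ a l) - dH k l ⬝ᵥ a l) := by
    rw [Finset.sum_comm]
    refine Finset.sum_congr rfl fun l _ ↦ ?_
    rw [neg_dotProduct, sum_dotProduct, ← Finset.sum_neg_distrib]
    refine Finset.sum_congr rfl fun k _ ↦ ?_
    have : (g k ⨯₃ H k l) ⬝ᵥ a l = -(H k l ⬝ᵥ (g k ⨯₃ a l)) := by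
      simp [cross_apply, dotProduct, Fin.sum_univ_three]
      ring
    rw [add_dotProduct, this]
    ring
  calc _ = ∑ k, ∑ l, H k l ⬝ᵥ (da k l + g k ⨯₃ a l) - ∑ k, ∑ l, H k l ⬝ᵥ (da l k + g l ⨯₃ a k) := by
        simp only [← Finset.sum_sub_distrib, ← dotProduct_sub]
        refine Finset.sum_congr rfl fun k _ ↦ Finset.sum_congr rfl fun l _ ↦ ?_
        congr 1
        abel
    _ = _ := by
        rw [h1, h2, sub_neg_eq_add, ← two_mul, ← Finset.sum_add_distrib]
        congr 1
        refine Finset.sum_congr rfl fun k _ ↦ ?_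
        rw [← Finset.sum_add_distrib]
        refine Finset.sum_congr rfl fun l _ ↦ ?_
        rw [dotProduct_add]
        ring

lemma fderiv_dotProduct {E ι : Type*} [NormedAddCommGroup E] [NormedSpace ℝ E] [Fintype ι]
    {f g : E → ι → ℝ} {y : E} (hf : DifferentiableAt ℝ f y) (hg : DifferentiableAt ℝ g y) (v : E) :
    DifferentiableAt ℝ (fun y ↦ f y ⬝ᵥ g y) y ∧
    fderiv ℝ (fun y ↦ f y ⬝ᵥ g y) y v = fderiv ℝ f y v ⬝ᵥ g y + f y ⬝ᵥ fderiv ℝ g y v := by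
  have h1 : HasFDerivAt (fun y ↦ f y ⬝ᵥ g y) (∑ i, (f y i • (ContinuousLinearMap.proj i ∘L fderiv ℝ g y) +
      g y i • (ContinuousLinearMap.proj i ∘L fderiv ℝ f y))) y :=
    HasFDerivAt.fun_sum fun i _ ↦
      ((hasFDerivAt_pi'.mp hf.hasFDerivAt i).mul (hasFDerivAt_pi'.mp hg.hasFDerivAt i))
  refine ⟨h1.differentiableAt, ?_⟩
  rw [h1.fderiv]
  simp only [sum_apply, add_apply, smul_apply, ContinuousLinearMap.comp_apply,
    ContinuousLinearMap.proj_apply, smul_eq_mul, dotProduct, ← Finset.sum_add_distrib]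
  exact Finset.sum_congr rfl fun i _ ↦ by ring

end Algebra

section LocalAdjoint

open scoped Matrix

variable {X : Type*} [TopologicalSpace X] [ChartedSpace R4 X] [IsManifold (𝓡 4) ∞ X]
  {V : X → Type*} [TopologicalSpace (TotalSpace R3 V)]
  [∀ x, NormedAddCommGroup (V x)] [∀ x, InnerProductSpace ℝ (V x)]
  [FiberBundle R3 V] [VectorBundle ℝ R3 V]
  {p : X} {L : ChartFrame V p}
  [ContMDiffVectorBundle ∞ R3 V (𝓡 4)] [IsContMDiffRiemannianBundle (𝓡 4) ∞ R3 V]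
  {A : CovariantDerivative (𝓡 4) R3 V} {γ : R4 → R4 →L[ℝ] (Fin 3 → ℝ)} (h : L.IsConnRep A γ)
  (hA : IsDefinite A) {c : ℝ} (hc : 0 < c)
include h hA hc

lemma ChartFrame.IsConnRep.contDiffOn_inner₁ (a b : OneForm V) :
    ContDiffOn ℝ ∞ (fun y ↦ inner₁ c A a b ((extChartAt (𝓡 4) p).symm y)) L.dom := by
  refine ContDiffOn.congr ?_ fun y hy ↦ h.inner₁_eq hy hA hc a b
  refine ContDiffOn.sum fun i _ ↦ ContDiffOn.sum fun j _ ↦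
    (h.contDiffOn_metricMat_inv hA hc i j).mul (contDiffOn_const.mul (contDiffOn_dotProduct ?_ ?_))
  · exact (L.contDiffOn_oneRep a).clm_apply contDiffOn_const
  · exact (L.contDiffOn_oneRep b).clm_apply contDiffOn_const

variable {β : Π x : X, TangentSpace (𝓡 4) x → TangentSpace (𝓡 4) x → Module.End ℝ (V x)}

omit h in
lemma ChartFrame.IsConnRep.inner₂_covExtDeriv (h : L.IsConnRep A γ) (hβ : IsTwoForm β)
    (a : OneForm V) {y : R4} (hy : y ∈ L.dom) :
    inner₂ c A β (covExtDeriv A a) ((extChartAt (𝓡 4) p).symm y) = 2 * c * ((1 / 2) *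
      ∑ i, ∑ j, ∑ k, ∑ l, (metricMat c γ y)⁻¹ i k * (metricMat c γ y)⁻¹ j l *
        (L.twoRep hβ y (stdR4 i) (stdR4 j) ⬝ᵥ extRep γ (L.oneRep a) y (stdR4 k) (stdR4 l))) :=
  h.inner₂_eq hy hA hc (S' := L.twoRep hβ y) (R' := extRepₗ γ (L.oneRep a) y)
    (L.twoForm_eq hβ hy) (h.covExtDeriv_eq a hy)

lemma ChartFrame.IsConnRep.contDiffOn_inner₂ [T2Space X] (hβ : IsTwoForm β) (a : OneForm V) :
    ContDiffOn ℝ ∞ (fun y ↦ inner₂ c A β (covExtDeriv A a) ((extChartAt (𝓡 4) p).symm y)) L.dom := by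
  refine ContDiffOn.congr ?_ fun y hy ↦ h.inner₂_covExtDeriv hA hc hβ a hy
  exact contDiffOn_const.mul (contDiffOn_const.mul (ContDiffOn.sum fun i _ ↦ ContDiffOn.sum fun j _ ↦
    ContDiffOn.sum fun k _ ↦ ContDiffOn.sum fun l _ ↦ ((h.contDiffOn_metricMat_inv hA hc i k).mul
    (h.contDiffOn_metricMat_inv hA hc j l)).mul (contDiffOn_dotProduct (L.contDiffOn_twoRep hβ _ _)
    (contDiffOn_extRep L.isOpen_dom h.smooth (L.contDiffOn_oneRep a) _ _))))

end LocalAdjoint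

section Density

variable {X : Type*} [TopologicalSpace X] [ChartedSpace R4 X] [IsManifold (𝓡 4) ∞ X]
  {V : X → Type*} [TopologicalSpace (TotalSpace R3 V)]
  [∀ x, NormedAddCommGroup (V x)] [∀ x, InnerProductSpace ℝ (V x)]
  [FiberBundle R3 V] [VectorBundle ℝ R3 V]
  [ContMDiffVectorBundle ∞ R3 V (𝓡 4)] [IsContMDiffRiemannianBundle (𝓡 4) ∞ R3 V]
  [T2Space X] {A : CovariantDerivative (𝓡 4) R3 V} (hA : IsDefinite A) {c : ℝ} (hc : 0 < c)
  {β : Π x : X, TangentSpace (𝓡 4) x → TangentSpace (𝓡 4) x → Module.End ℝ (V x)}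
include hA hc

lemma isContDensity_inner₁ (a b : OneForm V) :
    IsContDensity fun x v ↦ inner₁ c A a b x * |volForm c A x v| :=
  isContDensity_mul_volForm hA c fun q M ↦ by
    obtain ⟨δ, hδ⟩ := M.exists_isConnRep hA.metric hA.smooth
    exact (hδ.contDiffOn_inner₁ hA hc a b).continuousOn

lemma isContDensity_inner₂ (hβ : IsTwoForm β) (a : OneForm V) :
    IsContDensity fun x v ↦ inner₂ c A β (covExtDeriv A a) x * |volForm c A x v| :=
  isContDensity_mul_volForm hA c fun q M ↦ by
    obtain ⟨δ, hδ⟩ := M.exists_isConnRep hA.metric hA.smooth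
    exact (hδ.contDiffOn_inner₂ hA hc hβ a).continuousOn

end Density

section Codifferential

open scoped Matrix

/-- The density `|μ(A)|` in a chart. -/
noncomputable def volRep (c : ℝ) (γ : R4 → R4 →L[ℝ] (Fin 3 → ℝ)) (y : R4) : ℝ :=
  |2 * c / 3| * |(curvMat γ y).trace|

/-- The bivector `|μ(A)| ∑ gⁱᵏ gʲˡ Sᵢⱼ` with values in `ℝ³` which is dual to a 2-form. -/
noncomputable def raised (c : ℝ) (γ : R4 → R4 →L[ℝ] (Fin 3 → ℝ))
    (S : R4 → R4 →ₗ[ℝ] R4 →ₗ[ℝ] (Fin 3 → ℝ)) (k l : Fin 4) (y : R4) : Fin 3 → ℝ :=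
  volRep c γ y • ∑ i, ∑ j, ((metricMat c γ y)⁻¹ i k * (metricMat c γ y)⁻¹ j l) •
    S y (stdR4 i) (stdR4 j)

/-- The covariant divergence of `raised`, up to the sign. -/
noncomputable def codiff (c : ℝ) (γ : R4 → R4 →L[ℝ] (Fin 3 → ℝ))
    (S : R4 → R4 →ₗ[ℝ] R4 →ₗ[ℝ] (Fin 3 → ℝ)) (l : Fin 4) (y : R4) : Fin 3 → ℝ :=
  -∑ k, (fderiv ℝ (raised c γ S k l) y (stdR4 k) + γ y (stdR4 k) ⨯₃ raised c γ S k l y)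

/-- The 1-form which is dual to the vector density `codiff`. -/
noncomputable def adjRep (c : ℝ) (γ : R4 → R4 →L[ℝ] (Fin 3 → ℝ))
    (S : R4 → R4 →ₗ[ℝ] R4 →ₗ[ℝ] (Fin 3 → ℝ)) (y : R4) : R4 →L[ℝ] (Fin 3 → ℝ) :=
  (volRep c γ y)⁻¹ • ∑ i, (EuclideanSpace.proj i : R4 →L[ℝ] ℝ).smulRight
    (∑ l, metricMat c γ y l i • codiff c γ S l y)

variable {c : ℝ} {γ : R4 → R4 →L[ℝ] (Fin 3 → ℝ)} {S : R4 → R4 →ₗ[ℝ] R4 →ₗ[ℝ] (Fin 3 → ℝ)}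

lemma raised_neg {y : R4} (hS : ∀ u v, S y u v = -S y v u) (k l : Fin 4) :
    raised c γ S k l y = -raised c γ S l k y := by
  rw [raised, raised, ← smul_neg, Finset.sum_comm, ← Finset.sum_neg_distrib]
  congr 1
  refine Finset.sum_congr rfl fun i _ ↦ ?_
  rw [← Finset.sum_neg_distrib]
  refine Finset.sum_congr rfl fun j _ ↦ ?_
  rw [hS, smul_neg, mul_comm]

lemma adjRep_single (y : R4) (i : Fin 4) : adjRep c γ S y (stdR4 i) =
    (volRep c γ y)⁻¹ • ∑ l, metricMat c γ y l i • codiff c γ S l y := by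
  simp [adjRep, Pi.single_apply, ite_smul]

lemma raised_eq_zero {y : R4} (hS : S y = 0) (k l : Fin 4) : raised c γ S k l y = 0 := by
  simp [raised, hS]

lemma adjRep_eq_zero {y : R4} (hS : ∀ᶠ z in nhds y, S z = 0) : adjRep c γ S y = 0 := by
  have h1 : ∀ l, codiff c γ S l y = 0 := fun l ↦ by
    rw [codiff, neg_eq_zero]
    refine Finset.sum_eq_zero fun k _ ↦ ?_
    have h2 : raised c γ S k l =ᶠ[nhds y] fun _ ↦ 0 := by
      filter_upwards [hS] with z hz using raised_eq_zero hz k l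
    rw [h2.fderiv_eq, h2.self_of_nhds]
    simp
  simp [adjRep, h1]

lemma sum_comm₄ {ι : Type*} [Fintype ι] (f : ι → ι → ι → ι → ℝ) :
    ∑ i, ∑ j, ∑ k, ∑ l, f i j k l = ∑ k, ∑ l, ∑ i, ∑ j, f i j k l :=
  calc _ = ∑ i, ∑ k, ∑ j, ∑ l, f i j k l := Finset.sum_congr rfl fun _ _ ↦ Finset.sum_comm
    _ = ∑ k, ∑ i, ∑ j, ∑ l, f i j k l := Finset.sum_comm
    _ = ∑ k, ∑ i, ∑ l, ∑ j, f i j k l :=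
      Finset.sum_congr rfl fun _ _ ↦ Finset.sum_congr rfl fun _ _ ↦ Finset.sum_comm
    _ = _ := Finset.sum_congr rfl fun _ _ ↦ Finset.sum_comm

/-- The inner product of 2-forms, as a density, in terms of `raised`. -/
lemma volRep_mul_sum_dotProduct (c : ℝ) (γ : R4 → R4 →L[ℝ] (Fin 3 → ℝ))
    (S : R4 → R4 →ₗ[ℝ] R4 →ₗ[ℝ] (Fin 3 → ℝ)) (y : R4) (R : Fin 4 → Fin 4 → Fin 3 → ℝ) :
    volRep c γ y * ∑ i, ∑ j, ∑ k, ∑ l, (metricMat c γ y)⁻¹ i k * (metricMat c γ y)⁻¹ j l *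
      (S y (stdR4 i) (stdR4 j) ⬝ᵥ R k l) = ∑ k, ∑ l, raised c γ S k l y ⬝ᵥ R k l := by
  have h1 : ∀ k l, raised c γ S k l y ⬝ᵥ R k l = volRep c γ y * ∑ i, ∑ j,
      (metricMat c γ y)⁻¹ i k * (metricMat c γ y)⁻¹ j l * (S y (stdR4 i) (stdR4 j) ⬝ᵥ R k l) := by
    intro k l
    simp only [raised, smul_dotProduct, sum_dotProduct, smul_eq_mul]
  rw [sum_comm₄ fun i j k l ↦ (metricMat c γ y)⁻¹ i k * (metricMat c γ y)⁻¹ j l *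
    (S y (stdR4 i) (stdR4 j) ⬝ᵥ R k l), Finset.mul_sum]
  refine Finset.sum_congr rfl fun k _ ↦ ?_
  rw [Finset.mul_sum]
  exact Finset.sum_congr rfl fun l _ ↦ (h1 k l).symm

/-- The inner product of `adjRep` with a 1-form, as a density, in terms of `codiff`. -/
lemma volRep_mul_sum_adjRep {y : R4} (hv : volRep c γ y ≠ 0) (hg : IsUnit (metricMat c γ y).det)
    (a : Fin 4 → Fin 3 → ℝ) :
    volRep c γ y * ∑ i, ∑ j, (metricMat c γ y)⁻¹ i j * (adjRep c γ S y (stdR4 i) ⬝ᵥ a j) =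
      ∑ l, codiff c γ S l y ⬝ᵥ a l := by
  have h1 : ∀ l j, ∑ i, metricMat c γ y l i * (metricMat c γ y)⁻¹ i j = if l = j then 1 else 0 :=
    fun l j ↦ by rw [← Matrix.mul_apply, Matrix.mul_nonsing_inv _ hg, Matrix.one_apply]
  calc _ = volRep c γ y * ∑ i, ∑ j, (volRep c γ y)⁻¹ * ∑ l, (metricMat c γ y l i *
        (metricMat c γ y)⁻¹ i j) * (codiff c γ S l y ⬝ᵥ a j) := by
        congr 1
        refine Finset.sum_congr rfl fun i _ ↦ Finset.sum_congr rfl fun j _ ↦ ?_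
        rw [adjRep_single, smul_dotProduct, sum_dotProduct, smul_eq_mul, mul_left_comm,
          Finset.mul_sum]
        congr 1
        refine Finset.sum_congr rfl fun l _ ↦ ?_
        rw [smul_dotProduct, smul_eq_mul]
        ring
    _ = ∑ i, ∑ j, ∑ l, (metricMat c γ y l i *
        (metricMat c γ y)⁻¹ i j) * (codiff c γ S l y ⬝ᵥ a j) := by
        simp only [← Finset.mul_sum]
        rw [mul_inv_cancel_left₀ hv]
    _ = ∑ j, ∑ l, ∑ i, (metricMat c γ y l i *
        (metricMat c γ y)⁻¹ i j) * (codiff c γ S l y ⬝ᵥ a j) := by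
        rw [Finset.sum_comm]
        exact Finset.sum_congr rfl fun j _ ↦ Finset.sum_comm
    _ = _ := by
        simp only [← Finset.sum_mul, h1]
        simp

end Codifferential

section LocalAdjoint

open scoped Matrix

variable {X : Type*} [TopologicalSpace X] [ChartedSpace R4 X] [IsManifold (𝓡 4) ∞ X]
  {V : X → Type*} [TopologicalSpace (TotalSpace R3 V)]
  [∀ x, NormedAddCommGroup (V x)] [∀ x, InnerProductSpace ℝ (V x)]
  [FiberBundle R3 V] [VectorBundle ℝ R3 V]
  {p : X} {L : ChartFrame V p}
  [ContMDiffVectorBundle ∞ R3 V (𝓡 4)] [IsContMDiffRiemannianBundle (𝓡 4) ∞ R3 V]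
  {A : CovariantDerivative (𝓡 4) R3 V} {γ : R4 → R4 →L[ℝ] (Fin 3 → ℝ)} (h : L.IsConnRep A γ)
  (hA : IsDefinite A) {c : ℝ} (hc : 0 < c)
  {β : Π x : X, TangentSpace (𝓡 4) x → TangentSpace (𝓡 4) x → Module.End ℝ (V x)}
  (hβ : IsTwoForm β) [T2Space X]
include h hA hc

lemma ChartFrame.IsConnRep.volRep_pos {y : R4} (hy : y ∈ L.dom) : 0 < volRep c γ y :=
  mul_pos (abs_pos.mpr (by positivity)) (abs_pos.mpr (h.trace_ne_zero hy hA).1)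

lemma ChartFrame.IsConnRep.contDiffOn_raised (k l : Fin 4) :
    ContDiffOn ℝ ∞ (raised c γ (L.twoRep hβ) k l) L.dom :=
  (h.contDiffOn_abs_trace hA c).smul (ContDiffOn.sum fun i _ ↦ ContDiffOn.sum fun j _ ↦
    ((h.contDiffOn_metricMat_inv hA hc i k).mul (h.contDiffOn_metricMat_inv hA hc j l)).smul
      (L.contDiffOn_twoRep hβ _ _))

lemma ChartFrame.IsConnRep.contDiffOn_adjRep :
    ContDiffOn ℝ ∞ (adjRep c γ (L.twoRep hβ)) L.dom := by
  refine ((h.contDiffOn_abs_trace hA c).inv fun y hy ↦ (h.volRep_pos hA hc hy).ne').smul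
    (ContDiffOn.sum fun i _ ↦ (ContinuousLinearMap.smulRightL ℝ R4 (Fin 3 → ℝ)
      (EuclideanSpace.proj i)).contDiff.comp_contDiffOn (ContDiffOn.sum fun l _ ↦
        (h.contDiffOn_metricMat hA hc l i).smul (ContDiffOn.neg (ContDiffOn.sum fun k _ ↦ ?_))))
  have h1 := h.contDiffOn_raised hA hc hβ k l
  exact (contDiffOn_fderiv_apply L.isOpen_dom h1 _).add
    (contDiffOn_crossProduct (h.smooth.clm_apply contDiffOn_const) h1)

/-- In a chart, the difference of the two sides of the adjunction is a divergence. -/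
lemma ChartFrame.IsConnRep.inner₂_sub_inner₁ {α : OneForm V}
    (hα : ∀ y ∈ L.dom, L.oneRep α y = adjRep c γ (L.twoRep hβ) y) (a : OneForm V) {y : R4}
    (hy : y ∈ L.dom) :
    inner₂ c A β (covExtDeriv A a) ((extChartAt (𝓡 4) p).symm y) * volRep c γ y -
      inner₁ c A α a ((extChartAt (𝓡 4) p).symm y) * volRep c γ y =
      2 * c * ∑ k, ∑ l, fderiv ℝ (fun z ↦ raised c γ (L.twoRep hβ) k l z ⬝ᵥ L.oneRep a z (stdR4 l)) y
        (stdR4 k) := by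
  have e1 := volRep_mul_sum_dotProduct c γ (L.twoRep hβ) y
    fun k l ↦ extRep γ (L.oneRep a) y (stdR4 k) (stdR4 l)
  have e2 := volRep_mul_sum_adjRep (S := L.twoRep hβ) (h.volRep_pos hA hc hy).ne'
    (h.isUnit_metricMat hy hA hc) fun l ↦ L.oneRep a y (stdR4 l)
  have ha := (L.contDiffOn_oneRep a).contDiffAt (L.isOpen_dom.mem_nhds hy) |>.differentiableAt (by simp)
  have e3 : ∀ k l, fderiv ℝ (fun z ↦ raised c γ (L.twoRep hβ) k l z ⬝ᵥ L.oneRep a z (stdR4 l)) y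
      (stdR4 k) = fderiv ℝ (raised c γ (L.twoRep hβ) k l) y (stdR4 k) ⬝ᵥ L.oneRep a y (stdR4 l) +
        raised c γ (L.twoRep hβ) k l y ⬝ᵥ fderiv ℝ (L.oneRep a) y (stdR4 k) (stdR4 l) := by
    intro k l
    have h1 := (h.contDiffOn_raised hA hc hβ k l).contDiffAt (L.isOpen_dom.mem_nhds hy)
      |>.differentiableAt (by simp)
    have h2 := ha.hasFDerivAt.clm_apply (hasFDerivAt_const (stdR4 l) y)
    rw [(fderiv_dotProduct h1 h2.differentiableAt _).2, h2.fderiv]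
    simp
  have e4 := sum_dotProduct_extDeriv (raised_neg (c := c) (γ := γ) (L.twoRep_neg hβ y))
    (fun k l ↦ fderiv ℝ (raised c γ (L.twoRep hβ) k l) y (stdR4 k)) (fun k ↦ γ y (stdR4 k))
    (fun l ↦ L.oneRep a y (stdR4 l)) fun k l ↦ fderiv ℝ (L.oneRep a) y (stdR4 k) (stdR4 l)
  have e5 : ∑ i, ∑ j, (metricMat c γ y)⁻¹ i j *
      (2 * c * (L.oneRep α y (stdR4 i) ⬝ᵥ L.oneRep a y (stdR4 j))) = 2 * c * ∑ i, ∑ j,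
      (metricMat c γ y)⁻¹ i j * (adjRep c γ (L.twoRep hβ) y (stdR4 i) ⬝ᵥ L.oneRep a y (stdR4 j)) := by
    rw [hα y hy, Finset.mul_sum]
    refine Finset.sum_congr rfl fun i _ ↦ ?_
    rw [Finset.mul_sum]
    exact Finset.sum_congr rfl fun j _ ↦ by ring
  rw [h.inner₂_covExtDeriv hA hc hβ a hy, h.inner₁_eq hy hA hc, e5]
  simp only [e3]
  simp only [extRep] at e1
  rw [e4] at e1
  simp only [extRep]
  simp only [codiff] at e2
  linear_combination c * e1 - 2 * c * e2

open MeasureTheory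

include hβ in
/-- The adjoint on 2-forms with support in the domain of a frame. -/
lemma ChartFrame.IsConnRep.exists_isAdjointValue [CompactSpace X] {K : Set X} (hK : IsClosed K)
    (hKU : K ⊆ L.U) (h0 : ∀ x ∉ K, ∀ u v, β x u v = 0) : ∃ α, IsAdjointValue c A β α := by
  have hsupp : ∀ y ∈ L.dom, (extChartAt (𝓡 4) p).symm y ∉ K →
      ∀ᶠ z in nhds y, L.twoRep hβ z = 0 := by
    intro y hy hyK
    filter_upwards [L.eventually_symm hy (hK.isOpen_compl.mem_nhds hyK)] with z hz
    ext1 u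
    ext1 v
    rw [L.twoRep_apply, h0 _ hz.2]
    exact map_zero _
  obtain ⟨α, hα, hα0⟩ := L.exists_oneForm (h.contDiffOn_adjRep hA hc hβ) hK hKU
    fun y hy hyK ↦ adjRep_eq_zero (hsupp y hy hyK)
  refine ⟨α, fun a ↦ ?_⟩
  have hKc : IsCompact K := hK.isCompact
  have d1 := isContDensity_inner₁ hA hc α a
  have d2 := isContDensity_inner₂ hA hc hβ a
  have z1 : ∀ x ∉ K, inner₁ c A α a x = 0 := fun x hx ↦ by
    have : ∀ u, α.endo x u = 0 := fun u ↦ LinearMap.ext fun s ↦ by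
      change α.toFun x s u = 0
      rw [hα0 x hx]
      rfl
    simp [inner₁, this, soInner]
  have z2 : ∀ x ∉ K, inner₂ c A β (covExtDeriv A a) x = 0 := fun x hx ↦ by
    simp [inner₂, h0 x hx, soInner]
  have hKp : K ⊆ (chartAt R4 p).source := hKU.trans L.subset
  rw [innerL2, integral, integral,
    d1.integral_eq_chart p hKc hKp fun x hx ↦ funext fun v ↦ by rw [z1 x hx, zero_mul]; rfl,
    d2.integral_eq_chart p hKc hKp fun x hx ↦ funext fun v ↦ by rw [z2 x hx, zero_mul]; rfl]
  have hKp' : K ⊆ (extChartAt (𝓡 4) p).source := by simpa using hKp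
  set K' := extChartAt (𝓡 4) p '' K with hK'
  have hK'c : IsCompact K' := hKc.image_of_continuousOn ((continuousOn_extChartAt p).mono hKp')
  have hK'dom : K' ⊆ L.dom := by
    rintro _ ⟨x, hx, rfl⟩
    exact (L.exists_dom (hKU hx)).1
  have hmem : ∀ y ∈ (extChartAt (𝓡 4) p).target, y ∉ K' → (extChartAt (𝓡 4) p).symm y ∉ K :=
    fun y hy hyK h ↦ hyK ⟨_, h, (extChartAt (𝓡 4) p).right_inv hy⟩
  have hres : ∀ f : R4 → ℝ, (∀ y ∈ (extChartAt (𝓡 4) p).target, y ∉ K' → f y = 0) →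
      ∫ y in (extChartAt (𝓡 4) p).target, f y = ∫ y in L.dom, f y := fun f hf ↦
    setIntegral_eq_of_subset_of_forall_sdiff_eq_zero (isOpen_extChartAt_target p).measurableSet
      Set.inter_subset_left fun y hy ↦ hf y hy.1 fun hk ↦ hy.2 (hK'dom hk)
  have hr1 : ∀ y ∈ (extChartAt (𝓡 4) p).target, y ∉ K' →
      densRep p (fun x v ↦ inner₁ c A α a x * |volForm c A x v|) y = 0 := fun y hy hyK ↦ by
    rw [densRep, z1 _ (hmem y hy hyK), zero_mul]
  have hr2 : ∀ y ∈ (extChartAt (𝓡 4) p).target, y ∉ K' →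
      densRep p (fun x v ↦ inner₂ c A β (covExtDeriv A a) x * |volForm c A x v|) y = 0 :=
    fun y hy hyK ↦ by rw [densRep, z2 _ (hmem y hy hyK), zero_mul]
  -- Both integrals are over the domain of the frame, and the difference of the integrands is a
  -- divergence.
  rw [hres _ hr1, hres _ hr2, eq_comm, ← sub_eq_zero]
  have hint : ∀ f : R4 → ℝ, ContinuousOn f L.dom → (∀ y ∈ L.dom, y ∉ K' → f y = 0) →
      IntegrableOn f L.dom := fun f hf hf0 ↦
    integrableOn_of_continuousOn_of_compact hK'c hK'dom L.isOpen_dom.measurableSet hf hf0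
  rw [← integral_sub (hint _ ((d2.cont p).mono Set.inter_subset_left) fun y hy ↦ hr2 y hy.1)
    (hint _ ((d1.cont p).mono Set.inter_subset_left) fun y hy ↦ hr1 y hy.1)]
  let W : Fin 4 → Fin 4 → R4 → ℝ :=
    fun k l z ↦ raised c γ (L.twoRep hβ) k l z ⬝ᵥ L.oneRep a z (stdR4 l)
  have hW : ∀ k l, ContDiffOn ℝ ∞ (W k l) L.dom := fun k l ↦
    contDiffOn_dotProduct (h.contDiffOn_raised hA hc hβ k l)
      ((L.contDiffOn_oneRep a).clm_apply contDiffOn_const)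
  have hW0 : ∀ k l, ∀ y ∈ L.dom, y ∉ K' → ∀ᶠ z in nhds y, W k l z = 0 := fun k l y hy hyK ↦ by
    filter_upwards [hsupp y hy (hmem y hy.1 hyK)] with z hz
    simp only [W, raised_eq_zero hz, zero_dotProduct]
  have hW' : ∀ k l, ∀ y ∈ L.dom, y ∉ K' → fderiv ℝ (W k l) y (stdR4 k) = 0 := fun k l y hy hyK ↦ by
    have : W k l =ᶠ[nhds y] fun _ ↦ 0 := hW0 k l y hy hyK
    rw [this.fderiv_eq]
    simp
  have hWi : ∀ k l, IntegrableOn (fun y ↦ fderiv ℝ (W k l) y (stdR4 k)) L.dom := fun k l ↦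
    hint _ (contDiffOn_fderiv_apply L.isOpen_dom (hW k l) _).continuousOn (hW' k l)
  calc _ = ∫ y in L.dom, 2 * c * ∑ k, ∑ l, fderiv ℝ (W k l) y (stdR4 k) := by
        refine setIntegral_congr_fun L.isOpen_dom.measurableSet fun y hy ↦ ?_
        simp only [densRep]
        rw [h.volForm_eq hy, abs_mul]
        exact h.inner₂_sub_inner₁ hA hc hβ hα a hy
    _ = 0 := by
        rw [integral_const_mul, integral_finsetSum _ fun k _ ↦ integrable_finsetSum _ fun l _ ↦ hWi k l]
        simp only [integral_finsetSum _ fun l _ ↦ hWi _ l]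
        simp only [setIntegral_fderiv_eq_zero L.isOpen_dom hK'c hK'dom (hW _ _)
          fun y hy hyK ↦ (hW0 _ _ y hy hyK).self_of_nhds]
        simp

end LocalAdjoint

section Linear

variable {W : Type*} [AddCommGroup W] [Module ℝ W]

lemma soInner_add_left (c : ℝ) (ξ ξ' η : Module.End ℝ W) :
    soInner c (ξ + ξ') η = soInner c ξ η + soInner c ξ' η := by
  simp only [soInner, add_mul, map_add, mul_add]

lemma soInner_smul_left (c r : ℝ) (ξ η : Module.End ℝ W) :
    soInner c (r • ξ) η = r * soInner c ξ η := by
  simp only [soInner, smul_mul_assoc, map_smul, smul_eq_mul]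
  ring

variable {X : Type*} [TopologicalSpace X] [ChartedSpace R4 X] [IsManifold (𝓡 4) ∞ X]
  {V : X → Type*} [TopologicalSpace (TotalSpace R3 V)]
  [∀ x, NormedAddCommGroup (V x)] [∀ x, InnerProductSpace ℝ (V x)]
  [FiberBundle R3 V] [VectorBundle ℝ R3 V]

lemma inner₂_add_left (c : ℝ) (A : CovariantDerivative (𝓡 4) R3 V)
    (β β' T : Π x : X, TangentSpace (𝓡 4) x → TangentSpace (𝓡 4) x → Module.End ℝ (V x)) (x : X) :
    inner₂ c A (fun x u v ↦ β x u v + β' x u v) T x = inner₂ c A β T x + inner₂ c A β' T x := by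
  simp only [inner₂, soInner_add_left, mul_add, Finset.sum_add_distrib]

lemma inner₂_smul_left (c : ℝ) (A : CovariantDerivative (𝓡 4) R3 V) (f : X → ℝ)
    (β T : Π x : X, TangentSpace (𝓡 4) x → TangentSpace (𝓡 4) x → Module.End ℝ (V x)) (x : X) :
    inner₂ c A (fun x u v ↦ f x • β x u v) T x = f x * inner₂ c A β T x := by
  simp only [inner₂, soInner_smul_left, mul_left_comm _ (f x), ← Finset.mul_sum]

variable [ContMDiffVectorBundle ∞ R3 V (𝓡 4)] [IsContMDiffRiemannianBundle (𝓡 4) ∞ R3 V]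

lemma inner₁_addSMul_left (c : ℝ) (A : CovariantDerivative (𝓡 4) R3 V) (a a' b : OneForm V) (r : ℝ)
    (x : X) : inner₁ c A (a.addSMul a' r) b x = inner₁ c A a b x + r * inner₁ c A a' b x := by
  have h : ∀ u, (a.addSMul a' r).endo x u = a.endo x u + r • a'.endo x u := fun u ↦ rfl
  simp only [inner₁, h, soInner_add_left, soInner_smul_left, mul_add, Finset.sum_add_distrib,
    mul_left_comm _ r, ← Finset.mul_sum]

end Linear

section Global

variable {X : Type*} [TopologicalSpace X] [ChartedSpace R4 X] [IsManifold (𝓡 4) ∞ X]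
  {V : X → Type*} [TopologicalSpace (TotalSpace R3 V)]
  [∀ x, NormedAddCommGroup (V x)] [∀ x, InnerProductSpace ℝ (V x)]
  [FiberBundle R3 V] [VectorBundle ℝ R3 V]
  [ContMDiffVectorBundle ∞ R3 V (𝓡 4)] [IsContMDiffRiemannianBundle (𝓡 4) ∞ R3 V]
  [T2Space X] {A : CovariantDerivative (𝓡 4) R3 V} (hA : IsDefinite A) {c : ℝ} (hc : 0 < c)
  {β β' : Π x : X, TangentSpace (𝓡 4) x → TangentSpace (𝓡 4) x → Module.End ℝ (V x)}
include hA hc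

variable [CompactSpace X]

lemma innerL2_addSMul_left (a a' b : OneForm V) (r : ℝ) :
    innerL2 c A (a.addSMul a' r) b = innerL2 c A a b + r * innerL2 c A a' b := by
  have h1 := (isContDensity_inner₁ hA hc a b).cont
  have h2 := (isContDensity_inner₁ hA hc a' b).cont
  have h3 : r * innerL2 c A a' b = integrateDensity fun x v ↦
      r * (inner₁ c A a' b x * |volForm c A x v|) := by
    rw [innerL2, integral, integrateDensity_eq_sum, integrateDensity_eq_sum, Finset.mul_sum]
    refine Finset.sum_congr rfl fun p _ ↦ ?_
    rw [← MeasureTheory.integral_const_mul]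
    simp only [densRep, mul_left_comm r]
  have h4 : ∀ p, ContinuousOn (densRep p fun x v ↦ r * (inner₁ c A a' b x * |volForm c A x v|))
      (extChartAt (𝓡 4) p).target := fun p ↦ continuousOn_const.mul (h2 p)
  rw [h3, innerL2, innerL2, integral, integral, ← integrateDensity_add h1 h4]
  simp only [inner₁_addSMul_left, add_mul, mul_assoc]

lemma exists_isAdjointValue_add (hβ : IsTwoForm β) (hβ' : IsTwoForm β')
    (h : ∃ α, IsAdjointValue c A β α) (h' : ∃ α, IsAdjointValue c A β' α) :
    ∃ α, IsAdjointValue c A (fun x u v ↦ β x u v + β' x u v) α := by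
  obtain ⟨α, hα⟩ := h
  obtain ⟨α', hα'⟩ := h'
  refine ⟨α.addSMul α' 1, fun a ↦ ?_⟩
  rw [innerL2_addSMul_left hA hc, hα, hα', one_mul, integral, integral, integral,
    ← integrateDensity_add (isContDensity_inner₂ hA hc hβ a).cont
      (isContDensity_inner₂ hA hc hβ' a).cont]
  simp only [inner₂_add_left, add_mul]

/-- The adjoint of `d_A` exists: the partition of unity splits a 2-form into a sum of 2-forms with
support in the domains of frames. -/
lemma exists_isAdjointValue (hβ : IsTwoForm β) : ∃ α, IsAdjointValue c A β α := by
  choose L hL using fun x : X ↦ exists_chartFrame (V := V) x x (mem_chart_source R4 x)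
  obtain ⟨σ, hσ⟩ := SmoothPartitionOfUnity.exists_isSubordinate (𝓡 4) (s := Set.univ) isClosed_univ
    (fun x ↦ (L x).U) (fun x ↦ (L x).isOpen) fun x _ ↦ Set.mem_iUnion.mpr ⟨x, hL x⟩
  have key : ∀ s : Finset X, ∃ α, IsAdjointValue c A (fun x u v ↦ (∑ i ∈ s, σ i x) • β x u v) α := by
    classical
    intro s
    induction s using Finset.induction_on with
    | empty =>
      -- The zero form is written as `a₀ - a₀`.
      obtain ⟨a₀⟩ := (inferInstance : Nonempty (OneForm V))
      refine ⟨a₀.addSMul a₀ (-1), fun a ↦ ?_⟩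
      rw [innerL2_addSMul_left hA hc, integral]
      simp only [inner₂_smul_left, Finset.sum_empty, zero_mul, integrateDensity, mul_zero,
        MeasureTheory.integral_zero, finsum_zero, neg_mul, one_mul, add_neg_cancel]
    | insert i s hi ih =>
      have hs : IsTwoForm fun x u v ↦ (∑ i ∈ s, σ i x) • β x u v :=
        hβ.smul_form (ContMDiff.sum fun i _ ↦ (σ i).contMDiff)
      obtain ⟨γ, h⟩ := (L i).exists_isConnRep hA.metric hA.smooth
      have h1 := h.exists_isAdjointValue hA hc (hβ.smul_form (σ i).contMDiff)
        (isClosed_tsupport (σ i)) (hσ i) fun x hx u v ↦ by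
          rw [image_eq_zero_of_notMem_tsupport hx, zero_smul]
      have h2 := exists_isAdjointValue_add hA hc (hβ.smul_form (σ i).contMDiff) hs h1 ih
      simpa only [Finset.sum_insert hi, add_smul] using h2
  have hfin := σ.locallyFinite.finite_nonempty_of_compact
  have hsum : ∀ x, ∑ i ∈ hfin.toFinset, σ i x = 1 := fun x ↦ by
    rw [← σ.sum_eq_one (Set.mem_univ x)]
    refine (finsum_eq_sum_of_support_subset _ fun i hi ↦ ?_).symm
    simp only [Set.Finite.coe_toFinset, Set.mem_ofPred_eq]
    exact ⟨x, hi⟩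
  simpa only [hsum, one_smul] using key hfin.toFinset

lemma isAdjointValue_dAdjoint (hβ : IsTwoForm β) : IsAdjointValue c A β (dAdjoint c A β) :=
  Classical.epsilon_spec (exists_isAdjointValue hA hc hβ)

end Global

/-! ### The derivative of the energy -/

section Parametric

open MeasureTheory

/-- Differentiation under the integral sign for integrands with support in a fixed compact set. -/
lemma hasDerivAt_setIntegral_mul {D K : Set R4} (hD : MeasurableSet D) (hK : IsCompact K)
    (hKD : K ⊆ D) {ρ : R4 → ℝ} (hρ : ContinuousOn ρ K) (h0 : ∀ y ∈ D, y ∉ K → ρ y = 0)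
    {E : ℝ × R4 → ℝ} (hE : ∀ y ∈ K, ContDiffAt ℝ 1 E (0, y)) {E' : R4 → ℝ}
    (hE' : ∀ y ∈ K, HasDerivAt (fun t ↦ E (t, y)) (E' y) 0) :
    HasDerivAt (fun t ↦ ∫ y in D, ρ y * E (t, y)) (∫ y in D, ρ y * E' y) 0 := by
  -- The integrals are over the compact set `K`, where continuity of the derivative in `(t, y)` gives a
  -- bound which is uniform in `t`.
  have hres : ∀ f : R4 → ℝ, ∫ y in D, ρ y * f y = ∫ y in K, ρ y * f y := fun f ↦
    setIntegral_eq_of_subset_of_forall_sdiff_eq_zero hD hKD fun y hy ↦ by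
      rw [h0 y hy.1 hy.2, zero_mul]
  rw [hres E', funext fun t ↦ hres fun y ↦ E (t, y)]
  have hev : ∀ᶠ t : ℝ in nhds 0, ∀ y ∈ K, ContDiffAt ℝ 1 E (t, y) :=
    hK.eventually_forall_of_forall_eventually fun y hy ↦ (hE y hy).eventually (by simp)
  obtain ⟨ε, hε, hball⟩ := Metric.eventually_nhds_iff_ball.mp hev
  have hd : ∀ t ∈ Metric.ball (0 : ℝ) ε, ∀ y ∈ K,
      HasDerivAt (fun t ↦ E (t, y)) (fderiv ℝ E (t, y) (1, 0)) t := fun t ht y hy ↦ by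
    have h1 := ((hball t ht y hy).differentiableAt one_ne_zero).hasFDerivAt
    have h2 : HasDerivAt (fun t : ℝ ↦ (t, y)) ((1 : ℝ), (0 : R4)) t :=
      (hasDerivAt_id t).prodMk (hasDerivAt_const t y)
    exact h1.comp_hasDerivAt t h2
  have hcont : ContinuousOn (fun z ↦ fderiv ℝ E z (1, 0)) (Metric.closedBall 0 (ε / 2) ×ˢ K) := by
    rintro ⟨t, y⟩ ⟨ht, hy⟩
    have ht' : t ∈ Metric.ball (0 : ℝ) ε :=
      Metric.closedBall_subset_ball (by linarith) ht
    have h1 := (hball t ht' y hy).fderiv_right (m := 0) (by norm_num)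
    exact (h1.continuousAt.clm_apply continuousAt_const).continuousWithinAt
  obtain ⟨C, hC⟩ := ((isCompact_closedBall (0 : ℝ) (ε / 2)).prod hK).exists_bound_of_continuousOn hcont
  obtain ⟨C', hC'⟩ := hK.exists_bound_of_continuousOn hρ
  have hEc : ∀ t ∈ Metric.ball (0 : ℝ) ε, ContinuousOn (fun y ↦ ρ y * E (t, y)) K := fun t ht ↦
    hρ.mul fun y hy ↦ ((hball t ht y hy).continuousAt.comp
      (Continuous.prodMk_right t).continuousAt).continuousWithinAt
  have h0ε : (0 : ℝ) ∈ Metric.ball (0 : ℝ) ε := Metric.mem_ball_self hε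
  have h0ε' : (0 : ℝ) ∈ Metric.closedBall (0 : ℝ) (ε / 2) := Metric.mem_closedBall_self (by linarith)
  have hE'c : ContinuousOn (fun y ↦ ρ y * fderiv ℝ E (0, y) (1, 0)) K :=
    hρ.mul (hcont.comp (by fun_prop) fun y hy ↦ ⟨h0ε', hy⟩)
  have hmain := hasDerivAt_integral_of_dominated_loc_of_deriv_le (μ := volume.restrict K)
    (F := fun t y ↦ ρ y * E (t, y)) (F' := fun t y ↦ ρ y * fderiv ℝ E (t, y) (1, 0))
    (bound := fun _ ↦ C' * C) (Metric.ball_mem_nhds (0 : ℝ) (half_pos hε))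
    (Filter.mem_of_superset (Metric.ball_mem_nhds _ hε) fun t ht ↦
      (hEc t ht).aestronglyMeasurable hK.measurableSet)
    ((hEc 0 h0ε).integrableOn_compact hK) (hE'c.aestronglyMeasurable hK.measurableSet)
    ((ae_restrict_iff' hK.measurableSet).mpr (ae_of_all _ fun y hy t ht ↦ ?_))
    (by
      have : IsFiniteMeasure (volume.restrict K) := ⟨by simpa using hK.measure_lt_top⟩
      exact integrable_const _)
    ((ae_restrict_iff' hK.measurableSet).mpr (ae_of_all _ fun y hy t ht ↦
      (hd t (Metric.ball_subset_ball (by linarith) ht) y hy).const_mul (ρ y)))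
  · refine hmain.2.congr_deriv (setIntegral_congr_fun hK.measurableSet fun y hy ↦ ?_)
    simp only [(hE' y hy).unique (hd 0 h0ε y hy)]
  · rw [norm_mul]
    exact mul_le_mul (hC' y hy) (hC (t, y) ⟨Metric.ball_subset_closedBall ht, hy⟩) (norm_nonneg _)
      ((norm_nonneg _).trans (hC' y hy))

end Parametric

section Variation

open scoped Matrix

variable {T : Type*}

/-- The matrix of the 4-forms `Fᵢ ∧ Gⱼ`. -/
def mixedMatrix (F G : T → T → Fin 3 → ℝ) (v : Fin 4 → T) : Matrix (Fin 3) (Fin 3) ℝ :=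
  Matrix.of fun i j ↦ wedge (fun x y : ℝ ↦ x * y) (fun a b ↦ F a b i) (fun a b ↦ G a b j) v

lemma wedgeMatrix_comm (F : T → T → Fin 3 → ℝ) (v : Fin 4 → T) (i j : Fin 3) :
    wedgeMatrix F v i j = wedgeMatrix F v j i := by
  simp only [wedgeMatrix, Matrix.of_apply, wedge]
  ring

lemma wedge_mulVec_eq_sum (B : Matrix (Fin 3) (Fin 3) ℝ) (F G : T → T → Fin 3 → ℝ) (v : Fin 4 → T) :
    wedge (fun x y : Fin 3 → ℝ ↦ x ⬝ᵥ y) (fun a b ↦ B *ᵥ F a b) G v =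
      ∑ i, ∑ j, B i j * mixedMatrix F G v j i := by
  simp only [mixedMatrix, Matrix.of_apply, wedge, dotProduct, Matrix.mulVec, Fin.sum_univ_three]
  ring

/-- The derivative of `6 tr(M²) / tr M` along a variation `G` of `F` is twice the right-hand side, for `M`
the matrix of the 4-forms `Fᵢ ∧ Fⱼ`. This is the origin of the coefficients of `B_A`. -/
lemma wedge_bMat_eq (M : Matrix (Fin 3) (Fin 3) ℝ) (F G : T → T → Fin 3 → ℝ) (v : Fin 4 → T) :
    wedge (fun x y : Fin 3 → ℝ ↦ x ⬝ᵥ y) (fun a b ↦ bMat M *ᵥ F a b) G v =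
      12 / M.trace * ∑ i, ∑ j, M i j * mixedMatrix F G v j i -
        6 * (M * M).trace / M.trace ^ 2 * (mixedMatrix F G v).trace := by
  have h1 : (qMat M * qMat M).trace = 9 / M.trace ^ 2 * (M * M).trace := by
    simp only [qMat, Matrix.smul_mul, Matrix.mul_smul, Matrix.trace_smul, smul_eq_mul]
    ring
  have h2 : ∑ i, (mixedMatrix F G v) i i = (mixedMatrix F G v).trace := rfl
  rw [wedge_mulVec_eq_sum, bMat, h1]
  simp only [Matrix.sub_apply, Matrix.smul_apply, qMat, smul_eq_mul, Matrix.one_apply,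
    sub_mul, Finset.sum_sub_distrib, mul_ite, ite_mul, mul_one, mul_zero, zero_mul,
    Finset.sum_ite_eq, Finset.mem_univ, if_true, mul_assoc, ← Finset.mul_sum, h2]
  ring

variable (F d q : T → T → Fin 3 → ℝ) (v : Fin 4 → T)

lemma hasDerivAt_wedgeMatrix (i j : Fin 3) :
    HasDerivAt (fun t : ℝ ↦ wedgeMatrix (fun a b ↦ F a b + t • d a b + t ^ 2 • q a b) v i j)
      (mixedMatrix F d v i j + mixedMatrix F d v j i) 0 := by
  have e : ∀ a b k, HasDerivAt (fun t : ℝ ↦ F a b k + t * d a b k + t ^ 2 * q a b k) (d a b k) 0 := by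
    intro a b k
    have h1 := (((hasDerivAt_id (0 : ℝ)).mul_const (d a b k)).const_add (F a b k)).add
      (((hasDerivAt_id (0 : ℝ)).pow 2).mul_const (q a b k))
    exact h1.congr_deriv (by simp)
  have h := ((((((e (v 0) (v 1) i).mul (e (v 2) (v 3) j)).sub ((e (v 0) (v 2) i).mul (e (v 1) (v 3) j))).add
    ((e (v 0) (v 3) i).mul (e (v 1) (v 2) j))).add ((e (v 1) (v 2) i).mul (e (v 0) (v 3) j))).sub
    ((e (v 1) (v 3) i).mul (e (v 0) (v 2) j))).add ((e (v 2) (v 3) i).mul (e (v 0) (v 1) j))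
  refine h.congr_deriv ?_
  simp only [mixedMatrix, Matrix.of_apply, wedge]
  ring

lemma wedgeMatrix_add_zero :
    wedgeMatrix (fun a b ↦ F a b + (0 : ℝ) • d a b + (0 : ℝ) ^ 2 • q a b) v = wedgeMatrix F v := by
  simp

/-- The variation of the density `|Q|² |μ|`. -/
lemma hasDerivAt_trace_sq_div_abs_trace (htr : (wedgeMatrix F v).trace ≠ 0) (c : ℝ) :
    HasDerivAt (fun t : ℝ ↦
      6 * c * ((wedgeMatrix (fun a b ↦ F a b + t • d a b + t ^ 2 • q a b) v *
        wedgeMatrix (fun a b ↦ F a b + t • d a b + t ^ 2 • q a b) v).trace /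
          |(wedgeMatrix (fun a b ↦ F a b + t • d a b + t ^ 2 • q a b) v).trace|))
      (2 * c * (SignType.sign (wedgeMatrix F v).trace *
        wedge (fun x y : Fin 3 → ℝ ↦ x ⬝ᵥ y) (fun a b ↦ bMat (wedgeMatrix F v) *ᵥ F a b) d v)) 0 := by
  set N : ℝ → Matrix (Fin 3) (Fin 3) ℝ :=
    fun t ↦ wedgeMatrix (fun a b ↦ F a b + t • d a b + t ^ 2 • q a b) v
  set M := wedgeMatrix F v with hM
  set P := mixedMatrix F d v
  have hN0 : N 0 = M := wedgeMatrix_add_zero F d q v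
  have hN : ∀ i j, HasDerivAt (fun t ↦ N t i j) (P i j + P j i) 0 := hasDerivAt_wedgeMatrix F d q v
  have h1 : HasDerivAt (fun t ↦ (N t).trace) (2 * P.trace) 0 := by
    refine (HasDerivAt.fun_sum fun i _ ↦ hN i i).congr_deriv ?_
    simp only [Matrix.trace, Matrix.diag, Fin.sum_univ_three]
    ring
  have h2 : HasDerivAt (fun t ↦ (N t * N t).trace) (4 * ∑ i, ∑ j, M i j * P j i) 0 := by
    have e : (fun t ↦ (N t * N t).trace) = fun t ↦ ∑ i, ∑ j, N t i j * N t j i := rfl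
    rw [e]
    refine (HasDerivAt.fun_sum fun i _ ↦ HasDerivAt.fun_sum fun j _ ↦
      (hN i j).fun_mul (hN j i)).congr_deriv ?_
    simp only [hN0, Fin.sum_univ_three, wedgeMatrix_comm F v 1 0, wedgeMatrix_comm F v 2 0,
      wedgeMatrix_comm F v 2 1, hM]
    ring
  have h3 : HasDerivAt (fun t ↦ |(N t).trace|) (SignType.sign M.trace * (2 * P.trace)) 0 := by
    have := (hasDerivAt_abs (x := (N 0).trace) (by rw [hN0]; exact htr)).comp (0 : ℝ) h1
    rwa [hN0] at this
  refine ((h2.div h3 (by rw [hN0]; exact abs_ne_zero.mpr htr)).const_mul (6 * c)).congr_deriv ?_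
  rw [wedge_bMat_eq, hN0]
  generalize (∑ i, ∑ j, M i j * P j i) = s
  generalize (M * M).trace = m
  change _ = 2 * c * (_ * (12 / M.trace * s - 6 * m / M.trace ^ 2 * P.trace))
  generalize P.trace = r
  generalize M.trace = τ at htr
  rcases lt_or_gt_of_ne htr with h | h
  · rw [sign_neg h, abs_of_neg h]
    simp only [SignType.coe_neg_one]
    field_simp
    ring
  · rw [sign_pos h, abs_of_pos h]
    simp only [SignType.coe_one]
    field_simp
    ring

end Variation

section EnergyDensity

open scoped Matrix

variable {X : Type*} [TopologicalSpace X] [ChartedSpace R4 X] [IsManifold (𝓡 4) ∞ X]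
  {V : X → Type*} [TopologicalSpace (TotalSpace R3 V)]
  [∀ x, NormedAddCommGroup (V x)] [∀ x, InnerProductSpace ℝ (V x)]
  [FiberBundle R3 V] [VectorBundle ℝ R3 V]
  {p : X} {L : ChartFrame V p}
  [ContMDiffVectorBundle ∞ R3 V (𝓡 4)] [IsContMDiffRiemannianBundle (𝓡 4) ∞ R3 V]
  {A : CovariantDerivative (𝓡 4) R3 V} {γ : R4 → R4 →L[ℝ] (Fin 3 → ℝ)} (h : L.IsConnRep A γ)
  (hA : IsDefinite A) {c : ℝ} (hc : 0 < c)

/-- The density `|Q|² |μ|` of the energy. -/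
noncomputable def energyDensity (c : ℝ) (A : CovariantDerivative (𝓡 4) R3 V) (x : X)
    (v : Fin 4 → TangentSpace (𝓡 4) x) : ℝ :=
  normSqQ c A x * |volForm c A x v|

/-- The curvature of `d + (γ + t α) ×` as a polynomial in `t`. -/
noncomputable def curvPoly (γ α : R4 → R4 →L[ℝ] (Fin 3 → ℝ)) (t : ℝ) (y u v : R4) : Fin 3 → ℝ :=
  curvRep γ y u v + t • extRep γ α y u v + t ^ 2 • (α y u ⨯₃ α y v)

include h

lemma ChartFrame.IsConnRep.curvMat_add (a : OneForm V) {y : R4} (hy : y ∈ L.dom) (t : ℝ) :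
    curvMat (γ + t • L.oneRep a) y = wedgeMatrix (curvPoly γ (L.oneRep a) t y) stdR4 := by
  have hd : ∀ {f : R4 → R4 →L[ℝ] (Fin 3 → ℝ)}, ContDiffOn ℝ ∞ f L.dom → DifferentiableAt ℝ f y :=
    fun hf ↦ (hf.contDiffAt (L.isOpen_dom.mem_nhds hy)).differentiableAt (by simp)
  refine congrArg (fun F ↦ wedgeMatrix F stdR4) (funext fun u ↦ funext fun v ↦ ?_)
  exact curvRep_add (hd h.smooth) (hd (L.contDiffOn_oneRep a)) t u v

include hc

/-- In a chart the energy density is `6c tr(M²) / |tr M|`, with `M` the matrix of the 4-forms `Fᵢ ∧ Fⱼ`. -/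
lemma ChartFrame.IsConnRep.densRep_energyDensity (a : OneForm V) {y : R4} (hy : y ∈ L.dom) (t : ℝ) :
    densRep p (energyDensity c (DefiniteConnection.addForm A t a)) y =
      6 * c * ((wedgeMatrix (curvPoly γ (L.oneRep a) t y) stdR4 *
        wedgeMatrix (curvPoly γ (L.oneRep a) t y) stdR4).trace /
          |(wedgeMatrix (curvPoly γ (L.oneRep a) t y) stdR4).trace|) := by
  rw [densRep, energyDensity, (h.addForm t a).normSqQ_eq hy hc.ne', (h.addForm t a).volForm_eq hy,
    h.curvMat_add a hy, abs_mul, abs_of_pos (show 0 < 2 * c / 3 by positivity)]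
  generalize wedgeMatrix (curvPoly γ (L.oneRep a) t y) stdR4 = M
  simp only [qMat, Matrix.smul_mul, Matrix.mul_smul, Matrix.trace_smul, smul_eq_mul]
  by_cases h0 : M.trace = 0
  · simp [h0]
  · have h1 : |M.trace| ≠ 0 := abs_ne_zero.mpr h0
    have h2 : M.trace ^ 2 = |M.trace| ^ 2 := (sq_abs _).symm
    field_simp
    rw [h2]
    ring

include hA

lemma ChartFrame.IsConnRep.contDiffAt_densRep_energyDensity (a : OneForm V) {y : R4}
    (hy : y ∈ L.dom) : ContDiffAt ℝ 1 (fun z : ℝ × R4 ↦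
      densRep p (energyDensity c (DefiniteConnection.addForm A z.1 a)) z.2) (0, y) := by
  have hcomp : ∀ {f : R4 → Fin 3 → ℝ}, ContDiffOn ℝ ∞ f L.dom →
      ContDiffOn ℝ ∞ (fun z : ℝ × R4 ↦ f z.2) (Set.univ ×ˢ L.dom) := fun hf ↦
    hf.comp contDiffOn_snd fun z hz ↦ hz.2
  have hα := L.contDiffOn_oneRep a
  have hF : ∀ u v, ContDiffOn ℝ ∞ (fun z : ℝ × R4 ↦ curvPoly γ (L.oneRep a) z.1 z.2 u v)
      (Set.univ ×ˢ L.dom) := fun u v ↦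
    ((hcomp (contDiffOn_curvRep L.isOpen_dom h.smooth u v)).add
      (contDiffOn_fst.smul (hcomp (contDiffOn_extRep L.isOpen_dom h.smooth hα u v)))).add
      ((contDiffOn_fst.pow 2).smul (hcomp (contDiffOn_crossProduct
        (hα.clm_apply contDiffOn_const) (hα.clm_apply contDiffOn_const))))
  have hM := fun i j ↦ contDiffOn_wedgeMatrix (v := stdR4) hF i j
  have ho : IsOpen ((Set.univ : Set ℝ) ×ˢ L.dom) := isOpen_univ.prod L.isOpen_dom
  have hmem : ((0 : ℝ), y) ∈ (Set.univ : Set ℝ) ×ˢ L.dom := ⟨trivial, hy⟩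
  have htr := (contDiffOn_trace hM).contDiffAt (ho.mem_nhds hmem)
  have hsq := (contDiffOn_trace (contDiffOn_mul_apply hM hM)).contDiffAt (ho.mem_nhds hmem)
  have h0 : (wedgeMatrix (curvPoly γ (L.oneRep a) 0 y) stdR4).trace ≠ 0 := by
    rw [← h.curvMat_add a hy, zero_smul, add_zero]
    exact (h.trace_ne_zero hy hA).1
  refine ContDiffAt.congr_of_eventuallyEq (ContDiffAt.of_le ?_ (m := 1) (n := ∞) (by norm_cast))
    (f := fun z : ℝ × R4 ↦ 6 * c * ((wedgeMatrix (curvPoly γ (L.oneRep a) z.1 z.2) stdR4 *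
        wedgeMatrix (curvPoly γ (L.oneRep a) z.1 z.2) stdR4).trace /
          |(wedgeMatrix (curvPoly γ (L.oneRep a) z.1 z.2) stdR4).trace|)) ?_
  · exact contDiffAt_const.mul (hsq.div (htr.abs h0) (abs_ne_zero.mpr h0))
  · filter_upwards [ho.mem_nhds hmem] with z hz using h.densRep_energyDensity hc a hz.2 z.1

/-- The first variation of the energy density is the pairing of `B_A(F_A)` with `d_A a`. -/
lemma ChartFrame.IsConnRep.hasDerivAt_densRep_energyDensity (a : OneForm V) {y : R4}
    (hy : y ∈ L.dom) :
    HasDerivAt (fun t ↦ densRep p (energyDensity c (DefiniteConnection.addForm A t a)) y)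
      (densRep p (fun x v ↦ inner₂ c A (twistedCurvature c A) (covExtDeriv A a) x *
        |volForm c A x v|) y) 0 := by
  have htr := (h.trace_ne_zero hy hA).1
  simp only [h.densRep_energyDensity hc a hy]
  refine (hasDerivAt_trace_sq_div_abs_trace (curvRep γ y) (extRep γ (L.oneRep a) y)
    (fun u v ↦ L.oneRep a y u ⨯₃ L.oneRep a y v) stdR4 htr c).congr_deriv ?_
  let S : R4 →ₗ[ℝ] R4 →ₗ[ℝ] (Fin 3 → ℝ) := (curvRepₗ γ y).compr₂ (bMat (curvMat γ y)).mulVecLin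
  let R := extRepₗ γ (L.oneRep a) y
  have h1 := h.inner₂_eq hy hA hc (S := twistedCurvature c A) (R := covExtDeriv A a) (S' := S)
    (R' := R) (h.twistedCurvature_eq hy hc.ne') (h.covExtDeriv_eq a hy)
  have hneg : ∀ {G : R4 →ₗ[ℝ] R4 →ₗ[ℝ] (Fin 3 → ℝ)}, (∀ u v, G u v = -G v u) →
      ∀ u v, pushForm hy.1 G u v = -pushForm hy.1 G v u := by
    intro G hG u v
    obtain ⟨u, rfl⟩ := exists_coordMap hy.1 u
    obtain ⟨v, rfl⟩ := exists_coordMap hy.1 v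
    rw [pushForm_apply, pushForm_apply, hG]
  have hS : ∀ u v, S u v = -S v u := fun u v ↦ by
    change bMat (curvMat γ y) *ᵥ curvRep γ y u v = -(bMat (curvMat γ y) *ᵥ curvRep γ y v u)
    rw [curvRep_neg, Matrix.mulVec_neg]
  have h2 := (h.isTripleMetric_gA hy hA hc).mul_inner_eq_wedge (coordBasis hy.1) (pushForm_neg hy)
    (hneg hS) (hneg (G := R) (extRep_neg γ (L.oneRep a) y)) ⟨(bMat (curvMat γ y)).mulVecLin, fun u v ↦ rfl⟩
  simp only [coe_coordBasis, h.gram_gA hy hA hc, wedgeMatrix_pushForm hy, wedge, ← coordMap_single,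
    pushForm_apply] at h2
  have hS' : ∀ u v, S u v = bMat (curvMat γ y) *ᵥ curvRep γ y u v := fun u v ↦ rfl
  have hR' : ∀ u v, R u v = extRep γ (L.oneRep a) y u v := fun u v ↦ rfl
  have hM : wedgeMatrix (curvRep γ y) stdR4 = curvMat γ y := rfl
  rw [densRep, h.volForm_eq hy, h1, abs_mul, abs_of_pos (show 0 < 2 * c / 3 by positivity),
    ← self_mul_sign, hM]
  simp only [hS', hR'] at h2 ⊢
  simp only [wedge]
  linear_combination -(2 * c * SignType.sign (curvMat γ y).trace) * h2

end EnergyDensity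

/-! ### The gradient -/

section Gradient

open scoped Matrix
open MeasureTheory

variable {X : Type*} [TopologicalSpace X] [ChartedSpace R4 X] [IsManifold (𝓡 4) ∞ X]
  {V : X → Type*} [TopologicalSpace (TotalSpace R3 V)]
  [∀ x, NormedAddCommGroup (V x)] [∀ x, InnerProductSpace ℝ (V x)]
  [FiberBundle R3 V] [VectorBundle ℝ R3 V]
  [ContMDiffVectorBundle ∞ R3 V (𝓡 4)] [IsContMDiffRiemannianBundle (𝓡 4) ∞ R3 V]
  {A : CovariantDerivative (𝓡 4) R3 V} (hA : IsDefinite A) {c : ℝ} (hc : 0 < c)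
include hA hc

/-- The pointwise inner product on 1-forms is positive definite, as a sum of squares in an orthonormal
basis for `g_A`. -/
lemma ChartFrame.IsConnRep.inner₁_self {p : X} {L : ChartFrame V p}
    {γ : R4 → R4 →L[ℝ] (Fin 3 → ℝ)} (h : L.IsConnRep A γ) (a : OneForm V) {y : R4} (hy : y ∈ L.dom) :
    0 ≤ inner₁ c A a a ((extChartAt (𝓡 4) p).symm y) ∧
      (inner₁ c A a a ((extChartAt (𝓡 4) p).symm y) = 0 → L.oneRep a y = 0) := by
  obtain ⟨e, he, -⟩ := (h.isTripleMetric_gA hy hA hc).exists_oriented_basis (coordBasis hy.1)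
  let ℓ : TangentSpace (𝓡 4) ((extChartAt (𝓡 4) p).symm y) →ₗ[ℝ] (Fin 3 → ℝ) :=
    (L.oneRep a y).toLinearMap ∘ₗ (coordEquiv hy.1).symm.toLinearMap
  have hℓ : ∀ w, ℓ (coordMap p y w) = L.oneRep a y w := fun w ↦ by
    rw [← coordEquiv_apply hy.1]
    exact congrArg (L.oneRep a y) ((coordEquiv hy.1).symm_apply_apply w)
  have h1 := sum_gram_inv_mul he (coordBasis hy.1) ((2 * c) • dotₗ.compl₁₂ ℓ ℓ)
  have h2 : inner₁ c A a a ((extChartAt (𝓡 4) p).symm y) = ∑ i, 2 * c * (ℓ (e i) ⬝ᵥ ℓ (e i)) := by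
    rw [h.inner₁_eq hy hA hc]
    refine Eq.trans ?_ h1
    rw [coe_coordBasis, h.gram_gA hy hA hc]
    simp only [← hℓ]
    rfl
  have hnn : ∀ i, 0 ≤ 2 * c * (ℓ (e i) ⬝ᵥ ℓ (e i)) := fun i ↦
    mul_nonneg (by positivity) (Finset.sum_nonneg fun _ _ ↦ mul_self_nonneg _)
  refine ⟨h2 ▸ Finset.sum_nonneg fun i _ ↦ hnn i, fun h0 ↦ ?_⟩
  rw [h2, Finset.sum_eq_zero_iff_of_nonneg fun i _ ↦ hnn i] at h0
  have h3 : ℓ = 0 := e.ext fun i ↦ by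
    have := h0 i (Finset.mem_univ i)
    rw [mul_eq_zero, dotProduct_self_eq_zero] at this
    exact this.resolve_left (by positivity)
  ext1 w
  rw [← hℓ, h3]
  rfl

variable [T2Space X]

lemma inner₁_self_nonneg (a : OneForm V) (x : X) : 0 ≤ inner₁ c A a a x := by
  obtain ⟨p, L, y, hy, rfl⟩ := exists_chartFrame_at V x
  obtain ⟨γ, h⟩ := L.exists_isConnRep hA.metric hA.smooth
  exact (h.inner₁_self hA hc a hy).1

variable [CompactSpace X]

/-- The `L²` inner product is positive definite: the integrand is continuous and non-negative. -/
lemma toFun_eq_zero_of_innerL2_self (a : OneForm V) (h0 : innerL2 c A a a = 0) (x : X) :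
    a.toFun x = 0 := by
  have hδ := isContDensity_inner₁ hA hc a a
  set δ : Π x : X, (Fin 4 → TangentSpace (𝓡 4) x) → ℝ :=
    fun x v ↦ inner₁ c A a a x * |volForm c A x v|
  have hnn : ∀ p y, 0 ≤ chartPartition X p ((extChartAt (𝓡 4) p).symm y) * densRep p δ y :=
    fun p y ↦ mul_nonneg ((chartPartition X).nonneg _ _)
      (mul_nonneg (inner₁_self_nonneg hA hc a _) (abs_nonneg _))
  rw [innerL2, integral, integrateDensity_eq_sum,
    Finset.sum_eq_zero_iff_of_nonneg fun p _ ↦ integral_nonneg fun y ↦ hnn p y] at h0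
  obtain ⟨p, hp, hpx⟩ : ∃ p ∈ chartPartition_support.toFinset, chartPartition X p x ≠ 0 := by
    by_contra! hne
    have := chartPartition_sum x
    rw [Finset.sum_eq_zero hne] at this
    exact zero_ne_one this
  have hxp : x ∈ (chartAt R4 p).source := chartPartition_tsupport p (subset_tsupport _ hpx)
  obtain ⟨L, hL⟩ := exists_chartFrame (V := V) p x hxp
  obtain ⟨hy, hyx⟩ := L.exists_dom hL
  have h1 := (setIntegral_eq_zero_iff_of_nonneg_ae (ae_of_all _ fun y ↦ hnn p y)
    (integrableOn_chartPartition p (hδ.cont p))).mp (h0 p hp)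
  -- A continuous function which vanishes almost everywhere on an open set vanishes on it.
  have h2 := Measure.eqOn_open_of_ae_eq h1 (isOpen_extChartAt_target p)
    (((chartPartition X p).contMDiff.continuous.comp_continuousOn
      (continuousOn_extChartAt_symm p)).mul (hδ.cont p)) continuousOn_const hy.1
  generalize extChartAt (𝓡 4) p x = y at hy hyx h2
  subst hyx
  obtain ⟨γ, h⟩ := L.exists_isConnRep hA.metric hA.smooth
  have h3 : inner₁ c A a a ((extChartAt (𝓡 4) p).symm y) * |volForm c A _ (coordField p y)| = 0 :=
    (mul_eq_zero.mp h2).resolve_left hpx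
  have h4 : |volForm c A _ (coordField p y)| ≠ 0 := by
    rw [h.volForm_eq hy, abs_mul]
    exact (h.volRep_pos hA hc hy).ne'
  have h5 := (h.inner₁_self hA hc a hy).2 ((mul_eq_zero.mp h3).resolve_right h4)
  ext s u
  obtain ⟨u, rfl⟩ := exists_coordMap hy.1 u
  refine L.coord_injective hy.2 ?_
  rw [L.coord_oneForm a hy, h5]
  exact Eq.trans (b := (0 : Fin 3 → ℝ)) (by simp) (map_zero (L.coord _)).symm

/-- The first variation of the energy. -/
lemma hasDerivAt_energy (a : OneForm V) :
    HasDerivAt (fun t ↦ energy c (addForm A t a))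
      (integral c A (inner₂ c A (twistedCurvature c A) (covExtDeriv A a))) 0 := by
  have h0 : (fun t ↦ energy c (addForm A t a)) = fun t ↦ ∑ p ∈ chartPartition_support.toFinset,
      ∫ y in (extChartAt (𝓡 4) p).target, chartPartition X p ((extChartAt (𝓡 4) p).symm y) *
        densRep p (energyDensity c (addForm A t a)) y :=
    funext fun t ↦ integrateDensity_eq_sum (energyDensity c (addForm A t a))
  rw [h0, integral, integrateDensity_eq_sum]
  -- The partition of unity does not depend on the connection; it cuts off each integrand to a compact
  -- subset of a chart.
  refine HasDerivAt.fun_sum fun p _ ↦ ?_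
  have hs : tsupport (chartPartition X p) ⊆ (extChartAt (𝓡 4) p).source := by
    simpa using chartPartition_tsupport p
  have hKt : extChartAt (𝓡 4) p '' tsupport (chartPartition X p) ⊆ (extChartAt (𝓡 4) p).target :=
    Set.image_subset_iff.mpr fun x hx ↦ (extChartAt (𝓡 4) p).map_source (hs hx)
  refine hasDerivAt_setIntegral_mul (isOpen_extChartAt_target p).measurableSet
    ((isClosed_tsupport _).isCompact.image_of_continuousOn ((continuousOn_extChartAt p).mono hs)) hKt
    (((chartPartition X p).contMDiff.continuous.comp_continuousOn
      (continuousOn_extChartAt_symm p)).mono hKt) (fun y hy hyK ↦ ?_)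
    (E := fun z ↦ densRep p (energyDensity c (addForm A z.1 a)) z.2) (fun y hy ↦ ?_) fun y hy ↦ ?_
  · exact image_eq_zero_of_notMem_tsupport (f := chartPartition X p) fun hx ↦
      hyK ⟨_, hx, (extChartAt (𝓡 4) p).right_inv hy⟩
  all_goals
    obtain ⟨L, hL⟩ := exists_chartFrame_dom V (hKt hy)
    obtain ⟨γ, h⟩ := L.exists_isConnRep hA.metric hA.smooth
  · exact h.contDiffAt_densRep_energyDensity hA hc a hL
  · exact h.hasDerivAt_densRep_energyDensity hA hc a hL

/-- The gradient of the energy. -/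
lemma isGradient_iff (ξ : OneForm V) :
    IsGradient c A ξ ↔ ξ = dAdjoint c A (twistedCurvature c A) := by
  have hadj := isAdjointValue_dAdjoint hA hc (isTwoForm_twistedCurvature hA hc.ne')
  set ξ' := dAdjoint c A (twistedCurvature c A)
  refine ⟨fun hξ ↦ ?_, ?_⟩
  · have h1 : ∀ a, innerL2 c A ξ a = innerL2 c A ξ' a := fun a ↦ by
      rw [hadj a]
      exact (hξ a).unique (hasDerivAt_energy hA hc a)
    have h2 : innerL2 c A (ξ.addSMul ξ' (-1)) (ξ.addSMul ξ' (-1)) = 0 := by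
      rw [innerL2_addSMul_left hA hc, h1]
      ring
    have h3 : ξ.toFun = ξ'.toFun := funext fun x ↦ by
      have h4 : ξ.toFun x + (-1 : ℝ) • ξ'.toFun x = 0 := toFun_eq_zero_of_innerL2_self hA hc _ h2 x
      ext s u
      have h5 : ξ.toFun x s u + (-1 : ℝ) • ξ'.toFun x s u = 0 := congrArg (fun T ↦ T s u) h4
      rwa [neg_one_smul ℝ, ← sub_eq_add_neg, sub_eq_zero] at h5
    cases hξ₁ : ξ
    cases hξ₂ : ξ'
    rw [hξ₁, hξ₂] at h3
    cases h3
    rfl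
  · rintro rfl a
    rw [hadj a]
    exact hasDerivAt_energy hA hc a

end Gradient

end DefiniteConnection

theorem mainTheorem8
    {X : Type*} [TopologicalSpace X] [T2Space X] [CompactSpace X]
    [ChartedSpace (EuclideanSpace ℝ (Fin 4)) X] [IsManifold (𝓡 4) ∞ X]
    {V : X → Type*} [TopologicalSpace (TotalSpace (EuclideanSpace ℝ (Fin 3)) V)]
    [∀ x, NormedAddCommGroup (V x)] [∀ x, InnerProductSpace ℝ (V x)]
    [FiberBundle (EuclideanSpace ℝ (Fin 3)) V] [VectorBundle ℝ (EuclideanSpace ℝ (Fin 3)) V]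
    [ContMDiffVectorBundle ∞ (EuclideanSpace ℝ (Fin 3)) V (𝓡 4)]
    [IsContMDiffRiemannianBundle (𝓡 4) ∞ (EuclideanSpace ℝ (Fin 3)) V]
    (c : ℝ) (hc : 0 < c) :
    (∀ A : CovariantDerivative (𝓡 4) (EuclideanSpace ℝ (Fin 3)) V,
      DefiniteConnection.IsDefinite A →
        -- the metric `g_A` is well defined
        (∀ x, ∃! g, DefiniteConnection.IsMetricOf c A x g) ∧
        -- `d_A^*` is well defined, and `B_A(F_A)` lies in its domain
        (∀ β, DefiniteConnection.IsTwoForm β →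
          DefiniteConnection.IsAdjointValue c A β (DefiniteConnection.dAdjoint c A β)) ∧
        DefiniteConnection.IsTwoForm (DefiniteConnection.twistedCurvature c A) ∧
        -- the gradient of the energy at `A` is `d_A^* (B_A(F_A))`
        ∀ ξ : DefiniteConnection.OneForm V, DefiniteConnection.IsGradient c A ξ ↔
          ξ = DefiniteConnection.dAdjoint c A (DefiniteConnection.twistedCurvature c A)) ∧
    -- the equation of the downward gradient flow
    ∀ (J : Set ℝ) (A : ℝ → CovariantDerivative (𝓡 4) (EuclideanSpace ℝ (Fin 3)) V),
      J.OrdConnected → J.Nontrivial →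
        (DefiniteConnection.IsDownwardGradientFlow c A J ↔
          ∀ t ∈ J, DefiniteConnection.IsDefinite (A t) ∧
            DefiniteConnection.HasTimeDeriv A J t fun x ↦
              -(DefiniteConnection.dAdjoint c (A t)
                (DefiniteConnection.twistedCurvature c (A t))).toFun x) := by
  refine ⟨fun A hA ↦ ⟨fun x ↦ ?_, fun β hβ ↦ DefiniteConnection.isAdjointValue_dAdjoint hA hc hβ,
    DefiniteConnection.isTwoForm_twistedCurvature hA hc.ne',
    DefiniteConnection.isGradient_iff hA hc⟩, fun J A _ _ ↦ ⟨fun h t ht ↦ ?_, fun h t ht ↦ ?_⟩⟩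
  · obtain ⟨p, L, y, hy, rfl⟩ := DefiniteConnection.exists_chartFrame_at V x
    obtain ⟨γ, h⟩ := L.exists_isConnRep hA.metric hA.smooth
    exact h.existsUnique_metric hy hA hc
  · obtain ⟨hA, ξ, hξ, hd⟩ := h t ht
    rw [DefiniteConnection.isGradient_iff hA hc] at hξ
    exact ⟨hA, hξ ▸ hd⟩
  · obtain ⟨hA, hd⟩ := h t ht
    exact ⟨hA, _, (DefiniteConnection.isGradient_iff hA hc _).mpr rfl, hd⟩
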